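/- **Ribbon graphs.** A ribbon graph with flags $G$ is given by a finite set $X$ of crosses and permutations $(\sigma_0,\theta,\sigma_1)$ of $X$ with $\theta^2=\sigma_1^2=1$, $\theta\sigma_1=\sigma_1\theta$, $\theta x\ne x$, $\theta x\neq\sigma_1x$, $\sigma_0\theta=\theta\sigma_0^{-1}$, and $x,\theta x$ in different cycles of $\sigma_0$ for every $x$, together with a finite number of isolated vertices without half-ribbons. Half-ribbons are the pairs $\{x,\theta x\}$; they are flags if $\sigma_1x=x$, half-edges otherwise; the set $E(G)$ of edges consists of the orbits $\{x,\theta x,\sigma_1x,\sigma_1\theta x\}$ of non-fixed points of $\sigma_1$; vertices are the pairs of conjugate cycles of $\sigma_0$ through $x$ and $\theta x$, and the additional isolated vertices; $v(G)$ is their number. For $A\subset E(G)$ the partial dual is $G^A=(\sigma_0\theta_A\sigma_{1A},\ \sigma_{1A}\theta_{A^c},\ \sigma_{1A^c}\theta_A)$, where $\phi_A$ (resp. $\phi_{A^c}$) is $\phi$ on the crosses of edges in $A$ (resp. on all other crosses) and the identity elsewhere; it has the same edges and flags as $G$, and the same isolated vertices without half-ribbons. $G$ is *orientable* if one can choose one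 of the two conjugate cycles at each vertex so that no edge is twisted, i.e. there is $X^+\subset X$ stable under $\sigma_0$, exchanged with its complement by $\theta$, and with $\sigma_1x\in X^+\Leftrightarrow x\notin X^+$ for $x$ not on a flag. **The polynomial $\mathcal Q$.** For families $x,y,z,w$ indexed by $E(G)$ and a sequence $r=(r_n)_{n\ge0}$, $$\mathcal Q_G(x,y,z,w,r)=\sum_{A\subset E(G)}\ \sum_{B\subset E(G^A)}\ \prod_{e\in A^c\cap B^c}x_e\prod_{e\in A\cap B^c}y_e\prod_{e\in A\cap B}z_e\prod_{e\in A^c\cap B}w_e\ \prod_{v\in V(G^A)}r_{d_B(v)},$$ where $d_B(v)$ is the number of half-ribbons at $v$ in $G^A$ that are flags or halves of edges in $B$. **The first hyperbolic polynomial.** Let $G$ be orientable and oriented. Represent each vertex of $G$ by a plane tree with at least one inner vertex, all inner vertices of degree $3$ ("triangles"), whose edges are called corners; the half-ribbons at the vertex are attached, in their cyclic order, to distinct corners ending at leaves (the other leaves may be free). Corners attached to flags are external, the others internal. Direct each edge of $G$ arbitrarily. Let $\alpha$ be the antisymmetric matrix on the internal corners with $\alpha_{ij}=1$ (resp. $-1$)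 if $j$ follows (resp. precedes) $i$ counterclockwise in a triangle and $0$ otherwise; let $\epsilon_{ei}=1$ (resp. $-1$, $0$) if $e$ arrives at (resp. leaves, is not attached to) the internal corner $i$. With rows and columns indexed by $(u_e,v_e,\lambda_e,\mu_e,y_i)$ put $$D=\mathrm{diag}\big(\tfrac{\Omega_e}{t_e},\ \Omega_et_e,\ 0,\ 0,\ 0\big),\qquad R=\begin{pmatrix}0&0&I&0&0\\0&0&0&I&0\\-I&0&0&0&\frac{1}{\sqrt2}\epsilon\\0&-I&0&0&\frac1{\sqrt2}|\epsilon|\\0&0&-\frac1{\sqrt2}{}^t\epsilon&-\frac1{\sqrt2}{}^t|\epsilon|&\alpha\end{pmatrix},$$ $$\mathrm{HU}_G(\Omega,t)=2^{v(G)}\Big(\prod_{e\in E(G)}t_e\Big)\det(D+R).$$ **Theorem.** For every orientable ribbon graph with flags $G$, and whatever orientation of $G$, representing trees and directions of edges are chosen, $$\mathrm{HU}_G(\Omega,t)=\mathcal Q_G(t,\Omega,\Omega t^2,t\Omega^2,r),\qquad r_{2n+1}=2,\quad r_{2n}=0,$$ or explicitly $$\mathrm{HU}_G(\Omega,t)=\sum_{\substack{A,B\subset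 E(G)\\ (A,B)\text{ admissible}}}2^{v(G^A)}\prod_{e\in A^c\cap B^c}t_e\prod_{e\in A^c\cap B}t_e\Omega_e^2\prod_{e\in A\cap B^c}\Omega_e\prod_{e\in A\cap B}\Omega_et_e^2,$$ where $(A,B)$ is admissible if each vertex of the graph obtained from $G^A$ by cutting the edges in $B$ (replacing each by two flags) and deleting those in $B^c$ has an odd number of flags. These identities hold for all values $\Omega_e$, $t_e\neq0$ in any field $K\supseteq\mathbb R$; in particular for indeterminates, i.e. as polynomial identities. -/

import Mathlib

universe u v w

/-- A ribbon graph with flags, given as a combinatorial map on a set `X` of crosses, together with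
a number `bare` of isolated vertices carrying no half-ribbon at all (such vertices are invisible
in the crosses, but occur as ribbon graphs, e.g. after deleting edges). -/
structure RibbonGraph (X : Type u) where
  σ₀ : Equiv.Perm X
  θ : Equiv.Perm X
  σ₁ : Equiv.Perm X
  θ_sq : ∀ x, θ (θ x) = x
  σ₁_sq : ∀ x, σ₁ (σ₁ x) = x
  θ_σ₁ : ∀ x, θ (σ₁ x) = σ₁ (θ x)
  θ_ne : ∀ x, θ x ≠ x
  θ_ne_σ₁ : ∀ x, θ x ≠ σ₁ x
  σ₀_θ : σ₀ * θ = θ * σ₀⁻¹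
  not_sameCycle : ∀ x, ¬ σ₀.SameCycle x (θ x)
  bare : ℕ

namespace RibbonGraph

variable {X : Type u}

/-- `{x, θ x}` is a flag. -/
def IsFlag (G : RibbonGraph X) (x : X) : Prop := G.σ₁ x = x

instance [DecidableEq X] (G : RibbonGraph X) (x : X) : Decidable (G.IsFlag x) :=
  inferInstanceAs (Decidable (G.σ₁ x = x))

section Basic

variable [DecidableEq X]

/-- The half-ribbon (flag or half-edge) through a cross. -/
def halfRibbonOf (G : RibbonGraph X) (x : X) : Finset X := {x, G.θ x}

/-- The orbit of a cross under the group generated by `θ` and `σ₁`. -/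
def edgeOf (G : RibbonGraph X) (x : X) : Finset X := {x, G.θ x, G.σ₁ x, G.σ₁ (G.θ x)}

theorem edgeOf_θ (G : RibbonGraph X) (x : X) : G.edgeOf (G.θ x) = G.edgeOf x := by
  ext y
  simp only [edgeOf, G.θ_sq, Finset.mem_insert, Finset.mem_singleton]
  tauto

theorem edgeOf_σ₁ (G : RibbonGraph X) (x : X) : G.edgeOf (G.σ₁ x) = G.edgeOf x := by
  ext y
  simp only [edgeOf, G.θ_σ₁, G.σ₁_sq, Finset.mem_insert, Finset.mem_singleton]
  tauto

/-- The cross `x` lies on an edge belonging to `A`. -/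
def OnEdge (G : RibbonGraph X) (A : Finset (Finset X)) (x : X) : Prop :=
  ¬ G.IsFlag x ∧ G.edgeOf x ∈ A

instance (G : RibbonGraph X) (A : Finset (Finset X)) (x : X) : Decidable (G.OnEdge A x) :=
  inferInstanceAs (Decidable (_ ∧ _))

theorem onEdge_θ (G : RibbonGraph X) (A : Finset (Finset X)) (x : X) :
    G.OnEdge A (G.θ x) ↔ G.OnEdge A x := by
  simp only [OnEdge, edgeOf_θ, IsFlag, ← G.θ_σ₁, EmbeddingLike.apply_eq_iff_eq]

theorem onEdge_σ₁ (G : RibbonGraph X) (A : Finset (Finset X)) (x : X) :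
    G.OnEdge A (G.σ₁ x) ↔ G.OnEdge A x := by
  simp only [OnEdge, edgeOf_σ₁, IsFlag, EmbeddingLike.apply_eq_iff_eq]

/-- `θ_A`: equal to `θ` on the crosses of the edges in `A` and to the identity elsewhere. -/
def θOn (G : RibbonGraph X) (A : Finset (Finset X)) : Equiv.Perm X :=
  Function.Involutive.toPerm (fun x => if G.OnEdge A x then G.θ x else x) (by
    intro x
    by_cases h : G.OnEdge A x <;> simp [h, onEdge_θ, G.θ_sq])

/-- `θ_{Aᶜ}`: equal to `θ` on all the crosses (those of flags included) outside the edges in `A`,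
and to the identity on the crosses of the edges in `A`. -/
def θOff (G : RibbonGraph X) (A : Finset (Finset X)) : Equiv.Perm X :=
  Function.Involutive.toPerm (fun x => if G.OnEdge A x then x else G.θ x) (by
    intro x
    by_cases h : G.OnEdge A x <;> simp [h, onEdge_θ, G.θ_sq])

/-- `σ₁` restricted to the crosses of the edges in `A`. -/
def σ₁On (G : RibbonGraph X) (A : Finset (Finset X)) : Equiv.Perm X :=
  Function.Involutive.toPerm (fun x => if G.OnEdge A x then G.σ₁ x else x) (by
    intro x
    by_cases h : G.OnEdge A x <;> simp [h, onEdge_σ₁, G.σ₁_sq])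

/-- `σ₁` restricted to the crosses outside the edges in `A`. -/
def σ₁Off (G : RibbonGraph X) (A : Finset (Finset X)) : Equiv.Perm X :=
  Function.Involutive.toPerm (fun x => if G.OnEdge A x then x else G.σ₁ x) (by
    intro x
    by_cases h : G.OnEdge A x <;> simp [h, onEdge_σ₁, G.σ₁_sq])

theorem θOn_apply (G : RibbonGraph X) (A : Finset (Finset X)) (x : X) :
    G.θOn A x = if G.OnEdge A x then G.θ x else x := rfl

theorem θOff_apply (G : RibbonGraph X) (A : Finset (Finset X)) (x : X) :
    G.θOff A x = if G.OnEdge A x then x else G.θ x := rfl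

theorem σ₁On_apply (G : RibbonGraph X) (A : Finset (Finset X)) (x : X) :
    G.σ₁On A x = if G.OnEdge A x then G.σ₁ x else x := rfl

theorem σ₁Off_apply (G : RibbonGraph X) (A : Finset (Finset X)) (x : X) :
    G.σ₁Off A x = if G.OnEdge A x then x else G.σ₁ x := rfl

end Basic

theorem σ₀_θ_σ₀ (G : RibbonGraph X) (x : X) : G.σ₀ (G.θ (G.σ₀ x)) = G.θ x := by
  have h := congrArg (fun f : Equiv.Perm X => f (G.σ₀ x)) G.σ₀_θ
  simpa using h

theorem σ₀_ne_θ (G : RibbonGraph X) (x : X) : G.σ₀ x ≠ G.θ x := by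
  intro h
  exact G.not_sameCycle x ⟨1, by simpa using h⟩

/-- If `σ θ = θ σ⁻¹` with `θ` an involution, and neither `θ` nor `θ σ` has a fixed point, then the
cycles of `σ` through `x` and `θ x` are distinct. -/
theorem not_sameCycle_of_fixedPointFree (s t : Equiv.Perm X) (ht : ∀ x, t x ≠ x)
    (hst : s * t = t * s⁻¹) (hne : ∀ x, s x ≠ t x) (x : X) : ¬ s.SameCycle x (t x) := by
  have hpow : ∀ k : ℤ, t * s ^ k = s ^ (-k) * t := by
    intro k
    have h1 : SemiconjBy t s⁻¹ s := hst.symm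
    have h2 : SemiconjBy t ((s⁻¹) ^ (-k)) (s ^ (-k)) := h1.zpow_right (-k)
    have h3 : (s⁻¹) ^ (-k) = s ^ k := by simp
    rw [h3] at h2
    exact h2
  rintro ⟨k, hk⟩
  rcases Int.even_or_odd' k with ⟨m, rfl | rfl⟩
  · apply ht ((s ^ m) x)
    have := congrArg (fun f : Equiv.Perm X => f x) (hpow m)
    simp only [Equiv.Perm.coe_mul, Function.comp_apply] at this
    rw [this, ← hk, ← Equiv.Perm.mul_apply, ← zpow_add]
    congr 2
    ring
  · apply hne ((s ^ m) x)
    have := congrArg (fun f : Equiv.Perm X => f x) (hpow m)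
    simp only [Equiv.Perm.coe_mul, Function.comp_apply] at this
    rw [this, ← hk, ← Equiv.Perm.mul_apply, ← Equiv.Perm.mul_apply, ← zpow_add, ← zpow_one_add]
    congr 2
    ring

section Dual

variable [DecidableEq X]

theorem dual_aux₁ (G : RibbonGraph X) (A : Finset (Finset X)) (y : X) :
    G.σ₀ (G.θOn A (G.σ₁On A (G.σ₁On A (G.θOff A y)))) = G.σ₀ (G.θ y) := by
  by_cases h : G.OnEdge A y <;>
    simp [σ₁On_apply, θOff_apply, θOn_apply, h, onEdge_θ, onEdge_σ₁, G.σ₁_sq]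

theorem dual_aux₂ (G : RibbonGraph X) (A : Finset (Finset X)) (x : X) :
    G.θ (G.θOn A (G.σ₁On A x)) = G.σ₁On A (G.θOff A x) := by
  by_cases h : G.OnEdge A x <;>
    simp [σ₁On_apply, θOff_apply, θOn_apply, h, onEdge_θ, onEdge_σ₁, G.θ_sq]

/-- The partial dual `G^A = (σ₀ θ_A σ₁_A, σ₁_A θ_{Aᶜ}, σ₁_{Aᶜ} θ_A)`. It has the same crosses as
`G` and, as sets of crosses, the same edges and the same flags. -/
def partialDual (G : RibbonGraph X) (A : Finset (Finset X)) : RibbonGraph X where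
  σ₀ := G.σ₀ * G.θOn A * G.σ₁On A
  θ := G.σ₁On A * G.θOff A
  σ₁ := G.σ₁Off A * G.θOn A
  θ_sq x := by
    by_cases h : G.OnEdge A x <;>
      simp [σ₁On_apply, θOff_apply, h, onEdge_θ, onEdge_σ₁, G.θ_sq, G.σ₁_sq]
  σ₁_sq x := by
    by_cases h : G.OnEdge A x <;>
      simp [σ₁Off_apply, θOn_apply, h, onEdge_θ, onEdge_σ₁, G.θ_sq, G.σ₁_sq]
  θ_σ₁ x := by
    by_cases h : G.OnEdge A x <;>
      simp [σ₁On_apply, θOff_apply, σ₁Off_apply, θOn_apply, h, onEdge_θ, onEdge_σ₁, G.θ_σ₁]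
  θ_ne x := by
    by_cases h : G.OnEdge A x
    · simpa [σ₁On_apply, θOff_apply, h, IsFlag] using h.1
    · simpa [σ₁On_apply, θOff_apply, h, onEdge_θ] using G.θ_ne x
  θ_ne_σ₁ x := by
    by_cases h : G.OnEdge A x
    · simpa [σ₁On_apply, θOff_apply, σ₁Off_apply, θOn_apply, h, onEdge_θ] using
        (G.θ_ne_σ₁ x).symm
    · simpa [σ₁On_apply, θOff_apply, σ₁Off_apply, θOn_apply, h, onEdge_θ] using G.θ_ne_σ₁ x
  σ₀_θ := by
    rw [eq_mul_inv_iff_mul_eq]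
    ext x
    have h1 := G.dual_aux₁ A (G.σ₀ (G.θOn A (G.σ₁On A x)))
    have h2 := G.dual_aux₂ A x
    simp only [Equiv.Perm.coe_mul, Function.comp_apply]
    rw [h1, σ₀_θ_σ₀, h2]
  not_sameCycle := by
    apply not_sameCycle_of_fixedPointFree
    · intro x
      by_cases h : G.OnEdge A x
      · simpa [σ₁On_apply, θOff_apply, h, IsFlag] using h.1
      · simpa [σ₁On_apply, θOff_apply, h, onEdge_θ] using G.θ_ne x
    · rw [eq_mul_inv_iff_mul_eq]
      ext x
      have h1 := G.dual_aux₁ A (G.σ₀ (G.θOn A (G.σ₁On A x)))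
      have h2 := G.dual_aux₂ A x
      simp only [Equiv.Perm.coe_mul, Function.comp_apply]
      rw [h1, σ₀_θ_σ₀, h2]
    · intro x h
      simp only [Equiv.Perm.coe_mul, Function.comp_apply] at h
      rw [← G.dual_aux₂ A x] at h
      exact G.σ₀_ne_θ _ h
  bare := G.bare

end Dual

section Finite

variable [Fintype X] [DecidableEq X]

/-- `E(G)`: every edge is a set of four crosses. -/
def edges (G : RibbonGraph X) : Finset (Finset X) :=
  (Finset.univ.filter fun x => ¬ G.IsFlag x).image G.edgeOf

/-- The union of the two conjugate cycles of `σ₀` through `x` and `θ x`. -/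
def vertexOf (G : RibbonGraph X) (x : X) : Finset X :=
  Finset.univ.filter fun y => G.σ₀.SameCycle x y ∨ G.σ₀.SameCycle (G.θ x) y

/-- The vertices that carry at least one half-ribbon. -/
def vertices (G : RibbonGraph X) : Finset (Finset X) := Finset.univ.image G.vertexOf

/-- `V(G)`. -/
abbrev Vertex (G : RibbonGraph X) : Type u := {v : Finset X // v ∈ G.vertices} ⊕ Fin G.bare

/-- `v(G)`. -/
def numVertices (G : RibbonGraph X) : ℕ := Fintype.card G.Vertex

/-- The degree of a vertex in the spanning subgraph of `G` with edge set `B` and with all the flags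
of `G`, i.e. the number of its half-ribbons that are flags of `G` or halves of edges in `B`.
This is also its number of flags once the edges in `B` are cut and all the other edges are
deleted. -/
def degree (G : RibbonGraph X) (B : Finset (Finset X)) : G.Vertex → ℕ
  | Sum.inl v => ((v.1.filter fun x => G.IsFlag x ∨ G.OnEdge B x).image G.halfRibbonOf).card
  | Sum.inr _ => 0

/-- The polynomial `𝒬_G(x, y, z, w, r)`. -/
def Q {R : Type w} [CommSemiring R] (G : RibbonGraph X) (x y z w : Finset X → R) (r : ℕ → R) : R :=
  ∑ A ∈ G.edges.powerset, ∑ B ∈ (G.partialDual A).edges.powerset,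
    (∏ e ∈ (G.edges \ A) ∩ (G.edges \ B), x e) * (∏ e ∈ A ∩ (G.edges \ B), y e) *
      (∏ e ∈ A ∩ B, z e) * (∏ e ∈ (G.edges \ A) ∩ B, w e) *
        ∏ v : (G.partialDual A).Vertex, r ((G.partialDual A).degree B v)

/-- `(A, B)` is admissible if every vertex of the graph obtained from `G^A` by cutting the edges in
`B` and deleting the other ones has an odd number of flags. -/
def Admissible (G : RibbonGraph X) (A B : Finset (Finset X)) : Prop :=
  ∀ v : (G.partialDual A).Vertex, Odd ((G.partialDual A).degree B v)

instance (G : RibbonGraph X) (A B : Finset (Finset X)) : Decidable (G.Admissible A B) :=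
  inferInstanceAs (Decidable (∀ _ : (G.partialDual A).Vertex, Odd _))

/-- An orientation of the ribbon surface: the choice of one of the two conjugate cycles at every
vertex (its counterclockwise boundary) in such a way that no edge is twisted. -/
structure Orientation (G : RibbonGraph X) where
  pos : Finset X
  σ₀_mem : ∀ x, G.σ₀ x ∈ pos ↔ x ∈ pos
  θ_mem : ∀ x, G.θ x ∈ pos ↔ x ∉ pos
  σ₁_mem : ∀ x, ¬ G.IsFlag x → (G.σ₁ x ∈ pos ↔ x ∉ pos)

end Finite

end RibbonGraph

/-- Plane trees all of whose inner vertices have degree `3`, with edges labelled by `C`, rooted at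
an edge: `leaf i` is an edge `i` ending at a leaf; `node i l r` is an edge `i` ending at an inner
vertex whose incident edges are, counterclockwise, `i`, the root edge of `l`, the root edge of `r`.
The edges are the corners, and the inner vertices are the triangles, of a representation of a
Moyal vertex by triangles. -/
inductive PlaneTree (C : Type v) : Type v
  | leaf (i : C) : PlaneTree C
  | node (i : C) (l r : PlaneTree C) : PlaneTree C

namespace PlaneTree

variable {C : Type v}

/-- The label of the root edge. -/
def root : PlaneTree C → C
  | leaf i => i
  | node i _ _ => i

/-- All the edge labels. -/
def labels : PlaneTree C → List C
  | leaf i => [i]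
  | node i l r => i :: (l.labels ++ r.labels)

/-- The labels of the edges ending at a leaf other than the lower end of the root edge, in
counterclockwise order. -/
def frontier : PlaneTree C → List C
  | leaf i => [i]
  | node _ l r => l.frontier ++ r.frontier

/-- The labels of the edges attached to the leaves, in counterclockwise order around a tree whose
root edge has a leaf as its lower end. -/
def leaves : PlaneTree C → List C
  | leaf i => [i]
  | node i l r => i :: (l.frontier ++ r.frontier)

/-- The oriented triangle edges: every triangle is oriented counterclockwise. -/
def sides : PlaneTree C → List (C × C)
  | leaf _ => []
  | node i l r => (i, l.root) :: (l.root, r.root) :: (r.root, i) :: (l.sides ++ r.sides)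

/-- There is at least one triangle. -/
def HasTriangle : PlaneTree C → Prop
  | leaf _ => False
  | node _ _ _ => True

end PlaneTree

namespace RibbonGraph

variable {X : Type u} [Fintype X] [DecidableEq X]

/-- The auxiliary choices entering the determinant: every vertex is represented by a plane tree of
triangles, whose corners are labelled by `C`, and every edge is given a direction. -/
structure Presentation (G : RibbonGraph X) (o : G.Orientation) (C : Type v) where
  /-- The tree of triangles representing a vertex. -/
  tree : G.Vertex → PlaneTree C
  hasTriangle : ∀ v, (tree v).HasTriangle
  nodup : ∀ v, (tree v).labels.Nodup
  existsUnique_mem : ∀ c, ∃! v, c ∈ (tree v).labels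
  /-- The corner to which the half-ribbon `{x, θ x}` is attached. -/
  corner : X → C
  corner_θ : ∀ x, corner (G.θ x) = corner x
  /-- The half-ribbons of a vertex are attached to distinct leaves of its tree, in their cyclic
  order: the cycle `(x, σ₀ x, σ₀² x, …)` of a positive cross `x`, read from some starting point,
  gives a sublist of the list of leaves. -/
  cyclic : ∀ x (hx : G.vertexOf x ∈ G.vertices), x ∈ o.pos →
    ∃ L : List X, (L : Cycle X) = Function.periodicOrbit G.σ₀ x ∧
      (L.map corner).Sublist (tree (Sum.inl ⟨G.vertexOf x, hx⟩)).leaves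
  /-- The positive cross of the half-edge at which the edge `e` arrives. -/
  head : {e : Finset X // e ∈ G.edges} → X
  head_mem : ∀ e, head e ∈ e.1 ∧ head e ∈ o.pos

namespace Presentation

variable {G : RibbonGraph X} {o : G.Orientation} {C : Type v}

/-- The positive cross of the half-edge from which the edge `e` leaves. -/
def tail (P : Presentation G o C) (e : {e : Finset X // e ∈ G.edges}) : X := G.θ (G.σ₁ (P.head e))

/-- The internal corners: those not attached to a flag. -/
def IsInternal (P : Presentation G o C) (c : C) : Prop := ∀ x, G.IsFlag x → P.corner x ≠ c

variable [Fintype C] [DecidableEq C]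

instance (P : Presentation G o C) (c : C) : Decidable (P.IsInternal c) :=
  inferInstanceAs (Decidable (∀ x, G.IsFlag x → P.corner x ≠ c))

/-- The type of internal corners. -/
abbrev InternalCorner (P : Presentation G o C) : Type v := {c : C // P.IsInternal c}

/-- The antisymmetric adjacency matrix of the internal corners, with respect to the triangle
edges. -/
def α (P : Presentation G o C) : Matrix P.InternalCorner P.InternalCorner ℤ :=
  Matrix.of fun i j =>
    if ∃ v, (i.1, j.1) ∈ (P.tree v).sides then 1
    else if ∃ v, (j.1, i.1) ∈ (P.tree v).sides then -1
    else 0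

/-- The incidence matrix between the directed edges and the internal corners. -/
def ε (P : Presentation G o C) : Matrix {e : Finset X // e ∈ G.edges} P.InternalCorner ℤ :=
  Matrix.of fun e i =>
    if P.corner (P.head e) = i.1 then 1
    else if P.corner (P.tail e) = i.1 then -1
    else 0

variable {K : Type w} [Field K] [Algebra ℝ K]

/-- The index set of the Gaussian variables `((u, v), (λ, μ), y)`: four variables for each edge and
one for each internal corner. -/
abbrev Index (P : Presentation G o C) : Type (max u v) :=
  (({e : Finset X // e ∈ G.edges} ⊕ {e : Finset X // e ∈ G.edges}) ⊕
    ({e : Finset X // e ∈ G.edges} ⊕ {e : Finset X // e ∈ G.edges})) ⊕ P.InternalCorner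

instance (P : Presentation G o C) : DecidableEq P.Index :=
  instDecidableEqSum

/-- The diagonal matrix with entries `Ω_e / t_e` at `u_e`, `Ω_e t_e` at `v_e` and `0` at the other
variables. -/
def D (P : Presentation G o C) (Ω t : Finset X → K) : Matrix P.Index P.Index K :=
  Matrix.diagonal (Sum.elim
    (Sum.elim (Sum.elim (fun e => Ω e.1 / t e.1) (fun e => Ω e.1 * t e.1)) (fun _ => 0))
    (fun _ => 0))

variable (K) in
/-- The `(λ, μ) × y` block, with rows `ε / √2` and `|ε| / √2`. -/
noncomputable def incidence (P : Presentation G o C) :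
    Matrix ({e : Finset X // e ∈ G.edges} ⊕ {e : Finset X // e ∈ G.edges}) P.InternalCorner K :=
  (algebraMap ℝ K (1 / √2)) •
    Matrix.fromRows (P.ε.map (fun n : ℤ => (n : K))) (P.ε.map (fun n : ℤ => ((|n| : ℤ) : K)))

variable (K) in
/-- The antisymmetric matrix `R`. -/
noncomputable def R (P : Presentation G o C) : Matrix P.Index P.Index K :=
  Matrix.fromBlocks
    (Matrix.fromBlocks 0 1 (-1) 0) (Matrix.fromRows 0 (P.incidence K))
    (Matrix.fromCols 0 (-(P.incidence K).transpose)) (P.α.map (fun n : ℤ => (n : K)))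

/-- The first hyperbolic polynomial `HU_G(Ω, t) = 2^{v(G)} (∏ t_e) det (D + R)`. -/
noncomputable def HU (P : Presentation G o C) (Ω t : Finset X → K) : K :=
  2 ^ G.numVertices * (∏ e ∈ G.edges, t e) * (P.D Ω t + P.R K).det

end Presentation

end RibbonGraph

/-! The parameters enter the determinant only through the diagonal entries at `u_e`, `v_e`.
Eliminating these variables together with `λ_e`, `μ_e` by a Schur complement, and expanding
multilinearly in those entries, gives a sum over sets `S` of variables `u_e`, `v_e`
(`det_hyperbolic_eq`, `det_fromBlocks_diagonal_mul_expand`). The coefficient of `S` is the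
determinant of `α` bordered by the incidence rows in `S`. Let `B` be the set of edges with `v_e ∈
S`, and `A` the set of edges for which exactly one of `u_e`, `v_e` lies in `S`. The monomial of `S`,
times `∏ t_e`, is then the monomial of `(A, B)` in `𝒬`. It remains to see that `2 ^ v(G)` times the
coefficient is a product over the vertices of `G^A` of `2` or `0`, according to the parity of the
degree.

For this, corners are replaced by darts, the incidences of corners with triangles. On darts `α`
becomes `W⁻¹ - W`, with `W` the permutation matrix rotating the triangles. Equality of the two darts
of an inner corner and vanishing at external corners join the incidence rows as linear constraints.
All constraints together form a matrix `F` with orthonormal rows, and a diagonal projection `P`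
selects the active ones. Since `W³ = 1`, one has `(1 + W)(W⁻¹ - W) = 1 - W`, so multiplying by `det
(1 + W)` leads to `det (1 - W + 2 W Fᵀ P F) = det (1 + W (2 Fᵀ P F - 1))`
(`det_mul_det_fromBlocks_constraints`). The reflection `2 Fᵀ P F - 1` is a signed permutation: it
exchanges the two darts of each inner corner and the two ends of each edge in `A`, with sign `1` at
flags and edges of `B` and `-1` elsewhere (`two_mul_constraint_mul`).

The determinant of one plus a signed permutation is the product over its cycles of `1 - ∏ (-sign)`
(`det_one_add_weightedPerm`). Rotation after flip walks around the trees and meets the half-ribbons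
of a vertex in the order of `σ₀` (`firstHit_walk_dart`). With the exchange along `A`, the cycles
become the vertices of `G^A`, and each contributes `1 - (-1) ^ degree`. Finally `det (1 + W)` is `2`
to the number of triangles, and the normalisation `1 / √2` of the constraints cancels one factor `2`
for each non-root triangle, leaving one for each vertex of `G`. -/

namespace Matrix

/-! ### Determinant of one plus a weighted permutation. -/

section Cycles

variable {D : Type*} [Fintype D] [DecidableEq D] {K : Type*} [CommRing K]

/-- The matrix sending the basis vector at `j` to `s j` times the basis vector at `π j`. -/
def weightedPerm (π : Equiv.Perm D) (s : D → K) : Matrix D D K :=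
  Matrix.of fun i j => if i = π j then s j else 0

/-- In the Leibniz expansion only `1` and `π` survive: a permutation that agrees at each point with
one of them and follows `π` once must, by injectivity, follow it along the whole cycle. The sign of
the cycle is absorbed in the signs of the `-s d`. -/
theorem det_one_add_weightedPerm_of_sameCycle [Nonempty D] (π : Equiv.Perm D) (s : D → K)
    (h : ∀ x y, π.SameCycle x y) :
    (1 + weightedPerm π s).det = 1 - ∏ d, -s d := by
  classical
  rcases subsingleton_or_nontrivial D with hD | hD
  -- With a single point, `1` and `π` coincide and the two terms add up in one entry.
  · obtain ⟨d⟩ := ‹Nonempty D›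
    let : Unique D := ⟨⟨d⟩, fun x => Subsingleton.elim _ _⟩
    have hπ : π default = default := Subsingleton.elim _ _
    rw [Matrix.det_unique, Fintype.prod_unique]
    simp [weightedPerm, hπ]
  · have hne : ∀ x, π x ≠ x := by
      intro x hx
      obtain ⟨y, hy⟩ := exists_ne x
      obtain ⟨k, hk⟩ := h x y
      rw [Equiv.Perm.zpow_apply_eq_self_of_apply_eq_self hx] at hk
      exact hy hk.symm
    have hcyc : π.IsCycle := by
      obtain ⟨x⟩ := ‹Nonempty D›
      exact ⟨x, hne x, fun y _ => h x y⟩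
    have hsupp : π.support = Finset.univ := by
      ext x; simp [hne x]
    have hone : (1 : Equiv.Perm D) ≠ π := by
      obtain ⟨x⟩ := ‹Nonempty D›
      intro h1
      exact hne x (by rw [← h1]; rfl)
    rw [Matrix.det_apply]
    rw [← Finset.sum_subset (Finset.subset_univ {1, π})]
    · rw [Finset.sum_pair hone]
      have h1 : ∀ i, (1 + weightedPerm π s) i i = 1 := by
        intro i; simp [weightedPerm, (hne i).symm]
      have h2 : ∀ i, (1 + weightedPerm π s) (π i) i = s i := by
        intro i; simp [weightedPerm, hne i]
      simp only [Equiv.Perm.sign_one, one_smul, Equiv.Perm.one_apply, h1, h2, hcyc.sign, hsupp,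
        Finset.prod_const_one]
      have h3 : ∏ d, -s d = (-1) ^ Fintype.card D * ∏ d, s d := by
        rw [Finset.prod_neg, Finset.card_univ]
      rw [h3, Finset.card_univ]
      rcases Nat.even_or_odd (Fintype.card D) with he | ho
      · simp [he.neg_one_pow, sub_eq_add_neg]
      · simp [ho.neg_one_pow]
    · intro ρ _ hρ
      simp only [Finset.mem_insert, Finset.mem_singleton, not_or] at hρ
      by_cases hall : ∀ i, ρ i = i ∨ ρ i = π i
      · exfalso
        obtain ⟨x, hx⟩ : ∃ x, ρ x ≠ x := by
          by_contra! hc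
          exact hρ.1 (Equiv.ext hc)
        have step : ∀ y, ρ y = π y → ρ (π y) = π (π y) := by
          intro y hy
          rcases hall (π y) with h1 | h1
          · exact absurd (ρ.injective (h1.trans hy.symm)) (hne y)
          · exact h1
        have hpow : ∀ n : ℕ, ρ ((π ^ n) x) = π ((π ^ n) x) := by
          intro n
          induction n with
          | zero => exact (hall x).resolve_left hx
          | succ n ih =>
            rw [pow_succ', Equiv.Perm.mul_apply]
            exact step _ ih
        apply hρ.2
        ext y
        obtain ⟨n, -, hn⟩ := (h x y).exists_pow_eq'
        rw [← hn]
        exact hpow n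
      · push Not at hall
        obtain ⟨i, h1, h2⟩ := hall
        rw [Finset.prod_eq_zero (Finset.mem_univ i), smul_zero]
        simp [weightedPerm, h1, h2]

/-- The fibres of `f` are the cycles of `π`. Any numbering of them makes the matrix block
triangular, with one block per cycle. -/
theorem det_one_add_weightedPerm {W : Type*} [Fintype W] [DecidableEq W]
    (π : Equiv.Perm D) (s : D → K) (f : D → W) (hf : ∀ d, f (π d) = f d)
    (hsurj : Function.Surjective f) (htrans : ∀ d d', f d = f d' → π.SameCycle d d') :
    (1 + weightedPerm π s).det = ∏ w, (1 - ∏ d with f d = w, -s d) := by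
  classical
  let b : D → Fin (Fintype.card W) := fun d => Fintype.equivFin W (f d)
  have hblock : (1 + weightedPerm π s).BlockTriangular b := by
    intro i j hij
    have h1 : i ≠ j := by rintro rfl; exact lt_irrefl _ hij
    have h2 : i ≠ π j := by
      rintro rfl
      simp only [b, hf] at hij
      exact lt_irrefl _ hij
    simp [weightedPerm, h1, h2]
  rw [hblock.det_fintype, ← (Fintype.equivFin W).prod_comp]
  refine Finset.prod_congr rfl fun w _ => ?_
  let p : D → Prop := fun d => b d = Fintype.equivFin W w
  have hp : ∀ d, p (π d) ↔ p d := fun d => by simp only [p, b, hf]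
  let π' : Equiv.Perm {d // p d} := π.subtypePerm hp
  have hsub : (1 + weightedPerm π s).toSquareBlock b (Fintype.equivFin W w) =
      1 + weightedPerm π' (fun d => s d.1) := by
    ext i j
    simp only [toSquareBlock, toSquareBlockProp, Matrix.add_apply, Matrix.one_apply, weightedPerm,
      Matrix.of_apply, Subtype.ext_iff]
    rfl
  obtain ⟨d₀, hd₀⟩ := hsurj w
  have : Nonempty {d // p d} := ⟨⟨d₀, by simp [p, b, hd₀]⟩⟩
  rw [hsub, det_one_add_weightedPerm_of_sameCycle]
  · congr 1
    rw [Finset.prod_subtype (Finset.univ.filter fun d => f d = w) (p := p)]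
    intro d
    simp [p, b]
  · rintro ⟨x, hx⟩ ⟨y, hy⟩
    have hxy : f x = f y := by
      simp only [b, EmbeddingLike.apply_eq_iff_eq] at hx hy
      rw [hx, hy]
    obtain ⟨k, hk⟩ := htrans x y hxy
    refine ⟨k, ?_⟩
    ext
    rw [Equiv.Perm.subtypePerm_zpow]
    exact hk

end Cycles

/-! ### Block determinants: expansion, Schur complements, elimination of constraints. -/

section Blocks

variable {K : Type*} [CommRing K]
variable {m n Γ Δ I N : Type*} [Fintype m] [DecidableEq m] [Fintype n] [DecidableEq n]
  [Fintype Γ] [DecidableEq Γ] [Fintype Δ] [DecidableEq Δ] [Fintype I] [DecidableEq I]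
  [Fintype N] [DecidableEq N]

/-- Row `s` of the upper half is a unit row plus `d s` times a row of `E`; `S` records the rows in
which multilinearity picks the second summand. -/
theorem det_fromBlocks_diagonal_mul_expand (d : m → K) (E : Matrix m n K) (E' : Matrix n m K)
    (a : Matrix n n K) :
    (fromBlocks 1 (diagonal d * E) E' a).det =
      ∑ S : Finset m, (∏ s ∈ S, d s) *
        (fromBlocks (diagonal fun s => if s ∈ S then (0 : K) else 1)
          (diagonal (fun s => if s ∈ S then (1 : K) else 0) * E) E' a).det := by
  classical
  let r : m ⊕ n → m ⊕ n → K := Sum.elim (fun s => Sum.elim 0 (d s • E s)) 0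
  let r' : m ⊕ n → m ⊕ n → K :=
    Sum.elim (fun s => Sum.elim ((1 : Matrix m m K) s) 0) (fun j => Sum.elim (E' j) (a j))
  let t : Finset (m ⊕ n) := Finset.univ.map Function.Embedding.inl
  have h := (detRowAlternating (n := m ⊕ n) (R := K)).toMultilinearMap.map_piecewise_add r r' t
  have hl : (fromBlocks 1 (diagonal d * E) E' a).det =
      (detRowAlternating (n := m ⊕ n) (R := K)).toMultilinearMap (t.piecewise (r + r') r') := by
    change _ = Matrix.det (Matrix.of (t.piecewise (r + r') r'))
    congr 1
    ext i j
    rcases i with i | i <;> rcases j with j | j <;>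
      simp [t, r, r', Finset.piecewise, diagonal_mul]
  rw [hl, h]
  have ht : t.powerset = Finset.univ.map
      ⟨fun S : Finset m => S.map Function.Embedding.inl, Finset.map_injective _⟩ := by
    ext U
    simp only [Finset.mem_powerset, Finset.mem_map, Finset.mem_univ, true_and,
      Function.Embedding.coeFn_mk, t, Finset.subset_map_iff]
    constructor
    · rintro ⟨S, -, rfl⟩; exact ⟨S, rfl⟩
    · rintro ⟨S, rfl⟩; exact ⟨S, Finset.subset_univ _, rfl⟩
  rw [ht, Finset.sum_map]
  refine Finset.sum_congr rfl fun S _ => ?_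
  change Matrix.det (Matrix.of (Finset.piecewise (S.map Function.Embedding.inl) r r')) = _
  have hfac : Matrix.of (Finset.piecewise (S.map Function.Embedding.inl) r r') =
      diagonal (Sum.elim (fun s => if s ∈ S then d s else 1) (fun _ => 1)) *
        (fromBlocks (diagonal fun s => if s ∈ S then (0 : K) else 1)
          (diagonal (fun s => if s ∈ S then (1 : K) else 0) * E) E' a) := by
    ext i j
    rcases i with i | i <;> rcases j with j | j
    · by_cases hi : i ∈ S <;>
        simp [r, r', Finset.piecewise, diagonal_mul, hi, Matrix.one_apply, diagonal_apply]
    · by_cases hi : i ∈ S <;> simp [r, r', Finset.piecewise, diagonal_mul, hi]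
    · simp [r', Finset.piecewise, diagonal_mul]
    · simp [r', Finset.piecewise, diagonal_mul]
  rw [hfac, det_mul, det_diagonal, Fintype.prod_sum_type]
  simp [Finset.prod_ite_mem]

theorem det_fromBlocks_one_neg_one_zero (d : Matrix m m K) :
    (fromBlocks d 1 (-1) 0 : Matrix (m ⊕ m) (m ⊕ m) K).det = 1 := by
  have h : (fromBlocks d 1 (-1) 0 : Matrix (m ⊕ m) (m ⊕ m) K) =
      fromBlocks 1 (1 - d) 0 1 * fromBlocks 1 0 (-1) 1 * fromBlocks 1 1 0 1 := by
    simp [fromBlocks_multiply]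
  rw [h, det_mul, det_mul]
  simp

/-- Both sides have Schur complement `a + Eᵀ * diagonal d * E`, and the eliminated blocks have
determinant one. -/
theorem det_hyperbolic_eq (d : m → K) (E : Matrix m n K) (a : Matrix n n K) :
    (fromBlocks (fromBlocks (diagonal d) 1 (-1) 0) (fromRows 0 E) (fromCols 0 (-Eᵀ)) a).det =
      (fromBlocks 1 (diagonal d * E) (-Eᵀ) a).det := by
  have hinv : fromBlocks (diagonal d) (1 : Matrix m m K) (-1) 0 *
      fromBlocks 0 (-1) 1 (diagonal d) = 1 := by
    simp [fromBlocks_multiply]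
  let : Invertible (fromBlocks (diagonal d) (1 : Matrix m m K) (-1) 0) :=
    invertibleOfRightInverse _ _ hinv
  have hinv' : ⅟(fromBlocks (diagonal d) (1 : Matrix m m K) (-1) 0) =
      fromBlocks 0 (-1) 1 (diagonal d) := rfl
  rw [det_fromBlocks₁₁, det_fromBlocks_one₁₁, hinv']
  have hdet := det_fromBlocks_one_neg_one_zero (diagonal d)
  rw [hdet, one_mul]
  congr 1
  simp [fromCols_mul_fromBlocks, fromCols_mul_fromRows, Matrix.mul_assoc]

/-- The upper rows impose the constraints with `p s = 1` and switch off the multipliers of the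
others. Once the lower rows are multiplied by `G`, unipotent row and column operations suffice, so
`G` need not be invertible. -/
theorem det_mul_det_fromBlocks_constraints (p : Γ → K) (hp : ∀ s, p s * p s = p s)
    (F : Matrix Γ Δ K) (hF : F * Fᵀ = 1) (a G G' : Matrix Δ Δ K) (hG : G * a = G') :
    G.det * (fromBlocks (diagonal fun s => 1 - p s) (diagonal p * F) (-Fᵀ) a).det =
      (G' + (G - G') * Fᵀ * diagonal p * F).det := by
  set P := diagonal p with hP
  have hQ : (diagonal fun s => 1 - p s) = 1 - P := by
    rw [hP, ← diagonal_one, diagonal_sub]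
  have hPP : P * P = P := by simp [hP, diagonal_mul_diagonal, hp]
  have hPP' : ∀ Z : Matrix Γ Δ K, P * (P * Z) = P * Z := fun Z => by
    rw [← Matrix.mul_assoc, hPP]
  have hPP2 : ∀ Z : Matrix Γ Γ K, P * (P * Z) = P * Z := fun Z => by
    rw [← Matrix.mul_assoc, hPP]
  have hF1 : ∀ Z : Matrix Γ Γ K, F * (Fᵀ * Z) = Z := fun Z => by
    rw [← Matrix.mul_assoc, hF, Matrix.one_mul]
  have hF2 : ∀ Z : Matrix Γ Δ K, F * (Fᵀ * Z) = Z := fun Z => by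
    rw [← Matrix.mul_assoc, hF, Matrix.one_mul]
  rw [hQ]
  set H := G' + (G - G') * Fᵀ * P * F with hH
  have key : fromBlocks 1 0 (-(G' * Fᵀ * P)) 1 *
      (fromBlocks 1 0 0 G * fromBlocks (1 - P) (P * F) (-Fᵀ) a) *
      (fromBlocks 1 (-(P * F)) 0 1 * fromBlocks 1 0 (Fᵀ * P) 1) =
      fromBlocks 1 (P * F) (-(G * Fᵀ * (1 - P))) H := by
    simp only [fromBlocks_multiply, Matrix.one_mul, Matrix.zero_mul, Matrix.mul_one,
      Matrix.mul_zero, add_zero, zero_add, hG]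
    congr 1
    · simp only [Matrix.mul_add, Matrix.sub_mul, Matrix.mul_one, Matrix.one_mul,
        Matrix.mul_neg, Matrix.neg_mul, Matrix.mul_assoc, hPP, hF1]
      abel
    · simp only [Matrix.sub_mul, Matrix.one_mul,
        Matrix.mul_neg, hPP']
      abel
    · simp only [Matrix.mul_add, Matrix.add_mul, Matrix.mul_sub, Matrix.sub_mul, Matrix.mul_one,
        Matrix.mul_neg, Matrix.neg_mul, Matrix.mul_assoc, hPP, hPP', hF1]
      abel
    · simp only [hH, Matrix.add_mul, Matrix.mul_sub, Matrix.sub_mul, Matrix.mul_one,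
        Matrix.mul_neg, Matrix.neg_mul, Matrix.mul_assoc, hPP, hPP']
      abel
  have hdet := congrArg det key
  simp only [det_mul, det_fromBlocks_zero₁₂, det_fromBlocks_zero₂₁, det_one, one_mul, mul_one,
    det_fromBlocks_one₁₁] at hdet
  rw [hdet]
  -- The Schur complement differs from `H` by a multiple of `(1 - P) * P = 0`.
  congr 1
  simp only [Matrix.mul_sub, Matrix.sub_mul, Matrix.mul_one,
        Matrix.neg_mul, Matrix.mul_assoc, hPP']
  abel

/-- The constraints indexed by `N` say that the `N`-coordinates are `X` times the `I`-coordinates.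
The unipotent substitution `U` makes them say that the new `N`-coordinates vanish; these and their
multipliers then split off, with determinant `k.det ^ 2`. -/
theorem det_fromBlocks_eliminate (q : Matrix m m K) (E₁ : Matrix m I K) (E₂ : Matrix I m K)
    (X : Matrix N I K) (k k' : Matrix N N K) (hk : k' * k = 1)
    (a : Matrix (I ⊕ N) (I ⊕ N) K) :
    (fromBlocks (fromBlocks q 0 0 0) (fromBlocks E₁ 0 (-(k * X)) k)
      (fromBlocks E₂ (Xᵀ * k) 0 (-k)) a :
        Matrix ((m ⊕ N) ⊕ (I ⊕ N)) ((m ⊕ N) ⊕ (I ⊕ N)) K).det =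
      k.det ^ 2 * (fromBlocks q E₁ E₂
        ((fromRows (1 : Matrix I I K) X)ᵀ * a * fromRows (1 : Matrix I I K) X)).det := by
  set U : Matrix (I ⊕ N) (I ⊕ N) K := fromBlocks 1 0 X 1 with hU
  have hUa : (Uᵀ * a * U).toBlocks₁₁ =
      (fromRows (1 : Matrix I I K) X)ᵀ * a * fromRows (1 : Matrix I I K) X := by
    obtain ⟨a₁₁, a₁₂, a₂₁, a₂₂, rfl⟩ : ∃ a₁₁ a₁₂ a₂₁ a₂₂, a = fromBlocks a₁₁ a₁₂ a₂₁ a₂₂ :=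
      ⟨_, _, _, _, (fromBlocks_toBlocks a).symm⟩
    rw [hU, fromBlocks_transpose, fromBlocks_multiply, fromBlocks_multiply,
      toBlocks_fromBlocks₁₁, transpose_fromRows, fromCols_mul_fromBlocks, fromCols_mul_fromRows]
  obtain ⟨b₁₁, b₁₂, b₂₁, b₂₂, hb⟩ : ∃ a₁₁ a₁₂ a₂₁ a₂₂,
      Uᵀ * a * U = fromBlocks a₁₁ a₁₂ a₂₁ a₂₂ :=
    ⟨_, _, _, _, (fromBlocks_toBlocks _).symm⟩
  rw [← hUa, hb, toBlocks_fromBlocks₁₁]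
  set B : Matrix ((m ⊕ N) ⊕ (I ⊕ N)) ((m ⊕ N) ⊕ (I ⊕ N)) K :=
    fromBlocks (fromBlocks q 0 0 0) (fromBlocks E₁ 0 (-(k * X)) k)
      (fromBlocks E₂ (Xᵀ * k) 0 (-k)) a with hB
  have h1 : fromBlocks 1 0 0 Uᵀ * B * fromBlocks 1 0 0 U =
      fromBlocks (fromBlocks q 0 0 0) (fromBlocks E₁ 0 0 k) (fromBlocks E₂ 0 0 (-k))
        (fromBlocks b₁₁ b₁₂ b₂₁ b₂₂) := by
    rw [← hb, hB]
    simp [fromBlocks_multiply, hU, fromBlocks_transpose]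
  -- Regroup: kept multipliers with kept coordinates, eliminated multipliers with eliminated
  -- coordinates.
  have h2 : (fromBlocks (fromBlocks q 0 0 0) (fromBlocks E₁ 0 0 k) (fromBlocks E₂ 0 0 (-k))
      (fromBlocks b₁₁ b₁₂ b₂₁ b₂₂)).submatrix (Equiv.sumSumSumComm m I N N)
        (Equiv.sumSumSumComm m I N N) =
      fromBlocks (fromBlocks q E₁ E₂ b₁₁) (fromBlocks 0 0 0 b₁₂) (fromBlocks 0 0 0 b₂₁)
        (fromBlocks 0 k (-k) b₂₂) := by
    ext i j
    rcases i with (i | i) | (i | i) <;> rcases j with (j | j) | (j | j) <;> simp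
  have h3 : fromBlocks 1 (fromBlocks 0 0 (-(b₁₂ * k')) 0) 0 1 *
      fromBlocks (fromBlocks q E₁ E₂ b₁₁) (fromBlocks 0 0 0 b₁₂) (fromBlocks 0 0 0 b₂₁)
        (fromBlocks 0 k (-k) b₂₂) =
      fromBlocks (fromBlocks q E₁ E₂ b₁₁) 0 (fromBlocks 0 0 0 b₂₁)
        (fromBlocks 0 k (-k) b₂₂) := by
    simp [fromBlocks_multiply, fromBlocks_add, Matrix.mul_assoc, hk]
  have h4 : fromBlocks 0 k (-k) b₂₂ = fromBlocks k 0 b₂₂ k * fromBlocks 0 1 (-1) 0 := by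
    simp [fromBlocks_multiply]
  have hU1 : U.det = 1 := by simp [hU]
  have e1 := congrArg det h1
  have e3 := congrArg det h3
  rw [← h2, det_mul, det_submatrix_equiv_self, ← e1, det_fromBlocks_zero₁₂, h4] at e3
  simp only [det_mul, det_fromBlocks_one_neg_one_zero, det_fromBlocks_zero₁₂,
    det_fromBlocks_zero₂₁, det_transpose, hU1] at e3
  simp only [det_one, one_mul, mul_one] at e3
  rw [e3]
  ring

end Blocks

end Matrix

/-! ### Corners, triangles and sides of a single plane tree. -/

namespace PlaneTree

variable {C : Type v}

/-- The triangles, each given by its three corners in counterclockwise order, starting from the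
one closest to the root. -/
def triangles : PlaneTree C → List (C × C × C)
  | leaf _ => []
  | node i l r => (i, l.root, r.root) :: (l.triangles ++ r.triangles)

theorem root_mem_labels (t : PlaneTree C) : t.root ∈ t.labels := by
  cases t <;> simp [root, labels]

/-- Every corner other than the root hangs from exactly one triangle, as its second or third corner.
-/
theorem labels_perm (t : PlaneTree C) :
    t.labels.Perm (t.root :: t.triangles.flatMap fun x => [x.2.1, x.2.2]) := by
  induction t with
  | leaf i => simp [labels, root, triangles]
  | node i l r hl hr =>
    simp only [labels, root, triangles, List.flatMap_cons, List.flatMap_append]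
    refine List.Perm.cons i ?_
    refine (hl.append hr).trans ?_
    simp only [List.cons_append, List.nil_append]
    exact List.Perm.cons _ List.perm_middle

theorem map_fst_triangles_sublist (t : PlaneTree C) :
    (t.triangles.map Prod.fst).Sublist t.labels := by
  induction t with
  | leaf i => simp [triangles]
  | node i l r hl hr =>
    simp only [labels, triangles, List.map_cons, List.map_append]
    exact (hl.append hr).cons_cons i

theorem sides_perm (t : PlaneTree C) :
    t.sides.Perm (t.triangles.flatMap
      fun x => [(x.1, x.2.1), (x.2.1, x.2.2), (x.2.2, x.1)]) := by
  induction t with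
  | leaf i => simp [sides, triangles]
  | node i l r hl hr =>
    simp only [sides, triangles, List.flatMap_cons, List.flatMap_append, List.cons_append,
      List.nil_append]
    exact ((((hl.append hr).cons _).cons _).cons _)

theorem mem_labels_of_mem_sides (t : PlaneTree C) {p : C × C} (hp : p ∈ t.sides) :
    p.1 ∈ t.labels ∧ p.2 ∈ t.labels := by
  induction t with
  | leaf i => simp [sides] at hp
  | node i l r hl hr =>
    have h1 := l.root_mem_labels
    have h2 := r.root_mem_labels
    simp only [sides, List.mem_cons, List.mem_append] at hp
    simp only [labels, List.mem_cons, List.mem_append]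
    rcases hp with rfl | rfl | rfl | hp | hp
    · tauto
    · tauto
    · tauto
    · have := hl hp; tauto
    · have := hr hp; tauto

theorem sides_aux {i : C} {l r : PlaneTree C} (h : (node i l r).labels.Nodup) :
    i ∉ l.labels ∧ i ∉ r.labels ∧ l.labels.Nodup ∧ r.labels.Nodup ∧
      ∀ c ∈ l.labels, c ∉ r.labels := by
  simp only [labels, List.nodup_cons, List.mem_append, not_or, List.nodup_append] at h
  obtain ⟨⟨h1, h2⟩, h3, h4, h5⟩ := h
  exact ⟨h1, h2, h3, h4, fun c hc hc' => h5 c hc c hc' rfl⟩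

/-- Two corners meet in at most one triangle. Hence the two nonzero cases in the definition of `α`
exclude each other. -/
theorem swap_notMem_sides (t : PlaneTree C) (h : t.labels.Nodup) {i j : C}
    (hij : (i, j) ∈ t.sides) : (j, i) ∉ t.sides := by
  induction t with
  | leaf i => simp [sides] at hij
  | node k l r hl hr =>
    obtain ⟨h1, h2, h3, h4, h5⟩ := sides_aux h
    have hlr := l.root_mem_labels
    have hrr := r.root_mem_labels
    have hls : ∀ p, p ∈ l.sides → _ := fun p hp => l.mem_labels_of_mem_sides hp
    have hrs : ∀ p, p ∈ r.sides → _ := fun p hp => r.mem_labels_of_mem_sides hp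
    have hl := hl h3
    have hr := hr h4
    simp only [sides, List.mem_cons, List.mem_append, Prod.mk.injEq] at hij ⊢
    grind

theorem nodup_sides (t : PlaneTree C) (h : t.labels.Nodup) : t.sides.Nodup := by
  induction t with
  | leaf i => simp [sides]
  | node k l r hl hr =>
    obtain ⟨h1, h2, h3, h4, h5⟩ := sides_aux h
    have hlr := l.root_mem_labels
    have hrr := r.root_mem_labels
    have hls : ∀ p, p ∈ l.sides → _ := fun p hp => l.mem_labels_of_mem_sides hp
    have hrs : ∀ p, p ∈ r.sides → _ := fun p hp => r.mem_labels_of_mem_sides hp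
    have hl := hl h3
    have hr := hr h4
    simp only [sides, List.nodup_cons, List.mem_cons, List.mem_append, Prod.mk.injEq,
      List.nodup_append]
    grind

theorem frontier_sublist (t : PlaneTree C) : t.frontier.Sublist t.labels := by
  induction t with
  | leaf i => simp [frontier, labels]
  | node i l r hl hr => exact (hl.append hr).cons i

theorem leaves_sublist (t : PlaneTree C) : t.leaves.Sublist t.labels := by
  cases t with
  | leaf i => simp [leaves, labels]
  | node i l r => exact (l.frontier_sublist.append r.frontier_sublist).cons_cons i

theorem fst_mem_labels (t : PlaneTree C) {x : C × C × C} (hx : x ∈ t.triangles) :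
    x.1 ∈ t.labels :=
  t.map_fst_triangles_sublist.subset (List.mem_map_of_mem hx)

theorem snd_mem_labels (t : PlaneTree C) {x : C × C × C} (hx : x ∈ t.triangles) :
    x.2.1 ∈ t.labels ∧ x.2.2 ∈ t.labels := by
  constructor <;>
  · rw [t.labels_perm.mem_iff]
    refine List.mem_cons_of_mem _ (List.mem_flatMap.2 ⟨x, hx, by simp⟩)

/-- A frontier corner ends at a leaf, so no triangle lies beyond it. -/
theorem fst_ne_of_mem_frontier (t : PlaneTree C) (h : t.labels.Nodup) {c : C}
    (hc : c ∈ t.frontier) {x : C × C × C} (hx : x ∈ t.triangles) : x.1 ≠ c := by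
  induction t with
  | leaf i => simp [triangles] at hx
  | node k l r hl hr =>
    obtain ⟨h1, h2, h3, h4, h5⟩ := sides_aux h
    simp only [frontier, List.mem_append] at hc
    simp only [triangles, List.mem_cons, List.mem_append] at hx
    rcases hc with hc | hc <;> rcases hx with rfl | hx | hx
    · rintro rfl; exact h1 (l.frontier_sublist.subset hc)
    · exact hl h3 hc hx
    · rintro rfl; exact h5 _ (l.frontier_sublist.subset hc) (r.fst_mem_labels hx)
    · rintro rfl; exact h2 (r.frontier_sublist.subset hc)
    · rintro rfl; exact h5 _ (l.fst_mem_labels hx) (r.frontier_sublist.subset hc)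
    · exact hr h4 hc hx

theorem root_eq_fst_of_hasTriangle (t : PlaneTree C) (h : t.HasTriangle) :
    ∃ x ∈ t.triangles, x.1 = t.root := by
  cases t with
  | leaf i => exact h.elim
  | node i l r => exact ⟨_, List.mem_cons_self, rfl⟩

end PlaneTree

theorem List.eq_of_nodup_flatMap {α β : Type*} {l : List α} {f : α → List β}
    (h : (l.flatMap f).Nodup) {x y : α} {b : β} (hx : x ∈ l) (hy : y ∈ l) (hbx : b ∈ f x)
    (hby : b ∈ f y) : x = y := by
  by_contra hne
  have hp := (List.nodup_flatMap.1 h).2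
  have : Std.Symm (Function.onFun List.Disjoint f) := ⟨fun _ _ h => List.Disjoint.symm h⟩
  exact List.disjoint_left.1 (List.Pairwise.forall hp hx hy hne) hbx hby

theorem injective_of_nodup_triple {α : Type*} {a b c : α} (h : [a, b, c].Nodup) :
    Function.Injective ![a, b, c] := by
  simp only [List.nodup_cons, List.mem_cons, List.not_mem_nil, or_false, not_or,
    not_false_eq_true, List.nodup_nil, and_true] at h
  obtain ⟨⟨h1, h2⟩, h3⟩ := h
  intro k l hkl
  fin_cases k <;> fin_cases l <;> first
    | rfl
    | exact absurd hkl h1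
    | exact absurd hkl h2
    | exact absurd hkl h3
    | exact absurd hkl.symm h1
    | exact absurd hkl.symm h2
    | exact absurd hkl.symm h3

/-! ### Forests of triangles and the permutations of their darts. -/

/-- A family of plane trees of triangles whose corners are labelled bijectively by `C`. -/
structure TriangleForest (V : Type w) (C : Type v) where
  tree : V → PlaneTree C
  hasTriangle : ∀ v, (tree v).HasTriangle
  nodup : ∀ v, (tree v).labels.Nodup
  existsUnique_mem : ∀ c, ∃! v, c ∈ (tree v).labels

namespace TriangleForest

variable {V : Type w} {C : Type v} (F : TriangleForest V C)

theorem eq_of_mem_labels {c : C} {v v' : V} (h : c ∈ (F.tree v).labels)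
    (h' : c ∈ (F.tree v').labels) : v = v' :=
  (F.existsUnique_mem c).unique h h'

/-- The tree containing a corner. -/
noncomputable def owner (c : C) : V := (F.existsUnique_mem c).choose

theorem mem_owner (c : C) : c ∈ (F.tree (F.owner c)).labels :=
  (F.existsUnique_mem c).choose_spec.1

theorem owner_eq {c : C} {v : V} (h : c ∈ (F.tree v).labels) : F.owner c = v :=
  F.eq_of_mem_labels (F.mem_owner c) h

/-- The triangles of the forest. -/
abbrev Triangle := {x : C × C × C // ∃ v, x ∈ (F.tree v).triangles}

/-- The corner is the root of its tree. -/
def IsRoot (c : C) : Prop := ∃ v, c = (F.tree v).root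

/-- The triangles which are not at the root of their tree. -/
abbrev InnerTriangle := {x : F.Triangle // ¬ F.IsRoot x.1.1}

variable {F}

theorem Triangle.owner_snd (x : F.Triangle) :
    F.owner x.1.2.1 = F.owner x.1.1 ∧ F.owner x.1.2.2 = F.owner x.1.1 := by
  obtain ⟨x, v, hx⟩ := x
  have h1 := (F.tree v).fst_mem_labels hx
  have h2 := (F.tree v).snd_mem_labels hx
  rw [F.owner_eq h1, F.owner_eq h2.1, F.owner_eq h2.2]
  exact ⟨rfl, rfl⟩

theorem Triangle.ext_fst {x y : F.Triangle} (h : x.1.1 = y.1.1) : x = y := by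
  obtain ⟨x, v, hx⟩ := x
  obtain ⟨y, v', hy⟩ := y
  have h' : x.1 = y.1 := h
  obtain rfl : v = v' :=
    F.eq_of_mem_labels ((F.tree v).fst_mem_labels hx) (h' ▸ (F.tree v').fst_mem_labels hy)
  have hn := (F.nodup v).sublist (F.tree v).map_fst_triangles_sublist
  exact Subtype.ext (List.inj_on_of_nodup_map hn hx hy h')

theorem nodup_children (v : V) : ((F.tree v).root ::
    (F.tree v).triangles.flatMap fun x => [x.2.1, x.2.2]).Nodup :=
  (F.tree v).labels_perm.nodup_iff.1 (F.nodup v)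

theorem Triangle.not_isRoot_left (x : F.Triangle) : ¬ F.IsRoot x.1.2.1 := by
  rintro ⟨v, hv⟩
  obtain ⟨x, w, hx⟩ := x
  obtain rfl : w = v := F.eq_of_mem_labels ((F.tree w).snd_mem_labels hx).1
    (hv ▸ (F.tree v).root_mem_labels)
  apply (List.nodup_cons.1 (F.nodup_children w)).1
  rw [← hv]
  exact List.mem_flatMap.2 ⟨x, hx, by simp⟩

theorem Triangle.not_isRoot_right (x : F.Triangle) : ¬ F.IsRoot x.1.2.2 := by
  rintro ⟨v, hv⟩
  obtain ⟨x, w, hx⟩ := x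
  obtain rfl : w = v := F.eq_of_mem_labels ((F.tree w).snd_mem_labels hx).2
    (hv ▸ (F.tree v).root_mem_labels)
  apply (List.nodup_cons.1 (F.nodup_children w)).1
  rw [← hv]
  exact List.mem_flatMap.2 ⟨x, hx, by simp⟩

theorem Triangle.ext_child {x y : F.Triangle} {c : C} (hx : c ∈ [x.1.2.1, x.1.2.2])
    (hy : c ∈ [y.1.2.1, y.1.2.2]) : x = y := by
  obtain ⟨x, v, hxv⟩ := x
  obtain ⟨y, v', hyv⟩ := y
  have hx' : c ∈ (F.tree v).labels := by
    have := (F.tree v).snd_mem_labels hxv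
    simp only [List.mem_cons, List.not_mem_nil, or_false] at hx
    rcases hx with rfl | rfl
    exacts [this.1, this.2]
  have hy' : c ∈ (F.tree v').labels := by
    have := (F.tree v').snd_mem_labels hyv
    simp only [List.mem_cons, List.not_mem_nil, or_false] at hy
    rcases hy with rfl | rfl
    exacts [this.1, this.2]
  obtain rfl : v = v' := F.eq_of_mem_labels hx' hy'
  exact Subtype.ext
    (List.eq_of_nodup_flatMap (List.nodup_cons.1 (F.nodup_children v)).2 hxv hyv hx hy)

theorem Triangle.left_ne_right (x : F.Triangle) : x.1.2.1 ≠ x.1.2.2 := by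
  obtain ⟨x, v, hx⟩ := x
  have := (List.nodup_flatMap.1 (List.nodup_cons.1 (F.nodup_children v)).2).1 x hx
  simpa using this

theorem isRoot_or_child (c : C) :
    F.IsRoot c ∨ ∃ x : F.Triangle, c = x.1.2.1 ∨ c = x.1.2.2 := by
  have h := F.mem_owner c
  rw [(F.tree (F.owner c)).labels_perm.mem_iff, List.mem_cons, List.mem_flatMap] at h
  rcases h with h | ⟨x, hx, h⟩
  · exact Or.inl ⟨_, h⟩
  · exact Or.inr ⟨⟨x, _, hx⟩, by simpa using h⟩

theorem IsRoot.exists_triangle {c : C} (h : F.IsRoot c) : ∃ x : F.Triangle, x.1.1 = c := by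
  obtain ⟨v, rfl⟩ := h
  obtain ⟨x, hx, h⟩ := (F.tree v).root_eq_fst_of_hasTriangle (F.hasTriangle v)
  exact ⟨⟨x, v, hx⟩, h⟩

variable (F)

/-- The incidences between triangles and corners: `inl c` is the incidence of `c` with the triangle
above it (with its only triangle if `c` is a root), and `inr x` is the incidence of an inner
triangle `x` with its first corner. -/
abbrev Dart := C ⊕ F.InnerTriangle

variable {F}

/-- The corner of a dart. -/
def Dart.corner : F.Dart → C := Sum.elim id fun x => x.1.1.1

open Classical in
/-- The dart of a triangle at its first corner. -/
noncomputable def Triangle.lower (x : F.Triangle) : F.Dart :=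
  if h : F.IsRoot x.1.1 then Sum.inl x.1.1 else Sum.inr ⟨x, h⟩

/-- The three darts of a triangle, in counterclockwise order. -/
noncomputable def place (p : F.Triangle × Fin 3) : F.Dart :=
  ![p.1.lower, Sum.inl p.1.1.2.1, Sum.inl p.1.1.2.2] p.2

theorem Triangle.corner_lower (x : F.Triangle) : Dart.corner x.lower = x.1.1 := by
  unfold Triangle.lower
  split_ifs <;> rfl

theorem Triangle.lower_injective : Function.Injective (Triangle.lower (F := F)) := by
  intro x y h
  apply Triangle.ext_fst
  rw [← x.corner_lower, h, y.corner_lower]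

theorem Triangle.lower_ne_inl (x : F.Triangle) {c : C} (hc : ¬ F.IsRoot c) :
    x.lower ≠ Sum.inl c := by
  unfold Triangle.lower
  split_ifs with h
  · intro h'
    rw [Sum.inl.injEq] at h'
    exact hc (h' ▸ h)
  · simp

/-- A non-root corner is the second or third corner of a unique triangle. A first corner either is a
root, which lies in no other triangle, or has a separate dart `inr`. -/
theorem place_bijective : Function.Bijective (place (F := F)) := by
  constructor
  · rintro ⟨x, k⟩ ⟨y, l⟩ h
    have hx := x.lower_ne_inl y.not_isRoot_left
    have hx' := x.lower_ne_inl y.not_isRoot_right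
    have hy := y.lower_ne_inl x.not_isRoot_left
    have hy' := y.lower_ne_inl x.not_isRoot_right
    have key : ∀ c, c ∈ [x.1.2.1, x.1.2.2] → c ∈ [y.1.2.1, y.1.2.2] → x = y :=
      fun c => Triangle.ext_child
    fin_cases k <;> fin_cases l <;> simp only [place] at h <;> simp at h
    · rw [Triangle.lower_injective h]
    · exact absurd h hx
    · exact absurd h hx'
    · exact absurd h.symm hy
    · rw [key x.1.2.1 (by simp) (by simp [h])]
    · obtain rfl := key x.1.2.1 (by simp) (by simp [h])
      exact absurd h x.left_ne_right
    · exact absurd h.symm hy'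
    · obtain rfl := key x.1.2.2 (by simp) (by simp [h])
      exact absurd h.symm x.left_ne_right
    · rw [key x.1.2.2 (by simp) (by simp [h])]
  · rintro (c | x)
    · rcases F.isRoot_or_child c with hc | ⟨x, rfl | rfl⟩
      · obtain ⟨x, rfl⟩ := hc.exists_triangle
        exact ⟨(x, 0), by simp [place, Triangle.lower, hc]⟩
      · exact ⟨(x, 1), rfl⟩
      · exact ⟨(x, 2), rfl⟩
    · exact ⟨(x.1, 0), by simp [place, Triangle.lower, x.2]⟩

variable (F) in
/-- The bijection between pairs (triangle, position) and darts. -/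
noncomputable def placeEquiv : F.Triangle × Fin 3 ≃ F.Dart := Equiv.ofBijective place place_bijective

variable (F) in
/-- The counterclockwise rotation of the triangles. -/
noncomputable def rotate : Equiv.Perm F.Dart :=
  F.placeEquiv.permCongr ((Equiv.refl _).prodCongr (Equiv.addRight (1 : Fin 3)))

theorem rotate_place (x : F.Triangle) (k : Fin 3) : F.rotate (place (x, k)) = place (x, k + 1) := by
  change F.placeEquiv (((Equiv.refl _).prodCongr (Equiv.addRight (1 : Fin 3)))
    (F.placeEquiv.symm (F.placeEquiv (x, k)))) = _
  rw [Equiv.symm_apply_apply]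
  rfl

theorem rotate_lower (x : F.Triangle) : F.rotate x.lower = Sum.inl x.1.2.1 :=
  rotate_place x 0

theorem rotate_left (x : F.Triangle) : F.rotate (Sum.inl x.1.2.1) = Sum.inl x.1.2.2 :=
  rotate_place x 1

theorem rotate_right (x : F.Triangle) : F.rotate (Sum.inl x.1.2.2) = x.lower :=
  rotate_place x 2

/-- The oriented side of the triangle of a dart which starts at its corner. -/
noncomputable def Dart.side (d : F.Dart) : C × C := (d.corner, Dart.corner (F.rotate d))

theorem Triangle.side_place (x : F.Triangle) (k : Fin 3) : Dart.side (place (x, k)) =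
    ![(x.1.1, x.1.2.1), (x.1.2.1, x.1.2.2), (x.1.2.2, x.1.1)] k := by
  unfold Dart.side
  rw [rotate_place]
  fin_cases k
  · exact Prod.ext x.corner_lower rfl
  · rfl
  · exact Prod.ext rfl x.corner_lower

theorem Triangle.side_place_mem (x : F.Triangle) (k : Fin 3) : Dart.side (place (x, k)) ∈
    [(x.1.1, x.1.2.1), (x.1.2.1, x.1.2.2), (x.1.2.2, x.1.1)] := by
  rw [x.side_place]
  fin_cases k <;> simp

theorem Triangle.side_place_mem_sides (x : F.Triangle) (k : Fin 3) {v : V}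
    (hx : x.1 ∈ (F.tree v).triangles) : Dart.side (place (x, k)) ∈ (F.tree v).sides := by
  rw [(F.tree v).sides_perm.mem_iff]
  exact List.mem_flatMap.2 ⟨x.1, hx, x.side_place_mem k⟩

/-- An oriented side occurs in only one triangle and at only one position. Summing over darts
therefore yields the entries of `α` without multiplicities. -/
theorem Dart.side_injective : Function.Injective (Dart.side (F := F)) := by
  intro d d' h
  obtain ⟨⟨x, k⟩, rfl⟩ := place_bijective.2 d
  obtain ⟨⟨y, l⟩, rfl⟩ := place_bijective.2 d'
  obtain ⟨v, hx⟩ := x.2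
  obtain ⟨v', hy⟩ := y.2
  have h1 := x.side_place_mem_sides k hx
  have h2 := y.side_place_mem_sides l hy
  rw [← h] at h2
  obtain rfl : v = v' := F.eq_of_mem_labels ((F.tree v).mem_labels_of_mem_sides h1).1
    ((F.tree v').mem_labels_of_mem_sides h2).1
  have hn := (F.tree v).sides_perm.nodup_iff.1 ((F.tree v).nodup_sides (F.nodup v))
  obtain rfl : x = y := Subtype.ext (List.eq_of_nodup_flatMap hn hx hy (x.side_place_mem k)
    (h ▸ y.side_place_mem l))
  have hn' := (List.nodup_flatMap.1 hn).1 x.1 hx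
  rw [x.side_place, x.side_place] at h
  rw [injective_of_nodup_triple hn' h]

theorem Dart.exists_side_eq {v : V} {i j : C} (h : (i, j) ∈ (F.tree v).sides) :
    ∃ d : F.Dart, d.side = (i, j) := by
  rw [(F.tree v).sides_perm.mem_iff, List.mem_flatMap] at h
  obtain ⟨x, hx, h⟩ := h
  let x' : F.Triangle := ⟨x, v, hx⟩
  simp only [List.mem_cons, List.not_mem_nil, or_false] at h
  rcases h with h | h | h
  · exact ⟨place (x', 0), by rw [x'.side_place, h]; rfl⟩
  · exact ⟨place (x', 1), by rw [x'.side_place, h]; rfl⟩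
  · exact ⟨place (x', 2), by rw [x'.side_place, h]; rfl⟩

theorem Dart.side_mem_sides (d : F.Dart) : ∃ v, d.side ∈ (F.tree v).sides := by
  obtain ⟨⟨x, k⟩, rfl⟩ := place_bijective.2 d
  obtain ⟨v, hx⟩ := x.2
  exact ⟨v, x.side_place_mem_sides k hx⟩

theorem owner_place (x : F.Triangle) (k : Fin 3) :
    F.owner (Dart.corner (place (x, k))) = F.owner x.1.1 := by
  fin_cases k
  · exact congrArg F.owner x.corner_lower
  · exact x.owner_snd.1
  · exact x.owner_snd.2

theorem owner_rotate (d : F.Dart) : F.owner (Dart.corner (F.rotate d)) = F.owner d.corner := by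
  obtain ⟨⟨x, k⟩, rfl⟩ := place_bijective.2 d
  rw [rotate_place, owner_place, owner_place]

open Classical in
variable (F) in
/-- The exchange of the two darts at every inner corner. -/
noncomputable def flip : Equiv.Perm F.Dart :=
  Function.Involutive.toPerm
    (Sum.elim (fun c => if h : ∃ x : F.InnerTriangle, x.1.1.1 = c then Sum.inr h.choose
      else Sum.inl c) fun x => Sum.inl x.1.1.1) (by
    rintro (c | x)
    · by_cases h : ∃ x : F.InnerTriangle, x.1.1.1 = c
      · simp only [Sum.elim_inl, h, dite_true, Sum.elim_inr]
        rw [h.choose_spec]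
      · simp only [Sum.elim_inl, h, dite_false]
    · have h : ∃ y : F.InnerTriangle, y.1.1.1 = x.1.1.1 := ⟨x, rfl⟩
      simp only [Sum.elim_inl, Sum.elim_inr]
      rw [dif_pos h]
      congr 1
      exact Subtype.ext (Triangle.ext_fst h.choose_spec))

theorem flip_inr (x : F.InnerTriangle) : F.flip (Sum.inr x) = Sum.inl x.1.1.1 := rfl

theorem flip_flip (d : F.Dart) : F.flip (F.flip d) = d :=
  (Function.Involutive.toPerm_involutive _) d

theorem flip_inl (x : F.InnerTriangle) : F.flip (Sum.inl x.1.1.1) = Sum.inr x := by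
  rw [← flip_inr, flip_flip]

theorem flip_inl_of_forall_ne {c : C} (h : ∀ x : F.InnerTriangle, x.1.1.1 ≠ c) :
    F.flip (Sum.inl c) = Sum.inl c := by
  have h' : ¬ ∃ x : F.InnerTriangle, x.1.1.1 = c := fun ⟨x, hx⟩ => h x hx
  exact dif_neg h'

theorem corner_flip (d : F.Dart) : Dart.corner (F.flip d) = d.corner := by
  rcases d with c | x
  · by_cases h : ∃ x : F.InnerTriangle, x.1.1.1 = c
    · obtain ⟨x, rfl⟩ := h
      rw [flip_inl]
      rfl
    · push Not at h
      rw [flip_inl_of_forall_ne h]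
  · rfl

/-- A corner attached to a leaf of its tree is not the first corner of an inner triangle. -/
theorem fst_ne_of_mem_leaves {v : V} {c : C} (hc : c ∈ (F.tree v).leaves)
    (x : F.InnerTriangle) : x.1.1.1 ≠ c := by
  rintro rfl
  obtain ⟨⟨x, v', hx⟩, hroot⟩ := x
  obtain rfl : v = v' := F.eq_of_mem_labels ((F.tree v).leaves_sublist.subset hc)
    ((F.tree v').fst_mem_labels hx)
  have hn := F.nodup v
  have hroot' : x.1 ≠ (F.tree v).root := fun h => hroot ⟨v, h⟩
  change x.1 ∈ _ at hc
  cases ht : F.tree v with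
  | leaf i => rw [ht] at hx; simp [PlaneTree.triangles] at hx
  | node i l r =>
    rw [ht] at hx hc hn hroot'
    have hc' : x.1 ∈ (PlaneTree.node i l r).frontier :=
      (List.mem_cons.1 hc).resolve_left hroot'
    exact PlaneTree.fst_ne_of_mem_frontier _ hn hc' hx rfl

section Finite

variable [Fintype C]

noncomputable instance : Fintype F.Triangle := by classical exact inferInstance

noncomputable instance : Fintype F.InnerTriangle := by classical exact inferInstance

variable (F) in
-- Each tree has exactly one triangle at its root, by `hasTriangle`. These triangles are the source
-- of the factor `2 ^ v(G)`.
theorem card_triangle [Fintype V] :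
    Fintype.card F.Triangle = Fintype.card F.InnerTriangle + Fintype.card V := by
  classical
  have e : V ≃ {x : F.Triangle // F.IsRoot x.1.1} := by
    refine Equiv.ofBijective
      (fun v => ⟨(IsRoot.exists_triangle (F := F) ⟨v, rfl⟩).choose,
        ⟨v, (IsRoot.exists_triangle (F := F) ⟨v, rfl⟩).choose_spec⟩⟩) ⟨?_, ?_⟩
    · intro v v' h
      have h1 := (IsRoot.exists_triangle (F := F) ⟨v, rfl⟩).choose_spec
      have h2 := (IsRoot.exists_triangle (F := F) ⟨v', rfl⟩).choose_spec
      have h3 := (h1.symm.trans (congrArg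
        (fun z : {x : F.Triangle // F.IsRoot x.1.1} => z.1.1.1) h)).trans h2
      exact F.eq_of_mem_labels (F.tree v).root_mem_labels (h3 ▸ (F.tree v').root_mem_labels)
    · rintro ⟨x, v, hv⟩
      refine ⟨v, Subtype.ext (Triangle.ext_fst ?_)⟩
      rw [hv]
      exact (IsRoot.exists_triangle (F := F) ⟨v, rfl⟩).choose_spec
  rw [Fintype.card_congr e, ← Fintype.card_congr (Equiv.sumCompl fun x : F.Triangle => F.IsRoot x.1.1),
    Fintype.card_sum, add_comm]

end Finite

end TriangleForest

/-! ### Products of weighted permutation matrices. -/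

namespace Matrix

variable {D : Type*} [Fintype D] [DecidableEq D] {K : Type*} [CommRing K]

theorem weightedPerm_mul_apply {n : Type*} (π : Equiv.Perm D) (s : D → K) (B : Matrix D n K) (d : D)
    (j : n) : (weightedPerm π s * B) d j = s (π⁻¹ d) * B (π⁻¹ d) j := by
  rw [Matrix.mul_apply, Finset.sum_eq_single (π⁻¹ d)]
  · simp [weightedPerm]
  · intro b _ hb
    have : d ≠ π b := by rintro rfl; simp at hb
    simp [weightedPerm, this]
  · simp

theorem weightedPerm_mul (π ρ : Equiv.Perm D) (s t : D → K) :
    weightedPerm π s * weightedPerm ρ t = weightedPerm (π * ρ) fun j => s (ρ j) * t j := by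
  ext i j
  rw [weightedPerm_mul_apply]
  by_cases h : π⁻¹ i = ρ j
  · have h' : i = π (ρ j) := by rw [← h]; simp
    simp [weightedPerm, h']
  · have h' : i ≠ π (ρ j) := by rintro rfl; simp at h
    have h'' : i ≠ (π * ρ) j := h'
    simp only [weightedPerm, Matrix.of_apply, if_neg h, if_neg h'', mul_zero]

omit [Fintype D] in
theorem weightedPerm_one : weightedPerm (1 : Equiv.Perm D) (1 : D → K) = 1 := by
  ext i j
  rw [Matrix.one_apply]
  rfl

end Matrix

/-! ### The walk around the trees. -/

/-- Following `ρ` from the first point to the last one, one meets successively the images under `δ`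
of the elements of the list, and no other element of the range of `δ`. -/
inductive Visits {D : Type v} {Y : Type w} (ρ : D → D) (δ : Y → D) : D → List Y → D → Prop
  | nil (d : D) : Visits ρ δ d [] d
  | skip {d : D} {L : List Y} {d' : D} (hd : d ∉ Set.range δ) (h : Visits ρ δ (ρ d) L d') :
      Visits ρ δ d L d'
  | hit {y : Y} {L : List Y} {d' : D} (h : Visits ρ δ (ρ (δ y)) L d') :
      Visits ρ δ (δ y) (y :: L) d'

namespace Visits

variable {D : Type v} {Y : Type w} {δ : Y → D}

theorem trans {ρ : D → D} {d d' d'' : D} {L L' : List Y} (h : Visits ρ δ d L d')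
    (h' : Visits ρ δ d' L' d'') : Visits ρ δ d (L ++ L') d'' := by
  induction h with
  | nil => exact h'
  | skip hd _ ih => exact skip hd (ih h')
  | hit _ ih => exact hit (ih h')

theorem sameCycle {ρ : Equiv.Perm D} {d d' : D} {L : List Y} (h : Visits ρ δ d L d') :
    ρ.SameCycle d d' := by
  induction h with
  | nil => exact Equiv.Perm.SameCycle.refl _ _
  | skip _ _ ih => exact Equiv.Perm.sameCycle_apply_left.1 ih
  | hit _ ih => exact Equiv.Perm.sameCycle_apply_left.1 ih

end Visits

namespace TriangleForest

variable {V : Type w} {C : Type v} {F : TriangleForest V C}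

theorem rotate_rotate_rotate (d : F.Dart) : F.rotate (F.rotate (F.rotate d)) = d := by
  obtain ⟨⟨x, k⟩, rfl⟩ := place_bijective.2 d
  rw [rotate_place, rotate_place, rotate_place]
  congr 2
  fin_cases k <;> rfl

variable (F) in
/-- The step of the walk around the trees. -/
noncomputable def walk : Equiv.Perm F.Dart := F.rotate * F.flip

theorem walk_apply (d : F.Dart) : F.walk d = F.rotate (F.flip d) := rfl

theorem owner_walk (d : F.Dart) : F.owner (Dart.corner (F.walk d)) = F.owner d.corner := by
  rw [walk_apply, owner_rotate, corner_flip]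

theorem lower_of_not_isRoot (x : F.InnerTriangle) : x.1.lower = Sum.inr x := by
  unfold Triangle.lower
  rw [dif_neg x.2]

theorem lower_of_isRoot {x : F.Triangle} (h : F.IsRoot x.1.1) : x.lower = Sum.inl x.1.1 := by
  unfold Triangle.lower
  rw [dif_pos h]

theorem forall_ne_of_isRoot {c : C} (h : F.IsRoot c) (x : F.InnerTriangle) : x.1.1.1 ≠ c := by
  rintro rfl; exact x.2 h

section Walk

variable {Y : Type*} {cor : Y → C} (att : C → Option Y)
  (hatt : ∀ c y, att c = some y ↔ cor y = c)
  (hcor : ∀ y, ∀ x : F.InnerTriangle, x.1.1.1 ≠ cor y)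

include hatt in
theorem visits_single {c : C} (hc : ∀ x : F.InnerTriangle, x.1.1.1 ≠ c) :
    Visits F.walk (fun y => (Sum.inl (cor y) : F.Dart)) (Sum.inl c) ([c].filterMap att)
      (F.rotate (Sum.inl c)) := by
  have hw : F.walk (Sum.inl c) = F.rotate (Sum.inl c) := by
    rw [walk_apply, flip_inl_of_forall_ne hc]
  rw [← hw]
  cases h : att c with
  | none =>
    have : [c].filterMap att = [] := by simp [h]
    rw [this]
    refine Visits.skip ?_ (Visits.nil _)
    rintro ⟨y, hy⟩
    simp only [Sum.inl.injEq] at hy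
    rw [(hatt c y).2 hy] at h
    cases h
  | some y =>
    have : [c].filterMap att = [y] := by simp [h]
    rw [this]
    obtain rfl := (hatt c y).1 h
    exact Visits.hit (Visits.nil _)

include hcor in
theorem visits_skip {d : F.Dart} (hd : ∃ x : F.InnerTriangle, d = Sum.inr x ∨ d = Sum.inl x.1.1.1) :
    Visits F.walk (fun y => (Sum.inl (cor y) : F.Dart)) d [] (F.walk d) := by
  refine Visits.skip ?_ (Visits.nil _)
  rintro ⟨y, hy⟩
  obtain ⟨x, rfl | rfl⟩ := hd
  · simp at hy
  · simp only [Sum.inl.injEq] at hy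
    exact hcor y x hy.symm

-- The starting dart belongs to the triangle outside the subtree. At a node the flip enters the
-- node's triangle, the walk goes round `l` and then `r`, and the second dart of `i` leads out again
-- to the next corner of the outer triangle.
include hatt hcor in
theorem visits_subtree (t : PlaneTree C)
    (ht : ∀ x ∈ t.triangles, ∃ hx : ∃ v, x ∈ (F.tree v).triangles,
      ¬ F.IsRoot (⟨x, hx⟩ : F.Triangle).1.1)
    (hf : ∀ c ∈ t.frontier, ∀ x : F.InnerTriangle, x.1.1.1 ≠ c) :
    Visits F.walk (fun y => (Sum.inl (cor y) : F.Dart)) (Sum.inl t.root)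
      (t.frontier.filterMap att) (F.rotate (Sum.inl t.root)) := by
  induction t with
  | leaf c => exact visits_single att hatt (hf c (by simp [PlaneTree.frontier]))
  | node i l r hl hr =>
    obtain ⟨hx, hxr⟩ := ht (i, l.root, r.root) (by simp [PlaneTree.triangles])
    let x : F.InnerTriangle := ⟨⟨(i, l.root, r.root), hx⟩, hxr⟩
    have h1 := hl (fun y hy => ht y (by simp [PlaneTree.triangles, hy]))
      (fun c hc => hf c (by simp [PlaneTree.frontier, hc]))
    have h2 := hr (fun y hy => ht y (by simp [PlaneTree.triangles, hy]))
      (fun c hc => hf c (by simp [PlaneTree.frontier, hc]))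
    have e1 : F.walk (Sum.inl i) = Sum.inl l.root := by
      rw [walk_apply, F.flip_inl x, ← lower_of_not_isRoot x, rotate_lower]
    have e2 : F.rotate (Sum.inl l.root) = Sum.inl r.root := rotate_left x.1
    have e3 : F.rotate (Sum.inl r.root) = Sum.inr x := by
      rw [← lower_of_not_isRoot x]; exact rotate_right x.1
    have e4 : F.walk (Sum.inr x) = F.rotate (Sum.inl i) := by
      rw [walk_apply, F.flip_inr x]
    have h0 := visits_skip (cor := cor) hcor (d := Sum.inl i) ⟨x, Or.inr rfl⟩
    have h3 := visits_skip (cor := cor) hcor (d := Sum.inr x) ⟨x, Or.inl rfl⟩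
    rw [e1] at h0
    rw [e2] at h1
    rw [e3] at h2
    rw [e4] at h3
    have := ((h0.trans h1).trans h2).trans h3
    simpa [PlaneTree.frontier, PlaneTree.root] using this

theorem exists_inner_of_mem {v : V} {i : C} {l r t : PlaneTree C}
    (hv : F.tree v = PlaneTree.node i l r) (ht : t = l ∨ t = r) :
    (∀ x ∈ t.triangles, ∃ hx : ∃ v, x ∈ (F.tree v).triangles,
      ¬ F.IsRoot (⟨x, hx⟩ : F.Triangle).1.1) ∧
    (∀ c ∈ t.frontier, ∀ x : F.InnerTriangle, x.1.1.1 ≠ c) := by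
  have hn := F.nodup v
  rw [hv] at hn
  obtain ⟨h1, h2, -⟩ := PlaneTree.sides_aux hn
  constructor
  · intro x hx
    have hxv : x ∈ (F.tree v).triangles := by
      rw [hv]
      rcases ht with rfl | rfl <;> simp [PlaneTree.triangles, hx]
    refine ⟨⟨v, hxv⟩, ?_⟩
    rintro ⟨w, hw⟩
    obtain rfl : v = w := F.eq_of_mem_labels ((F.tree v).fst_mem_labels hxv)
      (by rw [hw]; exact (F.tree w).root_mem_labels)
    rw [hv] at hw
    change x.1 = i at hw
    have := t.fst_mem_labels hx
    rw [hw] at this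
    rcases ht with rfl | rfl
    exacts [h1 this, h2 this]
  · intro c hc
    apply F.fst_ne_of_mem_leaves (v := v)
    rw [hv]
    rcases ht with rfl | rfl <;> simp [PlaneTree.leaves, hc]

-- At the root the flip does nothing, the lower end of the root being itself a leaf. So the root is
-- met first and the walk closes up after the two subtrees.
include hatt hcor in
theorem visits_tree (v : V) :
    Visits F.walk (fun y => (Sum.inl (cor y) : F.Dart)) (Sum.inl (F.tree v).root)
      ((F.tree v).leaves.filterMap att) (Sum.inl (F.tree v).root) := by
  have htri := F.hasTriangle v
  have hroot : F.IsRoot (F.tree v).root := ⟨v, rfl⟩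
  have h0 := visits_single att hatt (forall_ne_of_isRoot hroot)
  cases ht : F.tree v with
  | leaf i => rw [ht] at htri; exact htri.elim
  | node i l r =>
    rw [ht] at h0 hroot
    let x : F.Triangle := ⟨(i, l.root, r.root), v, by rw [ht]; simp [PlaneTree.triangles]⟩
    obtain ⟨h1, h1'⟩ := F.exists_inner_of_mem ht (Or.inl rfl)
    obtain ⟨h2, h2'⟩ := F.exists_inner_of_mem ht (Or.inr rfl)
    have h1 := visits_subtree att hatt hcor l h1 h1'
    have h2 := visits_subtree att hatt hcor r h2 h2'
    have e1 : F.rotate (Sum.inl i) = Sum.inl l.root := by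
      have := rotate_lower x
      rwa [lower_of_isRoot hroot] at this
    have e2 : F.rotate (Sum.inl l.root) = Sum.inl r.root := rotate_left x
    have e3 : F.rotate (Sum.inl r.root) = Sum.inl i := by
      have := rotate_right x
      rwa [lower_of_isRoot hroot] at this
    change Visits _ _ _ _ (F.rotate (Sum.inl i)) at h0
    rw [e1] at h0
    rw [e2] at h1
    rw [e3] at h2
    have := (h0.trans h1).trans h2
    rw [List.append_assoc, ← List.filterMap_append, ← List.filterMap_append] at this
    exact this

end Walk

theorem sameCycle_subtree (t : PlaneTree C)
    (ht : ∀ x ∈ t.triangles, ∃ hx : ∃ v, x ∈ (F.tree v).triangles,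
      ¬ F.IsRoot (⟨x, hx⟩ : F.Triangle).1.1)
    (hf : ∀ c ∈ t.frontier, ∀ x : F.InnerTriangle, x.1.1.1 ≠ c)
    (x : F.Triangle) (hx : x.1 ∈ t.triangles) (k : Fin 3) :
    F.walk.SameCycle (Sum.inl t.root) (place (x, k)) := by
  induction t with
  | leaf c => simp [PlaneTree.triangles] at hx
  | node i l r hl hr =>
    obtain ⟨hy, hyr⟩ := ht (i, l.root, r.root) (by simp [PlaneTree.triangles])
    let y : F.InnerTriangle := ⟨⟨(i, l.root, r.root), hy⟩, hyr⟩
    have hl1 : ∀ y ∈ l.triangles, y ∈ (PlaneTree.node i l r).triangles := fun y hy => by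
      simp [PlaneTree.triangles, hy]
    have hr1 : ∀ y ∈ r.triangles, y ∈ (PlaneTree.node i l r).triangles := fun y hy => by
      simp [PlaneTree.triangles, hy]
    have hl2 : ∀ y ∈ l.frontier, y ∈ (PlaneTree.node i l r).frontier := fun y hy => by
      simp [PlaneTree.frontier, hy]
    have e1 : F.walk (Sum.inl i) = Sum.inl l.root := by
      rw [walk_apply, F.flip_inl y, ← lower_of_not_isRoot y, rotate_lower]
    have e2 : F.rotate (Sum.inl l.root) = Sum.inl r.root := rotate_left y.1
    have e4 : F.walk (Sum.inr y) = F.rotate (Sum.inl i) := by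
      rw [walk_apply, F.flip_inr y]
    have e3 : F.rotate (Sum.inl r.root) = Sum.inr y := by
      rw [← lower_of_not_isRoot y]; exact rotate_right y.1
    have c1 : F.walk.SameCycle (Sum.inl i) (Sum.inl l.root) :=
      ⟨1, by rw [zpow_one, e1]⟩
    -- With no marked dart at all, a tour of the subtree only says that its two ends lie on one
    -- cycle.
    have h2 := (visits_subtree (Y := Empty) (cor := Empty.elim) (fun _ => none)
      (fun _ y => y.elim) (fun y => y.elim) l (fun y hy => ht y (hl1 y hy))
      (fun c hc => hf c (hl2 c hc))).sameCycle
    rw [e2] at h2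
    have h3 := (visits_subtree (Y := Empty) (cor := Empty.elim) (fun _ => none)
      (fun _ y => y.elim) (fun y => y.elim) r (fun y hy => ht y (hr1 y hy))
      (fun c hc => hf c (by simp [PlaneTree.frontier, hc]))).sameCycle
    rw [e3] at h3
    simp only [PlaneTree.triangles, List.mem_cons, List.mem_append] at hx
    rcases hx with hx | hx | hx
    · obtain rfl : x = y.1 := Subtype.ext hx
      fin_cases k
      · change F.walk.SameCycle _ y.1.lower
        rw [lower_of_not_isRoot]
        exact (c1.trans h2).trans h3
      · exact c1
      · exact c1.trans h2
    · exact c1.trans (hl (fun y hy => ht y (hl1 y hy)) (fun c hc => hf c (hl2 c hc)) hx)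
    · exact (c1.trans h2).trans (hr (fun y hy => ht y (hr1 y hy))
        (fun c hc => hf c (by simp [PlaneTree.frontier, hc])) hx)

theorem sameCycle_root (d : F.Dart) :
    F.walk.SameCycle (Sum.inl (F.tree (F.owner d.corner)).root) d := by
  obtain ⟨⟨x, k⟩, rfl⟩ := place_bijective.2 d
  rw [owner_place]
  obtain ⟨v, hx⟩ := x.2
  rw [F.owner_eq ((F.tree v).fst_mem_labels hx)]
  have hroot : F.IsRoot (F.tree v).root := ⟨v, rfl⟩
  cases ht : F.tree v with
  | leaf i => rw [ht] at hx; simp [PlaneTree.triangles] at hx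
  | node i l r =>
    rw [ht] at hx hroot
    let y : F.Triangle := ⟨(i, l.root, r.root), v, by rw [ht]; simp [PlaneTree.triangles]⟩
    obtain ⟨h1, h1'⟩ := F.exists_inner_of_mem ht (Or.inl rfl)
    obtain ⟨h2, h2'⟩ := F.exists_inner_of_mem ht (Or.inr rfl)
    have e1 : F.rotate (Sum.inl i) = Sum.inl l.root := by
      have := rotate_lower y
      rwa [lower_of_isRoot hroot] at this
    have e2 : F.rotate (Sum.inl l.root) = Sum.inl r.root := rotate_left y
    have c1 : F.walk.SameCycle (Sum.inl i) (Sum.inl l.root) :=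
      ⟨1, by rw [zpow_one, walk_apply,
        flip_inl_of_forall_ne (c := i) (forall_ne_of_isRoot hroot), e1]⟩
    have c2 := (visits_subtree (Y := Empty) (cor := Empty.elim) (fun _ => none)
      (fun _ y => y.elim) (fun y => y.elim) l h1 h1').sameCycle
    rw [e2] at c2
    simp only [PlaneTree.triangles, List.mem_cons, List.mem_append] at hx
    rcases hx with hx | hx | hx
    · obtain rfl : x = y := Subtype.ext hx
      fin_cases k
      · change F.walk.SameCycle (Sum.inl i) y.lower
        rw [lower_of_isRoot hroot]
      · exact c1
      · exact c1.trans c2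
    · exact c1.trans (sameCycle_subtree l h1 h1' x hx k)
    · exact (c1.trans c2).trans (sameCycle_subtree r h2 h2' x hx k)

/-- With `owner_walk`, this says that the cycles of `walk` are exactly the trees. -/
theorem sameCycle_of_owner_eq {d d' : F.Dart} (h : F.owner d.corner = F.owner d'.corner) :
    F.walk.SameCycle d d' :=
  (sameCycle_root d).symm.trans (h ▸ sameCycle_root d')

/-! ### Rotation and adjacency matrices of the darts. -/

section Matrices

variable [Fintype C] [DecidableEq C] (K : Type*) [CommRing K]

variable (F) in
/-- The antisymmetric adjacency matrix of the darts. -/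
noncomputable def adjacency : Matrix F.Dart F.Dart K :=
  Matrix.weightedPerm F.rotate⁻¹ 1 - Matrix.weightedPerm F.rotate 1

/-- Since the rotation `W` has order three, `(1 + W)(W⁻¹ - W) = W⁻¹ + 1 - W - W²` and `W² = W⁻¹`. -/
theorem one_add_rotate_mul_adjacency :
    (1 + Matrix.weightedPerm F.rotate 1) * F.adjacency K =
      1 - Matrix.weightedPerm F.rotate (1 : F.Dart → K) := by
  have h1 : Matrix.weightedPerm F.rotate 1 * Matrix.weightedPerm F.rotate⁻¹ (1 : F.Dart → K) = 1 := by
    rw [Matrix.weightedPerm_mul, mul_inv_cancel, ← Matrix.weightedPerm_one]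
    simp [Pi.one_def]
  have h2 : Matrix.weightedPerm F.rotate 1 * Matrix.weightedPerm F.rotate (1 : F.Dart → K) =
      Matrix.weightedPerm F.rotate⁻¹ 1 := by
    rw [Matrix.weightedPerm_mul]
    have : F.rotate * F.rotate = F.rotate⁻¹ := by
      rw [eq_inv_iff_mul_eq_one]
      ext1 d
      exact rotate_rotate_rotate d
    rw [this]
    simp [Pi.one_def]
  rw [adjacency, Matrix.mul_sub, Matrix.add_mul, Matrix.add_mul, h1, h2, Matrix.one_mul,
    Matrix.one_mul]
  abel

/-- The cycles are the triangles, each contributing `1 - (-1) ^ 3 = 2`. -/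
theorem det_one_add_rotate :
    (1 + Matrix.weightedPerm F.rotate (1 : F.Dart → K)).det = 2 ^ Fintype.card F.Triangle := by
  have hf : ∀ p, (F.placeEquiv.symm (place p)) = p := fun p => F.placeEquiv.symm_apply_apply p
  rw [Matrix.det_one_add_weightedPerm F.rotate 1 fun d => (F.placeEquiv.symm d).1]
  · have h : ∀ x : F.Triangle,
        (1 - ∏ d with (F.placeEquiv.symm d).1 = x, -(1 : F.Dart → K) d) = 2 := by
      intro x
      have hcard : (Finset.univ.filter fun d : F.Dart => (F.placeEquiv.symm d).1 = x) =
          (Finset.univ : Finset (Fin 3)).image fun k => place (x, k) := by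
        ext d
        simp only [Finset.mem_filter, Finset.mem_univ, true_and, Finset.mem_image]
        constructor
        · intro hd
          refine ⟨(F.placeEquiv.symm d).2, ?_⟩
          rw [← hd]
          exact F.placeEquiv.apply_symm_apply d
        · rintro ⟨k, rfl⟩
          rw [hf]
      simp only [Pi.one_apply, Finset.prod_const, hcard]
      rw [Finset.card_image_of_injective]
      · norm_num
      · intro k l hkl
        exact (Prod.ext_iff.1 (place_bijective.1 hkl)).2
    rw [Finset.prod_congr rfl fun x _ => h x, Finset.prod_const, Finset.card_univ]
  · intro d
    obtain ⟨⟨x, k⟩, rfl⟩ := place_bijective.2 d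
    rw [rotate_place, hf, hf]
  · intro x
    exact ⟨place (x, 0), congrArg Prod.fst (hf (x, 0))⟩
  · intro d d' h
    obtain ⟨⟨x, k⟩, rfl⟩ := place_bijective.2 d
    obtain ⟨⟨y, l⟩, rfl⟩ := place_bijective.2 d'
    rw [hf, hf] at h
    obtain rfl : x = y := h
    have hs : ∀ k, F.rotate.SameCycle (place (x, k)) (place (x, k + 1)) := fun k =>
      ⟨1, by rw [zpow_one, rotate_place]⟩
    have h0 : ∀ k, F.rotate.SameCycle (place (x, 0)) (place (x, k)) := by
      intro k
      fin_cases k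
      · exact Equiv.Perm.SameCycle.refl _ _
      · exact hs 0
      · exact (hs 0).trans (hs 1)
    exact (h0 k).symm.trans (h0 l)

variable {K}

theorem sum_corner_eq (i j : C) [Decidable (∃ v, (i, j) ∈ (F.tree v).sides)] :
    ∑ d : F.Dart, (if d.corner = i then (1 : K) else 0) *
      (if Dart.corner (F.rotate d) = j then 1 else 0) =
      if ∃ v, (i, j) ∈ (F.tree v).sides then 1 else 0 := by
  split_ifs with h
  · obtain ⟨v, h⟩ := h
    obtain ⟨d, hd⟩ := Dart.exists_side_eq h
    rw [Finset.sum_eq_single d]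
    · have h1 : d.corner = i := congrArg Prod.fst hd
      have h2 : Dart.corner (F.rotate d) = j := congrArg Prod.snd hd
      simp [h1, h2]
    · intro b _ hb
      by_cases h1 : b.corner = i
      · by_cases h2 : Dart.corner (F.rotate b) = j
        · exact absurd (Dart.side_injective ((Prod.ext h1 h2 : b.side = (i, j)).trans hd.symm)) hb
        · simp [h2]
      · simp [h1]
    · simp
  · refine Finset.sum_eq_zero fun d _ => ?_
    by_cases h1 : d.corner = i
    · by_cases h2 : Dart.corner (F.rotate d) = j
      · obtain ⟨v, hv⟩ := d.side_mem_sides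
        exact absurd ⟨v, (Prod.ext h1 h2 : d.side = (i, j)) ▸ hv⟩ h
      · simp [h2]
    · simp [h1]

/-- `J` gives all darts of a corner the same variable. The entry is a difference of two indicators,
and `swap_notMem_sides` prevents both from being one. -/
theorem transpose_mul_adjacency_mul {I : Type*} (ι : I → C) (J : Matrix F.Dart I K)
    (hJ : ∀ d i, J d i = if d.corner = ι i then 1 else 0) (i j : I)
    [Decidable (∃ v, (ι i, ι j) ∈ (F.tree v).sides)]
    [Decidable (∃ v, (ι j, ι i) ∈ (F.tree v).sides)] :
    (J.transpose * F.adjacency K * J) i j =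
      if ∃ v, (ι i, ι j) ∈ (F.tree v).sides then 1
      else if ∃ v, (ι j, ι i) ∈ (F.tree v).sides then -1 else 0 := by
  have h1 : (J.transpose * F.adjacency K * J) i j =
      (if ∃ v, (ι i, ι j) ∈ (F.tree v).sides then 1 else 0) -
        (if ∃ v, (ι j, ι i) ∈ (F.tree v).sides then 1 else 0) := by
    rw [adjacency, Matrix.mul_sub, Matrix.sub_mul, Matrix.sub_apply, Matrix.mul_assoc,
      Matrix.mul_assoc, ← sum_corner_eq, ← sum_corner_eq, Matrix.mul_apply, Matrix.mul_apply]
    congr 1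
    · refine Finset.sum_congr rfl fun d _ => ?_
      rw [Matrix.weightedPerm_mul_apply, Matrix.transpose_apply, hJ, hJ]
      simp
    · rw [← Equiv.sum_comp F.rotate]
      refine Finset.sum_congr rfl fun d _ => ?_
      rw [Matrix.weightedPerm_mul_apply, Matrix.transpose_apply, hJ, hJ]
      simp [mul_comm]
  rw [h1]
  by_cases h : ∃ v, (ι i, ι j) ∈ (F.tree v).sides
  · have h' : ¬ ∃ v, (ι j, ι i) ∈ (F.tree v).sides := by
      rintro ⟨v', hv'⟩
      obtain ⟨v, hv⟩ := h
      obtain rfl : v = v' := F.eq_of_mem_labels ((F.tree v).mem_labels_of_mem_sides hv).1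
        ((F.tree v').mem_labels_of_mem_sides hv').2
      exact (F.tree v).swap_notMem_sides (F.nodup v) hv hv'
    rw [if_pos h, if_neg h', if_pos h, sub_zero]
  · rw [if_neg h, if_neg h]
    split_ifs <;> simp

end Matrices

end TriangleForest

/-! ### First-return maps and cycles of a permutation modified on marked points. -/

section FirstHit

variable {D : Type v} {Y : Type w}

open Classical in
/-- The first element of `Y` whose image under `δ` is met by the iteration of `ρ`. -/
noncomputable def firstHit (ρ : Equiv.Perm D) (δ : Y → D) (d : D) : Option Y :=
  if h : ∃ n : ℕ, (ρ ^ n) d ∈ Set.range δ then some (Nat.find_spec h).choose else none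

variable {ρ : Equiv.Perm D} {δ : Y → D}

theorem firstHit_spec {d : D} {y : Y} (h : firstHit ρ δ d = some y) :
    ∃ n : ℕ, (ρ ^ n) d = δ y ∧ ∀ m < n, (ρ ^ m) d ∉ Set.range δ := by
  classical
  unfold firstHit at h
  split_ifs at h with hn
  rw [Option.some.injEq] at h
  refine ⟨Nat.find hn, ?_, fun m hm => Nat.find_min hn hm⟩
  rw [← h]
  exact (Nat.find_spec hn).choose_spec.symm

theorem firstHit_eq_some (hδ : Function.Injective δ) {d : D} {y : Y} {n : ℕ}
    (h : (ρ ^ n) d = δ y) (hlt : ∀ m < n, (ρ ^ m) d ∉ Set.range δ) :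
    firstHit ρ δ d = some y := by
  classical
  have hn : ∃ n : ℕ, (ρ ^ n) d ∈ Set.range δ := ⟨n, y, h.symm⟩
  unfold firstHit
  rw [dif_pos hn]
  have hfind : Nat.find hn = n := (Nat.find_eq_iff hn).2 ⟨⟨y, h.symm⟩, hlt⟩
  congr 1
  apply hδ
  rw [(Nat.find_spec hn).choose_spec, hfind, h]

theorem firstHit_apply (hδ : Function.Injective δ) (y : Y) : firstHit ρ δ (δ y) = some y :=
  firstHit_eq_some hδ (n := 0) rfl (by simp)

theorem exists_firstHit_eq_some (hδ : Function.Injective δ) {d : D} {y : Y} {n : ℕ}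
    (h : (ρ ^ n) d = δ y) : ∃ z, firstHit ρ δ d = some z := by
  classical
  have hn : ∃ n : ℕ, (ρ ^ n) d ∈ Set.range δ := ⟨n, y, h.symm⟩
  obtain ⟨z, hz⟩ := Nat.find_spec hn
  exact ⟨z, firstHit_eq_some hδ hz.symm fun m hm => Nat.find_min hn hm⟩

theorem firstHit_of_notMem (hδ : Function.Injective δ) {d : D} (hd : d ∉ Set.range δ) :
    firstHit ρ δ d = firstHit ρ δ (ρ d) := by
  cases h : firstHit ρ δ (ρ d) with
  | some y =>
    obtain ⟨n, hn, hlt⟩ := firstHit_spec h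
    refine firstHit_eq_some hδ (n := n + 1) hn ?_
    intro m hm
    cases m with
    | zero => exact hd
    | succ m => exact hlt m (by omega)
  | none =>
    cases h' : firstHit ρ δ d with
    | none => rfl
    | some y =>
      obtain ⟨n, hn, -⟩ := firstHit_spec h'
      cases n with
      | zero => exact absurd ⟨y, hn.symm⟩ hd
      | succ n =>
        obtain ⟨z, hz⟩ := exists_firstHit_eq_some hδ (ρ := ρ) (d := ρ d) (n := n) hn
        rw [h] at hz
        cases hz

theorem Visits.firstHit_eq (hδ : Function.Injective δ) {d d' : D} {L : List Y}
    (h : Visits ρ δ d L d') : firstHit ρ δ d = L.head?.or (firstHit ρ δ d') := by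
  induction h with
  | nil => simp
  | skip hd _ ih => rw [firstHit_of_notMem hδ hd, ih]
  | hit _ _ => simp [firstHit_apply hδ]

/-- The starting point `y` and the length `n` vary because the induction shortens the list. The
hypothesis `hd'` supplies the successor of the last element. -/
theorem Visits.firstHit_next (hδ : Function.Injective δ) {ω : Y → Y} {d d' : D} {L : List Y}
    (h : Visits ρ δ d L d') (y : Y) (n : ℕ) (hL : L = List.iterate ω y n)
    (hd' : firstHit ρ δ d' = some (ω^[n] y)) :
    ∀ z ∈ L, firstHit ρ δ (ρ (δ z)) = some (ω z) := by
  induction h generalizing y n with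
  | nil => simp
  | skip hd _ ih => exact ih y n hL hd'
  | @hit x L d' h ih =>
    cases n with
    | zero => simp at hL
    | succ n =>
      simp only [List.iterate, List.cons.injEq] at hL
      obtain ⟨rfl, hL⟩ := hL
      intro z hz
      rcases List.mem_cons.1 hz with rfl | hz
      · rw [h.firstHit_eq hδ, hd', hL]
        cases n <;> simp [List.iterate]
      · exact ih (ω x) n hL hd' z hz

/-- If a walk comes back to its starting point after visiting an orbit of `ω`, then `ω` is the
first return map of the walk. -/
theorem Visits.firstHit_next_of_periodic (hδ : Function.Injective δ) {ω : Y → Y} {d : D} (y : Y)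
    (n : ℕ) (h : Visits ρ δ d (List.iterate ω y n) d) (hy : ω^[n] y = y) :
    ∀ z ∈ List.iterate ω y n, firstHit ρ δ (ρ (δ z)) = some (ω z) := by
  cases n with
  | zero => simp
  | succ n =>
    refine h.firstHit_next hδ y _ rfl ?_
    rw [hy, h.firstHit_eq hδ]
    simp [List.iterate]

end FirstHit

section Return

variable {D : Type*} {Y : Type*} {ρ : Equiv.Perm D} {δ : Y ↪ D} {κ ω : Equiv.Perm Y}

theorem mul_viaEmbedding_apply (y : Y) : (ρ * κ.viaEmbedding δ) (δ y) = ρ (δ (κ y)) := by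
  rw [Equiv.Perm.mul_apply, Equiv.Perm.viaEmbedding_apply]

theorem mul_viaEmbedding_apply_of_notMem {d : D} (hd : d ∉ Set.range δ) :
    (ρ * κ.viaEmbedding δ) d = ρ d := by
  rw [Equiv.Perm.mul_apply, Equiv.Perm.viaEmbedding_apply_of_notMem _ _ _ hd]

theorem mul_viaEmbedding_pow_apply {d : D} {n : ℕ} (h : ∀ m < n, (ρ ^ m) d ∉ Set.range δ) :
    ((ρ * κ.viaEmbedding δ) ^ n) d = (ρ ^ n) d := by
  induction n with
  | zero => rfl
  | succ n ih =>
    rw [pow_succ', Equiv.Perm.mul_apply, ih fun m hm => h m (by omega),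
      mul_viaEmbedding_apply_of_notMem (h n (by omega)), pow_succ', Equiv.Perm.mul_apply]

theorem sameCycle_of_firstHit {d : D} {y : Y} (h : firstHit ρ δ d = some y) :
    (ρ * κ.viaEmbedding δ).SameCycle d (δ y) := by
  obtain ⟨n, hn, hlt⟩ := firstHit_spec h
  exact ⟨n, by rw [zpow_natCast, mul_viaEmbedding_pow_apply hlt, hn]⟩

variable (hω : ∀ y, firstHit ρ δ (ρ (δ y)) = some (ω y))

-- After the first step, where `κ` acts, the modified walk agrees with `ρ` until the next marked
-- point. One step of `ω * κ` is thus a stretch of the walk.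
include hω in
theorem sameCycle_of_sameCycle_return [Finite Y] {y y' : Y} (h : (ω * κ).SameCycle y y') :
    (ρ * κ.viaEmbedding δ).SameCycle (δ y) (δ y') := by
  have hstep : ∀ y, (ρ * κ.viaEmbedding δ).SameCycle (δ y) (δ ((ω * κ) y)) := by
    intro y
    rw [← Equiv.Perm.sameCycle_apply_left, mul_viaEmbedding_apply]
    exact sameCycle_of_firstHit (hω (κ y))
  obtain ⟨n, -, hn⟩ := h.exists_pow_eq'
  rw [← hn]
  clear hn
  induction n with
  | zero => exact Equiv.Perm.SameCycle.refl _ _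
  | succ n ih =>
    rw [pow_succ', Equiv.Perm.mul_apply]
    exact ih.trans (hstep _)

-- Every cycle through marked points corresponds to a cycle of `ω * κ`, its unmarked points having
-- `-s = 1`. The cycles indexed by `B` carry no marked point and contribute `1 - 1 = 0`.
include hω in
theorem det_one_add_weightedPerm_return [Fintype D] [DecidableEq D] [Fintype Y] {K : Type*}
    [CommRing K] {V₀ W₀ B : Type*} [Fintype W₀] [DecidableEq W₀] [Fintype B] [DecidableEq B]
    (owner : D → V₀ ⊕ B) (howner : ∀ d, owner (ρ d) = owner d)
    (hsurj : Function.Surjective owner)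
    (hcycle : ∀ d d', owner d = owner d' → ρ.SameCycle d d')
    (hbare : ∀ y b, owner (δ y) ≠ Sum.inr b) (y₀ : V₀ → Y)
    (hy₀ : ∀ v, owner (δ (y₀ v)) = Sum.inl v)
    (vm : Y → W₀) (hvm : Function.Surjective vm) (hvm_inv : ∀ y, vm ((ω * κ) y) = vm y)
    (hvm_trans : ∀ y y', vm y = vm y' → (ω * κ).SameCycle y y')
    (s : D → K) (hs : ∀ d ∉ Set.range δ, s d = -1) :
    (1 + Matrix.weightedPerm (ρ * κ.viaEmbedding δ) s).det =
      (∏ w, (1 - ∏ y with vm y = w, -s (δ y))) * ∏ _b : B, 0 := by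
  classical
  set π := ρ * κ.viaEmbedding δ with hπ
  -- A point is labelled by the class of the next marked point. The default `y₀ v` is never taken,
  -- since `hcycle` guarantees a marked point on the cycle (`hex`).
  let f : D → W₀ ⊕ B := fun d =>
    match owner d with
    | Sum.inl v => Sum.inl (vm ((firstHit ρ δ d).getD (y₀ v)))
    | Sum.inr b => Sum.inr b
  have f_inr : ∀ d b, owner d = Sum.inr b → f d = Sum.inr b := fun d b h => by
    simp only [f, h]
  have f_inl : ∀ d v y, owner d = Sum.inl v → firstHit ρ δ d = some y →
      f d = Sum.inl (vm y) := fun d v y h h' => by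
    simp only [f, h, h', Option.getD_some]
  have hinl : ∀ y, ∃ v, owner (δ y) = Sum.inl v := by
    intro y
    cases h : owner (δ y) with
    | inl v => exact ⟨v, rfl⟩
    | inr b => exact absurd h (hbare y b)
  have f_δ : ∀ y, f (δ y) = Sum.inl (vm y) := by
    intro y
    obtain ⟨v, hv⟩ := hinl y
    exact f_inl _ v y hv (firstHit_apply δ.injective y)
  have hex : ∀ d v, owner d = Sum.inl v → ∃ y, firstHit ρ δ d = some y := by
    intro d v hd
    obtain ⟨n, -, hn⟩ := (hcycle d (δ (y₀ v)) (hd.trans (hy₀ v).symm)).exists_pow_eq'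
    exact exists_firstHit_eq_some δ.injective hn
  have hcases : ∀ d, (∃ b, owner d = Sum.inr b ∧ f d = Sum.inr b) ∨
      ∃ v y, owner d = Sum.inl v ∧ firstHit ρ δ d = some y ∧ f d = Sum.inl (vm y) := by
    intro d
    cases h : owner d with
    | inl v =>
      obtain ⟨y, hy⟩ := hex d v h
      exact Or.inr ⟨v, y, rfl, hy, f_inl d v y h hy⟩
    | inr b => exact Or.inl ⟨b, rfl, f_inr d b h⟩
  have hpow : ∀ d (n : ℕ), owner ((ρ ^ n) d) = owner d := by
    intro d n
    induction n with
    | zero => rfl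
    | succ n ih => rw [pow_succ', Equiv.Perm.mul_apply, howner, ih]
  have hbare' : ∀ d b, owner d = Sum.inr b → d ∉ Set.range δ := by
    rintro _ b hb ⟨y, rfl⟩
    exact hbare y b hb
  rw [Matrix.det_one_add_weightedPerm π s f, Fintype.prod_sum_type]
  · congr 1
    · refine Finset.prod_congr rfl fun w _ => ?_
      congr 1
      rw [← Finset.prod_map (Finset.univ.filter fun y => vm y = w) δ fun d => -s d]
      refine (Finset.prod_subset ?_ ?_).symm
      · intro d hd
        obtain ⟨y, hy, rfl⟩ := Finset.mem_map.1 hd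
        simp only [Finset.mem_filter, Finset.mem_univ, true_and] at hy ⊢
        rw [f_δ, hy]
      · intro d hd hd'
        have : d ∉ Set.range δ := by
          rintro ⟨y, rfl⟩
          apply hd'
          simp only [Finset.mem_filter, Finset.mem_univ, true_and, f_δ, Sum.inl.injEq] at hd
          exact Finset.mem_map_of_mem _ (by simp [hd])
        rw [hs d this, neg_neg]
    · refine Finset.prod_congr rfl fun b _ => ?_
      rw [Finset.prod_eq_one, sub_self]
      intro d hd
      simp only [Finset.mem_filter, Finset.mem_univ, true_and] at hd
      rcases hcases d with ⟨b', hb', -⟩ | ⟨v, y, -, -, h⟩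
      · rw [hs d (hbare' d b' hb'), neg_neg]
      · rw [hd] at h; cases h
  · intro d
    by_cases hd : d ∈ Set.range δ
    · obtain ⟨y, rfl⟩ := hd
      obtain ⟨v, hv⟩ := hinl (κ y)
      rw [f_δ, hπ, mul_viaEmbedding_apply, f_inl _ v (ω (κ y)) (by rw [howner, hv]) (hω (κ y))]
      exact congrArg Sum.inl (hvm_inv y)
    · rw [hπ, mul_viaEmbedding_apply_of_notMem hd]
      rcases hcases d with ⟨b, hb, h⟩ | ⟨v, y, hv, hy, h⟩
      · rw [h, f_inr _ b (by rw [howner, hb])]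
      · rw [h, f_inl _ v y (by rw [howner, hv]) (by rw [← firstHit_of_notMem δ.injective hd, hy])]
  · rintro (w | b)
    · obtain ⟨y, rfl⟩ := hvm w
      exact ⟨δ y, f_δ y⟩
    · obtain ⟨d, hd⟩ := hsurj (Sum.inr b)
      exact ⟨d, f_inr d b hd⟩
  · intro d d' h
    rcases hcases d with ⟨b, hb, hf⟩ | ⟨v, y, hv, hy, hf⟩ <;>
    rcases hcases d' with ⟨b', hb', hf'⟩ | ⟨v', y', hv', hy', hf'⟩ <;>
    rw [hf, hf'] at h
    · rw [Sum.inr.injEq] at h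
      obtain ⟨n, -, hn⟩ := (hcycle d d' (by rw [hb, hb', h])).exists_pow_eq'
      refine ⟨n, ?_⟩
      rw [zpow_natCast, hπ, mul_viaEmbedding_pow_apply, hn]
      exact fun m _ => hbare' _ b (by rw [hpow, hb])
    · cases h
    · cases h
    · rw [Sum.inl.injEq] at h
      exact ((sameCycle_of_firstHit hy).trans
        (sameCycle_of_sameCycle_return hω (hvm_trans y y' h))).trans
        (sameCycle_of_firstHit hy').symm

end Return

theorem List.rotate_iterate {α : Type*} (f : α → α) (x : α) (m k : ℕ) (hx : f^[m] x = x) :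
    (List.iterate f x m).rotate k = List.iterate f (f^[k] x) m := by
  induction k generalizing x with
  | zero => simp
  | succ k ih =>
    have h1 : (List.iterate f x m).rotate 1 = List.iterate f (f x) m := by
      cases m with
      | zero => simp
      | succ m =>
        rw [List.iterate, List.rotate_cons_succ, List.rotate_zero, List.iterate_add f (f x) m 1]
        rw [Function.iterate_succ_apply] at hx
        simp [List.iterate, hx]
    rw [Nat.add_comm k 1, ← List.rotate_rotate, h1, ih (f x)]
    · rw [Nat.add_comm 1 k]
      rfl
    · rw [← Function.iterate_succ_apply, Function.iterate_succ_apply', hx]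

theorem List.exists_eq_iterate_of_coe_eq_periodicOrbit {α : Type*} {f : α → α} {x : α} {L : List α}
    (h : (L : Cycle α) = Function.periodicOrbit f x) :
    ∃ y n, L = List.iterate f y n ∧ f^[n] y = y := by
  unfold Function.periodicOrbit at h
  obtain ⟨k, hk⟩ := (Cycle.coe_eq_coe.1 h).symm
  have hper : f^[Function.minimalPeriod f x] x = x := Function.iterate_minimalPeriod
  refine ⟨f^[k] x, Function.minimalPeriod f x, ?_, ?_⟩
  · rw [← hk, ← List.rotate_iterate f x _ k hper, ← List.range_map_iterate]
  · rw [← Function.iterate_add_apply, Nat.add_comm, Function.iterate_add_apply, hper]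

/-! ### Partial duals, and vertices as cycles of positive crosses. -/

namespace RibbonGraph

variable {X : Type u} [DecidableEq X] (G : RibbonGraph X)

section PartialDual

variable (A B : Finset (Finset X))

theorem isFlag_partialDual (x : X) : (G.partialDual A).IsFlag x ↔ G.IsFlag x := by
  change G.σ₁Off A (G.θOn A x) = x ↔ _
  by_cases h : G.OnEdge A x
  · simp [σ₁Off_apply, θOn_apply, h, onEdge_θ, G.θ_ne, h.1]
  · simp [σ₁Off_apply, θOn_apply, h, IsFlag]

theorem edgeOf_partialDual (x : X) : (G.partialDual A).edgeOf x = G.edgeOf x := by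
  have h1 : (G.partialDual A).θ x = G.σ₁On A (G.θOff A x) := rfl
  have h2 : ∀ x, (G.partialDual A).σ₁ x = G.σ₁Off A (G.θOn A x) := fun _ => rfl
  unfold edgeOf
  rw [h1, h2, h2]
  by_cases h : G.OnEdge A x
  · simp only [σ₁Off_apply, θOn_apply, σ₁On_apply, θOff_apply, h, onEdge_θ, onEdge_σ₁, if_true,
      G.θ_σ₁]
    ext y
    simp only [Finset.mem_insert, Finset.mem_singleton]
    tauto
  · simp [σ₁Off_apply, θOn_apply, σ₁On_apply, θOff_apply, h, onEdge_θ]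

theorem onEdge_partialDual (x : X) : (G.partialDual A).OnEdge B x ↔ G.OnEdge B x := by
  simp only [OnEdge, isFlag_partialDual, edgeOf_partialDual]

theorem edges_partialDual [Fintype X] : (G.partialDual A).edges = G.edges := by
  unfold edges
  have : (G.partialDual A).edgeOf = G.edgeOf := funext (G.edgeOf_partialDual A)
  simp only [isFlag_partialDual, this]

end PartialDual

section Vertices

variable {G}

omit [DecidableEq X] in
theorem sameCycle_θ {x y : X} (h : G.σ₀.SameCycle x y) : G.σ₀.SameCycle (G.θ x) (G.θ y) := by
  have h1 : G.σ₀ = G.θ * G.σ₀⁻¹ * G.θ⁻¹ := by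
    rw [← G.σ₀_θ, mul_inv_cancel_right]
  have h2 : ∀ x, G.θ⁻¹ (G.θ x) = x := fun x => by simp
  rw [h1, Equiv.Perm.sameCycle_conj, h2, h2, Equiv.Perm.sameCycle_inv]
  exact h

variable [Fintype X]

theorem mem_vertexOf {x y : X} :
    y ∈ G.vertexOf x ↔ G.σ₀.SameCycle x y ∨ G.σ₀.SameCycle (G.θ x) y := by
  simp [vertexOf]

theorem vertexOf_eq_of_sameCycle {x y : X} (h : G.σ₀.SameCycle x y) :
    G.vertexOf x = G.vertexOf y := by
  ext z
  have h' := sameCycle_θ h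
  rw [mem_vertexOf, mem_vertexOf]
  exact ⟨Or.imp h.symm.trans h'.symm.trans, Or.imp h.trans h'.trans⟩

theorem vertexOf_θ (x : X) : G.vertexOf (G.θ x) = G.vertexOf x := by
  ext z
  rw [mem_vertexOf, mem_vertexOf, G.θ_sq, or_comm]

theorem mem_vertexOf_iff {x y : X} : y ∈ G.vertexOf x ↔ G.vertexOf y = G.vertexOf x := by
  constructor
  · intro h
    rcases mem_vertexOf.1 h with h | h
    · exact (vertexOf_eq_of_sameCycle h).symm
    · rw [← vertexOf_eq_of_sameCycle h, vertexOf_θ]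
  · intro h
    rw [← h, mem_vertexOf]
    exact Or.inl (Equiv.Perm.SameCycle.refl _ _)

theorem vertexOf_mem_vertices (x : X) : G.vertexOf x ∈ G.vertices :=
  Finset.mem_image_of_mem _ (Finset.mem_univ x)

namespace Orientation

variable (o : G.Orientation)

theorem exists_pos_vertexOf_eq {v : Finset X} (hv : v ∈ G.vertices) :
    ∃ x ∈ o.pos, G.vertexOf x = v := by
  obtain ⟨x, -, rfl⟩ := Finset.mem_image.1 hv
  by_cases hx : x ∈ o.pos
  · exact ⟨x, hx, rfl⟩
  · exact ⟨G.θ x, (o.θ_mem x).2 hx, vertexOf_θ x⟩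

/-- The positive crosses. -/
abbrev Pos := {x : X // x ∈ o.pos}

/-- The counterclockwise rotation of the positive crosses around the vertices. -/
def next : Equiv.Perm o.Pos := G.σ₀.subtypePerm o.σ₀_mem

omit [DecidableEq X] [Fintype X] in
theorem coe_next (x : o.Pos) : (o.next x : X) = G.σ₀ x := rfl

omit [DecidableEq X] [Fintype X] in
theorem coe_next_iterate (x : o.Pos) (n : ℕ) : ((o.next^[n] x : o.Pos) : X) = G.σ₀^[n] x := by
  induction n generalizing x with
  | zero => rfl
  | succ n ih => rw [Function.iterate_succ_apply, ih, coe_next, Function.iterate_succ_apply]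

omit [DecidableEq X] [Fintype X] in
theorem sameCycle_next_iff {x y : o.Pos} :
    o.next.SameCycle x y ↔ G.σ₀.SameCycle (x : X) (y : X) :=
  Equiv.Perm.sameCycle_subtypePerm

omit [DecidableEq X] in
theorem mem_pos_of_sameCycle {x y : X} (h : G.σ₀.SameCycle x y) (hx : x ∈ o.pos) :
    y ∈ o.pos := by
  obtain ⟨n, -, rfl⟩ := h.exists_pow_eq'
  clear h
  induction n with
  | zero => exact hx
  | succ n ih =>
    rw [pow_succ', Equiv.Perm.mul_apply, o.σ₀_mem]
    exact ih

/-- Of the two conjugate cycles at a vertex, `θ` being sign-reversing, only one is positive. -/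
theorem vertexOf_eq_iff (x y : o.Pos) :
    G.vertexOf x = G.vertexOf y ↔ o.next.SameCycle x y := by
  rw [sameCycle_next_iff]
  refine ⟨fun h => ?_, vertexOf_eq_of_sameCycle⟩
  have h' := mem_vertexOf.1 (mem_vertexOf_iff.2 h.symm)
  refine h'.resolve_right fun h'' => ?_
  exact (o.θ_mem x.1).1 (o.mem_pos_of_sameCycle h''.symm y.2) x.2

omit [Fintype X] in
theorem halfRibbonOf_injOn : Set.InjOn G.halfRibbonOf (o.pos : Set X) := by
  intro x hx y hy h
  have hxy : x ∈ G.halfRibbonOf y := h ▸ Finset.mem_insert_self _ _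
  simp only [halfRibbonOf, Finset.mem_insert, Finset.mem_singleton] at hxy
  refine hxy.resolve_right ?_
  rintro rfl
  exact (o.θ_mem y).1 hx hy

omit [Fintype X] in
theorem halfRibbonOf_θ (x : X) : G.halfRibbonOf (G.θ x) = G.halfRibbonOf x := by
  unfold halfRibbonOf
  rw [G.θ_sq, Finset.pair_comm]

/-- Each half-ribbon `{x, θ x}` contains exactly one positive cross, so half-ribbons may be counted
by positive crosses. -/
theorem degree_inl (B : Finset (Finset X)) (v : {v : Finset X // v ∈ G.vertices}) :
    G.degree B (Sum.inl v) = (Finset.univ.filter fun x : o.Pos =>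
      G.vertexOf x = v.1 ∧ (G.IsFlag x ∨ G.OnEdge B x)).card := by
  obtain ⟨v, hv⟩ := v
  obtain ⟨z, -, rfl⟩ := Finset.mem_image.1 hv
  change (((G.vertexOf z).filter fun x => G.IsFlag x ∨ G.OnEdge B x).image G.halfRibbonOf).card = _
  rw [← Finset.card_map (Function.Embedding.subtype _), ← Finset.card_image_of_injOn
    (f := G.halfRibbonOf)]
  · congr 1
    ext h
    simp only [Finset.mem_image, Finset.mem_filter, mem_vertexOf_iff, Finset.mem_map,
      Finset.mem_univ, true_and, Function.Embedding.subtype_apply, Subtype.exists,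
      exists_and_left, exists_prop, exists_eq_right_right]
    constructor
    · rintro ⟨x, ⟨hx, hxB⟩, rfl⟩
      by_cases hpos : x ∈ o.pos
      · exact ⟨x, ⟨⟨hx, hxB⟩, hpos⟩, rfl⟩
      · refine ⟨G.θ x, ⟨⟨by rw [vertexOf_θ, hx], ?_⟩, (o.θ_mem x).2 hpos⟩, halfRibbonOf_θ x⟩
        rw [onEdge_θ]
        refine hxB.imp_left fun h => ?_
        unfold IsFlag at h ⊢
        rw [← G.θ_σ₁, h]
    · rintro ⟨x, ⟨⟨hx, hxB⟩, -⟩, rfl⟩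
      exact ⟨x, ⟨hx, hxB⟩, rfl⟩
  · intro x hx y hy
    have hx' : x ∈ o.pos := by
      obtain ⟨x, -, rfl⟩ := Finset.mem_map.1 hx; exact x.2
    have hy' : y ∈ o.pos := by
      obtain ⟨y, -, rfl⟩ := Finset.mem_map.1 hy; exact y.2
    exact o.halfRibbonOf_injOn hx' hy'

variable (A : Finset (Finset X))

-- On an edge of `A` both factors reverse positivity. This lets `σ₀` of the partial dual act on the
-- same positive crosses.
omit [Fintype X] in
theorem mem_pos_θOn_σ₁On (x : X) : (G.θOn A * G.σ₁On A) x ∈ o.pos ↔ x ∈ o.pos := by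
  rw [Equiv.Perm.mul_apply]
  by_cases h : G.OnEdge A x
  · simp [θOn_apply, σ₁On_apply, h, onEdge_σ₁, o.θ_mem, o.σ₁_mem x h.1]
  · simp [θOn_apply, σ₁On_apply, h]

/-- The exchange of the positive crosses at the two ends of the edges in `A`. -/
def swapOn : Equiv.Perm o.Pos := (G.θOn A * G.σ₁On A).subtypePerm (o.mem_pos_θOn_σ₁On A)

omit [Fintype X] in
theorem coe_swapOn_apply (x : o.Pos) : (o.swapOn A x : X) = G.θOn A (G.σ₁On A x) := rfl

/-- The orientation of the partial dual with the same positive crosses. -/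
def partialDual : (G.partialDual A).Orientation where
  pos := o.pos
  σ₀_mem x := by
    change G.σ₀ ((G.θOn A * G.σ₁On A) x) ∈ o.pos ↔ _
    rw [o.σ₀_mem, o.mem_pos_θOn_σ₁On]
  θ_mem x := by
    change G.σ₁On A (G.θOff A x) ∈ o.pos ↔ _
    by_cases h : G.OnEdge A x
    · simp [θOff_apply, σ₁On_apply, h, o.σ₁_mem x h.1]
    · simp [θOff_apply, σ₁On_apply, h, onEdge_θ, o.θ_mem]
  σ₁_mem x hx := by
    rw [isFlag_partialDual] at hx
    change G.σ₁Off A (G.θOn A x) ∈ o.pos ↔ _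
    by_cases h : G.OnEdge A x
    · simp [θOn_apply, σ₁Off_apply, h, onEdge_θ, o.θ_mem]
    · simp [θOn_apply, σ₁Off_apply, h, o.σ₁_mem x hx]

end Orientation

end Vertices

end RibbonGraph

/-! ### The walk of a presentation and the vertices of the partial dual. -/

namespace RibbonGraph.Presentation

variable {X : Type u} [Fintype X] [DecidableEq X] {G : RibbonGraph X} {o : G.Orientation}
  {C : Type v} (P : G.Presentation o C)

/-- The forest of the trees representing the vertices. -/
def forest : TriangleForest G.Vertex C := ⟨P.tree, P.hasTriangle, P.nodup, P.existsUnique_mem⟩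

/-- The vertex of a cross. -/
def vertexAt (_P : G.Presentation o C) (x : X) : G.Vertex :=
  Sum.inl ⟨G.vertexOf x, vertexOf_mem_vertices x⟩

theorem exists_iterate_sublist (x : o.Pos) :
    ∃ (y : o.Pos) (n : ℕ), o.next^[n] y = y ∧
      (∀ z : o.Pos, z ∈ List.iterate o.next y n ↔ G.vertexOf z = G.vertexOf x) ∧
      ((List.iterate o.next y n).map fun z : o.Pos => P.corner z).Sublist
        (P.tree (P.vertexAt x)).leaves := by
  obtain ⟨L, hL, hsub⟩ := P.cyclic x (vertexOf_mem_vertices x.1) x.2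
  obtain ⟨y, n, rfl, hy⟩ := List.exists_eq_iterate_of_coe_eq_periodicOrbit hL
  have hxper : (x : X) ∈ Function.periodicPts G.σ₀ := G.σ₀.injective.mem_periodicPts x.1
  have hmem : ∀ z, z ∈ List.iterate G.σ₀ y n ↔ G.σ₀.SameCycle x.1 z := by
    intro z
    have h1 : z ∈ Function.periodicOrbit G.σ₀ x.1 ↔ _ := Function.mem_periodicOrbit_iff hxper
    rw [← hL, Cycle.mem_coe_iff] at h1
    rw [h1]
    constructor
    · rintro ⟨m, hm⟩
      exact ⟨m, by rw [zpow_natCast, Equiv.Perm.coe_pow, hm]⟩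
    · intro h
      obtain ⟨m, -, hm⟩ := h.exists_pow_eq'
      exact ⟨m, by rw [← Equiv.Perm.coe_pow, hm]⟩
  -- The list cannot be empty, since the orbit contains `x`.
  have hypos : y ∈ o.pos := by
    cases n with
    | zero =>
      have := (hmem x.1).2 (Equiv.Perm.SameCycle.refl _ _)
      simp at this
    | succ n =>
      exact o.mem_pos_of_sameCycle ((hmem y).1 (by simp [List.iterate])) x.2
  have hmap : (List.iterate o.next ⟨y, hypos⟩ n).map Subtype.val = List.iterate G.σ₀ y n := by
    rw [← List.range_map_iterate, ← List.range_map_iterate, List.map_map]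
    refine List.map_congr_left fun m _ => ?_
    exact o.coe_next_iterate ⟨y, hypos⟩ m
  refine ⟨⟨y, hypos⟩, n, ?_, ?_, ?_⟩
  · apply Subtype.ext
    rw [o.coe_next_iterate]
    exact hy
  · intro z
    rw [eq_comm, o.vertexOf_eq_iff, o.sameCycle_next_iff, ← hmem, ← hmap]
    simp
  · have h2 : ((List.iterate o.next ⟨y, hypos⟩ n).map fun z : o.Pos => P.corner z) =
        (List.iterate G.σ₀ y n).map P.corner := by
      rw [← hmap, List.map_map]
      rfl
    rw [h2]
    exact hsub

theorem corner_mem_leaves (x : o.Pos) : P.corner x ∈ (P.tree (P.vertexAt x)).leaves := by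
  obtain ⟨y, n, -, hmem, hsub⟩ := P.exists_iterate_sublist x
  exact hsub.subset (List.mem_map_of_mem (f := fun z : o.Pos => P.corner z) ((hmem x).2 rfl))

theorem owner_corner (x : o.Pos) : P.forest.owner (P.corner x) = P.vertexAt x :=
  P.forest.owner_eq ((P.tree _).leaves_sublist.subset (P.corner_mem_leaves x))

theorem corner_injective : Function.Injective fun x : o.Pos => P.corner x := by
  intro x x' h
  have hv : P.vertexAt x.1 = P.vertexAt x'.1 := by
    rw [← P.owner_corner, ← P.owner_corner]
    exact congrArg _ h
  have hv' : G.vertexOf x.1 = G.vertexOf x'.1 := congrArg Subtype.val (Sum.inl.inj hv)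
  obtain ⟨y, n, -, hmem, hsub⟩ := P.exists_iterate_sublist x
  have hn := ((P.nodup _).sublist (P.tree _).leaves_sublist).sublist hsub
  exact List.inj_on_of_nodup_map hn ((hmem x).2 rfl) ((hmem x').2 hv'.symm) h

theorem fst_ne_corner (y : o.Pos) (x : P.forest.InnerTriangle) : x.1.1.1 ≠ P.corner y :=
  P.forest.fst_ne_of_mem_leaves (P.corner_mem_leaves y) x

/-- The dart of the corner of a positive cross. -/
def dart : o.Pos ↪ P.forest.Dart :=
  ⟨fun y => Sum.inl (P.corner y), fun _ _ h => P.corner_injective (Sum.inl.inj h)⟩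

open Classical in
/-- The positive cross attached to a corner. -/
noncomputable def attached (c : C) : Option o.Pos :=
  if h : ∃ y : o.Pos, P.corner y = c then some h.choose else none

theorem attached_eq_some (c : C) (y : o.Pos) : P.attached c = some y ↔ P.corner y = c := by
  unfold attached
  split_ifs with h
  · rw [Option.some.injEq]
    constructor
    · rintro rfl; exact h.choose_spec
    · rintro rfl; exact P.corner_injective h.choose_spec
  · simp only [false_iff]
    exact fun h' => h ⟨y, h'⟩

/-- The orbit is a sublist of the attached crosses by the cyclic order condition. Conversely, a
cross attached to a leaf of this tree lies at this vertex by `owner_corner`, so comparing lengths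
gives equality. -/
theorem filterMap_attached_leaves (x : o.Pos) : ∃ (y : o.Pos) (n : ℕ), o.next^[n] y = y ∧
    x ∈ List.iterate o.next y n ∧
    (P.tree (P.vertexAt x)).leaves.filterMap P.attached = List.iterate o.next y n := by
  obtain ⟨y, n, hy, hmem, hsub⟩ := P.exists_iterate_sublist x
  refine ⟨y, n, hy, (hmem x).2 rfl, ?_⟩
  have h1 := hsub.filterMap P.attached
  rw [List.filterMap_map] at h1
  have h2 : (P.attached ∘ fun z : o.Pos => P.corner z) = some :=
    funext fun z => (P.attached_eq_some _ z).2 rfl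
  rw [h2, List.filterMap_some] at h1
  refine (h1.eq_of_length_le ?_).symm
  have hnodup : ((P.tree (P.vertexAt x)).leaves.filterMap P.attached).Nodup := by
    refine ((P.nodup _).sublist (P.tree _).leaves_sublist).filterMap ?_
    intro c c' z hz hz'
    rw [← (P.attached_eq_some c z).1 hz, ← (P.attached_eq_some c' z).1 hz']
  refine (List.subperm_of_subset hnodup fun z hz => ?_).length_le
  obtain ⟨c, hc, hcz⟩ := List.mem_filterMap.1 hz
  rw [P.attached_eq_some] at hcz
  subst hcz
  rw [hmem]
  have h3 := P.owner_corner z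
  rw [P.forest.owner_eq (v := P.vertexAt x) ((P.tree _).leaves_sublist.subset hc)] at h3
  exact (congrArg Subtype.val (Sum.inl.inj h3)).symm

/-- This is where the trees are forgotten: whatever their shape and free leaves, the first-return
map of the walk is `σ₀` on positive crosses. -/
theorem firstHit_walk_dart (y : o.Pos) :
    firstHit P.forest.walk P.dart (P.forest.walk (P.dart y)) = some (o.next y) := by
  obtain ⟨z, n, hz, hy, hL⟩ := P.filterMap_attached_leaves y
  have hvis := TriangleForest.visits_tree (F := P.forest) (cor := fun y : o.Pos => P.corner y)
    P.attached P.attached_eq_some P.fst_ne_corner (P.vertexAt y)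
  change Visits P.forest.walk P.dart _
    ((P.tree (P.vertexAt y)).leaves.filterMap P.attached) _ at hvis
  rw [hL] at hvis
  exact hvis.firstHit_next_of_periodic P.dart.injective z n hz y hy

variable [Fintype C] [DecidableEq C]

/-- The return map `next * swapOn A` is `σ₀` of the partial dual on positive crosses, so its cycles
are the vertices carrying half-ribbons. Each counted half-ribbon puts a factor `-1` into the
product, giving `1 - (-1) ^ degree`; a bare vertex has degree zero and gives `0`. -/
theorem det_one_add_weightedPerm_walk {K : Type*} [CommRing K] (A B : Finset (Finset X))
    (s : P.forest.Dart → K) (hs : ∀ d ∉ Set.range P.dart, s d = -1)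
    (hs' : ∀ y, s (P.dart y) = if G.IsFlag y ∨ G.OnEdge B y then 1 else -1) :
    (1 + Matrix.weightedPerm (P.forest.walk * (o.swapOn A).viaEmbedding P.dart) s).det =
      ∏ v : (G.partialDual A).Vertex, if Odd ((G.partialDual A).degree B v) then 2 else 0 := by
  classical
  have hpos : ∀ v : {v // v ∈ G.vertices}, ∃ y : o.Pos, G.vertexOf y = v.1 := fun v => by
    obtain ⟨y, hy, h⟩ := o.exists_pos_vertexOf_eq v.2
    exact ⟨⟨y, hy⟩, h⟩
  choose y₀ hy₀ using hpos
  have hown : ∀ y, P.forest.owner (TriangleForest.Dart.corner (P.dart y)) = P.vertexAt y :=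
    P.owner_corner
  have key := det_one_add_weightedPerm_return (κ := o.swapOn A) (K := K) P.firstHit_walk_dart
    (V₀ := {v // v ∈ G.vertices}) (B := Fin G.bare)
    (fun d => P.forest.owner d.corner) TriangleForest.owner_walk ?_
    (fun _ _ => TriangleForest.sameCycle_of_owner_eq) ?_ y₀ ?_
    (fun y => (⟨(G.partialDual A).vertexOf y, vertexOf_mem_vertices y.1⟩ :
      {v // v ∈ (G.partialDual A).vertices})) ?_ ?_ ?_ s hs
  · rw [key, Fintype.prod_sum_type]
    congr 1
    · refine Finset.prod_congr rfl fun v _ => ?_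
      rw [(o.partialDual A).degree_inl]
      simp only [isFlag_partialDual, onEdge_partialDual, hs', Subtype.ext_iff]
      have hneg : ∀ y : o.Pos, -(if G.IsFlag y.1 ∨ G.OnEdge B y.1 then (1 : K) else -1) =
          if G.IsFlag y.1 ∨ G.OnEdge B y.1 then -1 else 1 := fun y => by
        split_ifs <;> simp
      simp only [hneg]
      rw [Finset.prod_ite, Finset.prod_const, Finset.prod_const_one, mul_one, Finset.filter_filter]
      change 1 - (-1 : K) ^ (Finset.univ.filter fun x : o.Pos =>
        (G.partialDual A).vertexOf x.1 = v.1 ∧ (G.IsFlag x.1 ∨ G.OnEdge B x.1)).card = 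
        if Odd (Finset.univ.filter fun x : o.Pos =>
        (G.partialDual A).vertexOf x.1 = v.1 ∧ (G.IsFlag x.1 ∨ G.OnEdge B x.1)).card then 2 else 0
      split_ifs with h
      · rw [h.neg_one_pow]; norm_num
      · rw [(Nat.not_odd_iff_even.1 h).neg_one_pow, sub_self]
  · intro v
    exact ⟨Sum.inl (P.tree v).root, P.forest.owner_eq (P.tree v).root_mem_labels⟩
  · intro y b h
    rw [hown] at h
    cases h
  · intro v
    rw [hown]
    exact congrArg Sum.inl (Subtype.ext (hy₀ v))
  · rintro ⟨v, hv⟩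
    obtain ⟨y, hy, h⟩ := (o.partialDual A).exists_pos_vertexOf_eq hv
    exact ⟨⟨y, hy⟩, Subtype.ext h⟩
  · intro y
    refine Subtype.ext ?_
    refine (vertexOf_eq_of_sameCycle (G := G.partialDual A) ?_).symm
    exact ⟨1, by rw [zpow_one]; rfl⟩
  · intro y y' h
    exact ((o.partialDual A).vertexOf_eq_iff y y').1 (congrArg Subtype.val h)

end RibbonGraph.Presentation

/-! ### Ends of edges, and the linear constraints between darts. -/

namespace RibbonGraph.Presentation

open TriangleForest

variable {X : Type u} [Fintype X] [DecidableEq X] {G : RibbonGraph X} {o : G.Orientation}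
  {C : Type v} (P : G.Presentation o C)

/-- The edges, as a type. -/
abbrev Edge (_P : G.Presentation o C) := {e : Finset X // e ∈ G.edges}

variable (e : P.Edge)

theorem head_spec : ¬ G.IsFlag (P.head e) ∧ G.edgeOf (P.head e) = e.1 := by
  obtain ⟨hmem, -⟩ := P.head_mem e
  obtain ⟨x, hx, hxe⟩ := Finset.mem_image.1 e.2
  have hx' : ¬ G.IsFlag x := (Finset.mem_filter.1 hx).2
  rw [← hxe] at hmem ⊢
  have hθ : ∀ x, G.IsFlag (G.θ x) ↔ G.IsFlag x := fun x => by
    simp only [IsFlag, ← G.θ_σ₁, EmbeddingLike.apply_eq_iff_eq]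
  have hσ : ∀ x, G.IsFlag (G.σ₁ x) ↔ G.IsFlag x := fun x => by
    simp only [IsFlag, EmbeddingLike.apply_eq_iff_eq]
  simp only [edgeOf, Finset.mem_insert, Finset.mem_singleton] at hmem
  rcases hmem with h | h | h | h <;> rw [h]
  · exact ⟨hx', rfl⟩
  · exact ⟨by rwa [hθ], edgeOf_θ G x⟩
  · exact ⟨by rwa [hσ], edgeOf_σ₁ G x⟩
  · exact ⟨by rwa [hσ, hθ], by rw [edgeOf_σ₁, edgeOf_θ]⟩

theorem tail_mem_pos : P.tail e ∈ o.pos := by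
  unfold tail
  rw [o.θ_mem, o.σ₁_mem _ (P.head_spec e).1, not_not]
  exact (P.head_mem e).2

/-- The positive cross at the head of an edge. -/
def headPos : o.Pos := ⟨P.head e, (P.head_mem e).2⟩

/-- The positive cross at the tail of an edge. -/
def tailPos : o.Pos := ⟨P.tail e, P.tail_mem_pos e⟩

theorem edgeOf_tail : G.edgeOf (P.tail e) = e.1 := by
  unfold tail
  rw [edgeOf_θ, edgeOf_σ₁, (P.head_spec e).2]

theorem not_isFlag_tail : ¬ G.IsFlag (P.tail e) := by
  have := (P.head_spec e).1
  simpa only [tail, IsFlag, ← G.θ_σ₁, EmbeddingLike.apply_eq_iff_eq] using this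

theorem tail_ne_head : P.tail e ≠ P.head e := by
  unfold tail
  intro h
  apply G.θ_ne_σ₁ (P.head e)
  rw [← G.θ_sq (G.σ₁ (P.head e)), h]

variable {P e}

theorem headPos_inj {e e' : P.Edge} : P.headPos e = P.headPos e' ↔ e = e' := by
  refine ⟨fun h => Subtype.ext ?_, fun h => h ▸ rfl⟩
  rw [← (P.head_spec e).2, ← (P.head_spec e').2]
  exact congrArg G.edgeOf (congrArg Subtype.val h)

theorem tailPos_inj {e e' : P.Edge} : P.tailPos e = P.tailPos e' ↔ e = e' := by
  refine ⟨fun h => Subtype.ext ?_, fun h => h ▸ rfl⟩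
  rw [← P.edgeOf_tail e, ← P.edgeOf_tail e']
  exact congrArg G.edgeOf (congrArg Subtype.val h)

theorem headPos_ne_tailPos {e e' : P.Edge} : P.headPos e ≠ P.tailPos e' := by
  intro h
  have h' : P.head e = P.tail e' := congrArg Subtype.val h
  obtain rfl : e = e' := Subtype.ext (by rw [← (P.head_spec e).2, ← P.edgeOf_tail e', h'])
  exact P.tail_ne_head e h'.symm

/-- Among the four crosses of the edge through `y`, only `y` and `θ (σ₁ y)` are positive. Either the
chosen head is `y`, or `y` is the tail. -/
theorem exists_edge_of_not_isFlag (P : G.Presentation o C) {y : o.Pos} (hy : ¬ G.IsFlag y) :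
    ∃ e : P.Edge, y = P.headPos e ∨ y = P.tailPos e := by
  have he : G.edgeOf y ∈ G.edges :=
    Finset.mem_image_of_mem _ (Finset.mem_filter.2 ⟨Finset.mem_univ _, hy⟩)
  refine ⟨⟨G.edgeOf y, he⟩, ?_⟩
  obtain ⟨hmem, hpos⟩ := P.head_mem ⟨G.edgeOf y, he⟩
  have hmem' : P.head ⟨G.edgeOf y, he⟩ ∈
      ({y.1, G.θ y.1, G.σ₁ y.1, G.σ₁ (G.θ y.1)} : Finset X) := hmem
  simp only [Finset.mem_insert, Finset.mem_singleton] at hmem'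
  rcases hmem' with h | h | h | h
  · exact Or.inl (Subtype.ext h.symm)
  · rw [h, o.θ_mem] at hpos
    exact absurd y.2 hpos
  · rw [h, o.σ₁_mem _ hy] at hpos
    exact absurd y.2 hpos
  · refine Or.inr (Subtype.ext ?_)
    change y.1 = G.θ (G.σ₁ (P.head ⟨G.edgeOf y, he⟩))
    rw [h, G.σ₁_sq, G.θ_sq]

theorem swapOn_headPos (A : Finset (Finset X)) :
    o.swapOn A (P.headPos e) = if e.1 ∈ A then P.tailPos e else P.headPos e := by
  have h : G.OnEdge A (P.head e) ↔ e.1 ∈ A := by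
    rw [OnEdge, (P.head_spec e).2]
    exact and_iff_right (P.head_spec e).1
  apply Subtype.ext
  rw [o.coe_swapOn_apply]
  change G.θOn A (G.σ₁On A (P.head e)) = _
  split_ifs with hA <;> simp [θOn_apply, σ₁On_apply, onEdge_σ₁, h, hA, tailPos, headPos, tail]

theorem swapOn_tailPos (A : Finset (Finset X)) :
    o.swapOn A (P.tailPos e) = if e.1 ∈ A then P.headPos e else P.tailPos e := by
  have h : G.OnEdge A (P.tail e) ↔ e.1 ∈ A := by
    rw [OnEdge, P.edgeOf_tail e]
    exact and_iff_right (P.not_isFlag_tail e)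
  apply Subtype.ext
  rw [o.coe_swapOn_apply]
  change G.θOn A (G.σ₁On A (P.tail e)) = _
  split_ifs with hA
  · simp [θOn_apply, σ₁On_apply, onEdge_σ₁, h, hA, headPos]
    simp [tail, G.θ_σ₁, G.θ_sq, G.σ₁_sq]
  · simp [θOn_apply, σ₁On_apply, h, hA, tailPos]

omit [Fintype X] in
theorem swapOn_of_isFlag (A : Finset (Finset X)) {y : o.Pos} (hy : G.IsFlag y) :
    o.swapOn A y = y := by
  have h : ¬ G.OnEdge A y := fun h => h.1 hy
  apply Subtype.ext
  rw [o.coe_swapOn_apply]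
  simp [θOn_apply, σ₁On_apply, h]

theorem exists_flag_of_not_isInternal {c : C} (hc : ¬ P.IsInternal c) :
    ∃ y : o.Pos, G.IsFlag y ∧ P.corner y = c := by
  unfold IsInternal at hc
  push Not at hc
  obtain ⟨x, hx, rfl⟩ := hc
  by_cases hpos : x ∈ o.pos
  · exact ⟨⟨x, hpos⟩, hx, rfl⟩
  · refine ⟨⟨G.θ x, (o.θ_mem x).2 hpos⟩, ?_, P.corner_θ x⟩
    change G.σ₁ (G.θ x) = G.θ x
    rw [← G.θ_σ₁, hx]

theorem isInternal_corner (y : o.Pos) : P.IsInternal (P.corner y) ↔ ¬ G.IsFlag y := by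
  constructor
  · intro h hy
    exact h y hy rfl
  · intro hy
    by_contra hc
    obtain ⟨z, hz, hzy⟩ := exists_flag_of_not_isInternal hc
    rw [P.corner_injective hzy] at hz
    exact hy hz

theorem isInternal_fst (x : P.forest.InnerTriangle) : P.IsInternal x.1.1.1 := by
  by_contra hc
  obtain ⟨z, -, hz⟩ := exists_flag_of_not_isInternal hc
  exact P.fst_ne_corner z x hz.symm

section Constraints

/-- The external corners. -/
abbrev ExternalCorner (P : G.Presentation o C) := {c : C // ¬ P.IsInternal c}

variable (P) in
/-- The index set of the linear constraints between the darts. -/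
abbrev Constraint := (P.Edge ⊕ P.Edge) ⊕ (P.ExternalCorner ⊕ P.forest.InnerTriangle)

instance [DecidableEq C] : DecidableEq P.Constraint := instDecidableEqSum

variable {K : Type*} [Field K]

theorem dart_inj {y z : o.Pos} : P.dart y = P.dart z ↔ y = z := P.dart.injective.eq_iff

theorem dart_headPos_ne_dart_tailPos {e e' : P.Edge} :
    P.dart (P.headPos e) ≠ P.dart (P.tailPos e') :=
  fun h => headPos_ne_tailPos (dart_inj.1 h)

theorem dart_ne_inl_external {y : o.Pos} (hy : ¬ G.IsFlag y) (c : P.ExternalCorner) :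
    P.dart y ≠ Sum.inl c.1 := by
  intro h
  exact c.2 ((Sum.inl.inj h) ▸ (isInternal_corner y).2 hy)

theorem dart_ne_inl_fst (y : o.Pos) (x : P.forest.InnerTriangle) :
    P.dart y ≠ Sum.inl x.1.1.1 :=
  fun h => P.fst_ne_corner y x (Sum.inl.inj h).symm

theorem dart_ne_inr (y : o.Pos) (x : P.forest.InnerTriangle) : P.dart y ≠ Sum.inr x := by
  intro h; cases h

theorem external_ne_fst (c : P.ExternalCorner) (x : P.forest.InnerTriangle) :
    c.1 ≠ x.1.1.1 :=
  fun h => c.2 (h ▸ isInternal_fst x)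

theorem fst_inj {x y : P.forest.InnerTriangle} : x.1.1.1 = y.1.1.1 ↔ x = y :=
  ⟨fun h => Subtype.ext (Triangle.ext_fst h), fun h => h ▸ rfl⟩

open Classical in
/-- The sign of a dart: `1` for the flags and the halves of the edges in `B`, `-1` otherwise. -/
noncomputable def mark (P : G.Presentation o C) (K : Type*) [Field K] (B : Finset (Finset X))
    (d : P.forest.Dart) : K :=
  if ∃ y, P.dart y = d ∧ (G.IsFlag y.1 ∨ G.OnEdge B y.1) then 1 else -1

theorem mark_dart (B : Finset (Finset X)) (y : o.Pos) :
    P.mark K B (P.dart y) = if G.IsFlag y.1 ∨ G.OnEdge B y.1 then 1 else -1 := by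
  have h : (∃ z, P.dart z = P.dart y ∧ (G.IsFlag z.1 ∨ G.OnEdge B z.1)) ↔
      (G.IsFlag y.1 ∨ G.OnEdge B y.1) := by
    constructor
    · rintro ⟨z, hz, h⟩
      rwa [dart_inj.1 hz] at h
    · exact fun h => ⟨y, rfl, h⟩
  unfold mark
  by_cases hy : G.IsFlag y.1 ∨ G.OnEdge B y.1
  · rw [if_pos hy, if_pos (h.2 hy)]
  · rw [if_neg hy, if_neg (mt h.1 hy)]

theorem mark_of_notMem (B : Finset (Finset X)) {d : P.forest.Dart} (hd : d ∉ Set.range P.dart) :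
    P.mark K B d = -1 := by
  unfold mark
  rw [if_neg]
  rintro ⟨y, rfl, -⟩
  exact hd ⟨y, rfl⟩

/-- The active constraints for the pair `(A, B)`. -/
def active (P : G.Presentation o C) (K : Type*) [Field K] (A B : Finset (Finset X)) :
    P.Constraint → K :=
  Sum.elim (Sum.elim (fun e => if ¬ (e.1 ∈ A ↔ e.1 ∈ B) then 1 else 0)
    (fun e => if e.1 ∈ B then 1 else 0)) 1

variable (P) in
/-- The exchange of darts at the inner corners and at the edges in `A`. -/
noncomputable def exchange (A : Finset (Finset X)) : Equiv.Perm P.forest.Dart :=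
  P.forest.flip * (o.swapOn A).viaEmbedding P.dart

theorem flip_dart (y : o.Pos) : P.forest.flip (P.dart y) = P.dart y :=
  flip_inl_of_forall_ne (P.fst_ne_corner y)

theorem exchange_dart (A : Finset (Finset X)) (y : o.Pos) :
    P.exchange A (P.dart y) = P.dart (o.swapOn A y) := by
  rw [exchange, Equiv.Perm.mul_apply, Equiv.Perm.viaEmbedding_apply, flip_dart]

theorem exchange_of_notMem (A : Finset (Finset X)) {d : P.forest.Dart}
    (hd : d ∉ Set.range P.dart) : P.exchange A d = P.forest.flip d := by
  rw [exchange, Equiv.Perm.mul_apply, Equiv.Perm.viaEmbedding_apply_of_notMem _ _ _ hd]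

theorem onEdge_head (B : Finset (Finset X)) (e : P.Edge) :
    (G.IsFlag (P.headPos e).1 ∨ G.OnEdge B (P.headPos e).1) ↔ e.1 ∈ B := by
  change (G.IsFlag (P.head e) ∨ (_ ∧ G.edgeOf (P.head e) ∈ B)) ↔ _
  rw [(P.head_spec e).2]
  have := (P.head_spec e).1
  tauto

theorem onEdge_tail (B : Finset (Finset X)) (e : P.Edge) :
    (G.IsFlag (P.tailPos e).1 ∨ G.OnEdge B (P.tailPos e).1) ↔ e.1 ∈ B := by
  change (G.IsFlag (P.tail e) ∨ (_ ∧ G.edgeOf (P.tail e) ∈ B)) ↔ _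
  rw [P.edgeOf_tail e]
  have := P.not_isFlag_tail e
  tauto

variable [Fintype C] [DecidableEq C]

variable (P) in
/-- The linear constraints between the darts, with normalisation `κ`. -/
noncomputable def constraint (κ : K) : Matrix P.Constraint P.forest.Dart K :=
  Matrix.of (Sum.elim
    (Sum.elim
      (fun e => κ • (Pi.single (P.dart (P.headPos e)) 1 - Pi.single (P.dart (P.tailPos e)) 1))
      (fun e => κ • (Pi.single (P.dart (P.headPos e)) 1 + Pi.single (P.dart (P.tailPos e)) 1)))
    (Sum.elim
      (fun c => Pi.single (Sum.inl c.1) 1)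
      (fun x => κ • (Pi.single (Sum.inl x.1.1.1) 1 - Pi.single (Sum.inr x) 1))))

omit [Fintype C] in
theorem constraint_head (κ : K) (e : P.Edge) (γ : P.Constraint) :
    P.constraint κ γ (P.dart (P.headPos e)) =
      Sum.elim (Sum.elim (Pi.single e κ) (Pi.single e κ)) 0 γ := by
  have h1 := dart_ne_inl_external (P := P) (y := P.headPos e) (P.head_spec e).1
  have h2 := fun e' : P.Edge => dart_headPos_ne_dart_tailPos (e := e) (e' := e')
  have h3 := fun x => dart_ne_inl_fst (P := P) (P.headPos e) x
  have h4 := fun x => dart_ne_inr (P := P) (P.headPos e) x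
  rcases γ with (e' | e') | (c' | x') <;>
    simp [constraint, Pi.single_apply, h1, h2, h3, h4, headPos_inj, eq_comm]

omit [Fintype C] in
theorem constraint_tail (κ : K) (e : P.Edge) (γ : P.Constraint) :
    P.constraint κ γ (P.dart (P.tailPos e)) =
      Sum.elim (Sum.elim (Pi.single e (-κ)) (Pi.single e κ)) 0 γ := by
  have h1 := dart_ne_inl_external (P := P) (y := P.tailPos e) (P.not_isFlag_tail e)
  have h2 := fun e' : P.Edge => (dart_headPos_ne_dart_tailPos (e := e') (e' := e)).symm
  have h3 := fun x => dart_ne_inl_fst (P := P) (P.tailPos e) x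
  have h4 := fun x => dart_ne_inr (P := P) (P.tailPos e) x
  rcases γ with (e' | e') | (c' | x') <;>
    simp [constraint, Pi.single_apply, h1, h2, h3, h4, tailPos_inj, eq_comm]
  split_ifs <;> simp

omit [Fintype C] in
theorem constraint_external (κ : K) (c : P.ExternalCorner) (γ : P.Constraint) :
    P.constraint κ γ (Sum.inl c.1) = Sum.elim (0 : P.Edge ⊕ P.Edge → K) (Sum.elim (Pi.single c 1) 0) γ := by
  have h1 := fun e : P.Edge =>
    (dart_ne_inl_external (P := P) (y := P.headPos e) (P.head_spec e).1 c).symm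
  have h2 := fun e : P.Edge =>
    (dart_ne_inl_external (P := P) (y := P.tailPos e) (P.not_isFlag_tail e) c).symm
  have h3 := fun x => external_ne_fst c x
  rcases γ with (e' | e') | (c' | x') <;>
    simp [constraint, Pi.single_apply, h1, h2, h3, ← Subtype.ext_iff, eq_comm]

omit [Fintype C] in
theorem constraint_fst (κ : K) (x : P.forest.InnerTriangle) (γ : P.Constraint) :
    P.constraint κ γ (Sum.inl x.1.1.1) = Sum.elim (0 : P.Edge ⊕ P.Edge → K)
        (Sum.elim (0 : P.ExternalCorner → K) (Pi.single x κ)) γ := by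
  have h1 := fun y => (dart_ne_inl_fst (P := P) y x).symm
  have h3 := fun c => (external_ne_fst (P := P) c x).symm
  rcases γ with (e' | e') | (c' | x')
  · simp [constraint, h1]
  · simp [constraint, h1]
  · simp [constraint, h3]
  · by_cases h : x = x'
    · subst h; simp [constraint]
    · have h' : x.1.1.1 ≠ x'.1.1.1 := fun h' => h (fst_inj.1 h')
      simp [constraint, h, h']

omit [Fintype C] in
theorem constraint_inr (κ : K) (x : P.forest.InnerTriangle) (γ : P.Constraint) :
    P.constraint κ γ (Sum.inr x) = Sum.elim (0 : P.Edge ⊕ P.Edge → K)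
        (Sum.elim (0 : P.ExternalCorner → K) (Pi.single x (-κ))) γ := by
  have h1 := fun y => (dart_ne_inr (P := P) y x).symm
  rcases γ with (e' | e') | (c' | x')
  · simp [constraint, h1]
  · simp [constraint, h1]
  · simp [constraint]
  · by_cases h : x = x'
    · subst h; simp [constraint]
    · simp [constraint, h]

omit [Fintype C] in
theorem constraint_free (κ : K) {c : C} (hc : P.IsInternal c) (hc' : ∀ y : o.Pos, P.corner y ≠ c)
    (hx : ∀ x : P.forest.InnerTriangle, x.1.1.1 ≠ c) (γ : P.Constraint) :
    P.constraint κ γ (Sum.inl c) = 0 := by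
  have h1 : ∀ y : o.Pos, (Sum.inl c : P.forest.Dart) ≠ P.dart y :=
    fun y h => hc' y (Sum.inl.inj h).symm
  have h3 := fun x => (hx x).symm
  rcases γ with (e' | e') | (c' | x')
  · simp [constraint, h1]
  · simp [constraint, h1]
  · have : c ≠ c'.1 := fun h => c'.2 (h ▸ hc)
    simp [constraint, this]
  · simp [constraint, h3]

/-- Rows have disjoint supports, except the difference and the sum attached to one edge, which are
orthogonal. The value of `κ` normalises the rows with two entries. -/
theorem constraint_mul_transpose {κ : K} (hκ : 2 * (κ * κ) = 1) :
    P.constraint κ * (P.constraint κ).transpose = 1 := by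
  have hκ' : κ * κ + κ * κ = 1 := by rw [← hκ]; ring
  ext γ γ'
  rw [Matrix.mul_apply']
  change P.constraint κ γ ⬝ᵥ P.constraint κ γ' = _
  rw [Matrix.one_apply]
  rcases γ' with (e | e) | (c | x)
  · have h : P.constraint κ γ ⬝ᵥ P.constraint κ (Sum.inl (Sum.inl e)) =
        κ * (P.constraint κ γ (P.dart (P.headPos e)) -
          P.constraint κ γ (P.dart (P.tailPos e))) := by
      have hrow : P.constraint κ (Sum.inl (Sum.inl e)) =
          κ • (Pi.single (P.dart (P.headPos e)) 1 - Pi.single (P.dart (P.tailPos e)) 1) := rfl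
      rw [hrow]
      simp [dotProduct_sub]
    rw [h, constraint_head, constraint_tail]
    rcases γ with (e' | e') | (c' | x') <;> simp [Pi.single_apply]
    split_ifs <;> simp [mul_add, hκ']
  · have h : P.constraint κ γ ⬝ᵥ P.constraint κ (Sum.inl (Sum.inr e)) =
        κ * (P.constraint κ γ (P.dart (P.headPos e)) +
          P.constraint κ γ (P.dart (P.tailPos e))) := by
      have hrow : P.constraint κ (Sum.inl (Sum.inr e)) =
          κ • (Pi.single (P.dart (P.headPos e)) 1 + Pi.single (P.dart (P.tailPos e)) 1) := rfl
      rw [hrow]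
      simp [dotProduct_add, mul_add]
    rw [h, constraint_head, constraint_tail]
    rcases γ with (e' | e') | (c' | x') <;> simp [Pi.single_apply]
    · split_ifs <;> simp
    · split_ifs <;> simp [mul_add, hκ']
  · have h : P.constraint κ γ ⬝ᵥ P.constraint κ (Sum.inr (Sum.inl c)) =
        P.constraint κ γ (Sum.inl c.1) := by
      have hrow : P.constraint κ (Sum.inr (Sum.inl c)) =
          Pi.single (Sum.inl c.1) 1 := rfl
      rw [hrow]
      simp
    rw [h, constraint_external]
    rcases γ with (e' | e') | (c' | x') <;> simp [Pi.single_apply]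
  · have h : P.constraint κ γ ⬝ᵥ P.constraint κ (Sum.inr (Sum.inr x)) =
        κ * (P.constraint κ γ (Sum.inl x.1.1.1) - P.constraint κ γ (Sum.inr x)) := by
      have hrow : P.constraint κ (Sum.inr (Sum.inr x)) =
          κ • (Pi.single (Sum.inl x.1.1.1) 1 - Pi.single (Sum.inr x) 1) := rfl
      rw [hrow]
      simp [dotProduct_sub]
    rw [h, constraint_fst, constraint_inr]
    rcases γ with (e' | e') | (c' | x') <;> simp [Pi.single_apply]
    split_ifs <;> simp [mul_add, hκ']

/-- Checked on each group of darts. A flag gives `2 = 1 + 1`, a free corner `0 = 1 - 1`, an inner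
corner `1 - swap`. On the two ends of an edge the difference row gives `1 - swap` and the sum row `1
+ swap`. So the edge contributes `1 + swap` on `A ∩ B`, `1 - swap` on `A \ B`, `1 + 1` on `B \ A`
and `1 - 1` elsewhere, which is the reason for the encoding in `active`. -/
theorem two_mul_constraint_mul {κ : K} (hκ : 2 * (κ * κ) = 1) (A B : Finset (Finset X)) :
    (2 : K) • ((P.constraint κ).transpose * Matrix.diagonal (P.active K A B) * P.constraint κ) =
      1 + Matrix.weightedPerm (P.exchange A) (P.mark K B) := by
  ext d d'
  have hL : ((2 : K) • ((P.constraint κ).transpose * Matrix.diagonal (P.active K A B) *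
      P.constraint κ)) d d' =
      2 * ∑ γ, P.constraint κ γ d * P.active K A B γ * P.constraint κ γ d' := by
    rw [Matrix.smul_apply, Matrix.mul_apply, smul_eq_mul]
    simp [Matrix.mul_diagonal]
  have hR : (1 + Matrix.weightedPerm (P.exchange A) (P.mark K B)) d d' =
      (if d = d' then 1 else 0) + if d = P.exchange A d' then P.mark K B d' else 0 := by
    rw [Matrix.add_apply, Matrix.one_apply]
    rfl
  rw [hL, hR]
  have hneg : ∀ (p : Prop) [Decidable p], (if p then (-1 : K) else 0) = -(if p then 1 else 0) :=
    fun p _ => by split_ifs <;> simp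
  have hu : ∀ e : P.Edge, P.constraint κ (Sum.inl (Sum.inl e)) d =
      κ * ((if d = P.dart (P.headPos e) then 1 else 0) -
        (if d = P.dart (P.tailPos e) then 1 else 0)) := fun e => by
    simp [constraint, Pi.single_apply]
  have hv : ∀ e : P.Edge, P.constraint κ (Sum.inl (Sum.inr e)) d =
      κ * ((if d = P.dart (P.headPos e) then 1 else 0) +
        (if d = P.dart (P.tailPos e) then 1 else 0)) := fun e => by
    simp [constraint, Pi.single_apply, mul_add]
  have hc : ∀ c : P.ExternalCorner, P.constraint κ (Sum.inr (Sum.inl c)) d =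
      if d = Sum.inl c.1 then 1 else 0 := fun c => by
    simp [constraint, Pi.single_apply]
  have hx : ∀ x : P.forest.InnerTriangle, P.constraint κ (Sum.inr (Sum.inr x)) d =
      κ * ((if d = Sum.inl x.1.1.1 then 1 else 0) -
        (if d = Sum.inr x then 1 else 0)) := fun x => by
    simp [constraint, Pi.single_apply]
  have hau : ∀ e : P.Edge, P.active K A B (Sum.inl (Sum.inl e)) =
    if ¬ (e.1 ∈ A ↔ e.1 ∈ B) then 1 else 0 := fun _ => rfl
  have hav : ∀ e : P.Edge, P.active K A B (Sum.inl (Sum.inr e)) =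
    if e.1 ∈ B then 1 else 0 := fun _ => rfl
  have ha : ∀ n, P.active K A B (Sum.inr n) = 1 := fun _ => rfl
  rcases d' with c | x
  · by_cases hy : ∃ y : o.Pos, P.corner y = c
    · obtain ⟨y, rfl⟩ := hy
      change 2 * ∑ γ, _ * _ * P.constraint κ γ (P.dart y) = (if d = P.dart y then 1 else 0) +
        if d = P.exchange A (P.dart y) then P.mark K B (P.dart y) else 0
      rw [exchange_dart, mark_dart]
      by_cases hflag : G.IsFlag y
      · rw [swapOn_of_isFlag A hflag, if_pos (Or.inl hflag)]
        have hext : ¬ P.IsInternal (P.corner y) := by rw [isInternal_corner]; simpa using hflag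
        have h1 : ∀ γ, P.constraint κ γ (P.dart y) = _ :=
          fun γ => constraint_external κ ⟨P.corner y, hext⟩ γ
        have h2 : ∑ γ, P.constraint κ γ d * P.active K A B γ * P.constraint κ γ (P.dart y) =
            P.constraint κ (Sum.inr (Sum.inl ⟨P.corner y, hext⟩)) d := by
          simp [h1, Pi.single_apply, ha]
        rw [h2, hc, two_mul]
        rfl
      · obtain ⟨e, rfl | rfl⟩ := P.exists_edge_of_not_isFlag hflag
        · have h2 : ∑ γ, P.constraint κ γ d * P.active K A B γ *
              P.constraint κ γ (P.dart (P.headPos e)) =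
              P.constraint κ (Sum.inl (Sum.inl e)) d * P.active K A B (Sum.inl (Sum.inl e)) * κ +
              P.constraint κ (Sum.inl (Sum.inr e)) d * P.active K A B (Sum.inl (Sum.inr e)) * κ := by
            simp [constraint_head, Fintype.sum_sum_type, Pi.single_apply]
          rw [h2, hu, hv, hau, hav, swapOn_headPos]
          simp only [onEdge_head]
          generalize hδ : (if d = P.dart (P.headPos e) then (1 : K) else 0) = δ
          generalize hδ' : (if d = P.dart (P.tailPos e) then (1 : K) else 0) = δ'
          by_cases hA : e.1 ∈ A <;> by_cases hB : e.1 ∈ B <;>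
            simp only [hA, hB, if_true, if_false, not_true_eq_false, not_false_eq_true, iff_true,
              iff_false, iff_self, hneg, hδ, hδ']
          · linear_combination (δ + δ') * hκ
          · linear_combination (δ - δ') * hκ
          · linear_combination 2 * δ * hκ
          · ring
        · have h2 : ∑ γ, P.constraint κ γ d * P.active K A B γ *
              P.constraint κ γ (P.dart (P.tailPos e)) =
              -(P.constraint κ (Sum.inl (Sum.inl e)) d * P.active K A B (Sum.inl (Sum.inl e)) * κ) +
              P.constraint κ (Sum.inl (Sum.inr e)) d * P.active K A B (Sum.inl (Sum.inr e)) * κ := by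
            simp [constraint_tail, Fintype.sum_sum_type, Pi.single_apply]
          rw [h2, hu, hv, hau, hav, swapOn_tailPos]
          simp only [onEdge_tail]
          generalize hδ : (if d = P.dart (P.headPos e) then (1 : K) else 0) = δ
          generalize hδ' : (if d = P.dart (P.tailPos e) then (1 : K) else 0) = δ'
          by_cases hA : e.1 ∈ A <;> by_cases hB : e.1 ∈ B <;>
            simp only [hA, hB, if_true, if_false, not_true_eq_false, not_false_eq_true, iff_true,
              iff_false, iff_self, hneg, hδ, hδ']
          · linear_combination (δ + δ') * hκ
          · linear_combination (δ' - δ) * hκ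
          · linear_combination 2 * δ' * hκ
          · ring
    · push Not at hy
      have hd : (Sum.inl c : P.forest.Dart) ∉ Set.range P.dart := by
        rintro ⟨y, hyc⟩; exact hy y (Sum.inl.inj hyc)
      rw [exchange_of_notMem A hd, mark_of_notMem B hd]
      by_cases hcx : ∃ x : P.forest.InnerTriangle, x.1.1.1 = c
      · obtain ⟨x, rfl⟩ := hcx
        have h2 : ∑ γ, P.constraint κ γ d * P.active K A B γ *
            P.constraint κ γ (Sum.inl x.1.1.1) =
            P.constraint κ (Sum.inr (Sum.inr x)) d * κ := by
          simp [constraint_fst, Pi.single_apply, ha]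
        rw [h2, hx, flip_inl, hneg]
        linear_combination ((if d = Sum.inl x.1.1.1 then 1 else 0) -
          (if d = Sum.inr x then 1 else 0)) * hκ
      · push Not at hcx
        -- A free corner: no half-ribbon is attached and no inner triangle has it as first corner,
        -- so no constraint meets it.
        have hint : P.IsInternal c := by
          by_contra hc
          obtain ⟨y, -, h⟩ := exists_flag_of_not_isInternal hc
          exact hy y h
        simp only [constraint_free κ hint hy hcx, flip_inl_of_forall_ne hcx]
        split_ifs <;> simp
  · have hd : (Sum.inr x : P.forest.Dart) ∉ Set.range P.dart := by
      rintro ⟨y, hy⟩; exact dart_ne_inr y x hy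
    rw [exchange_of_notMem A hd, mark_of_notMem B hd]
    have h2 : ∑ γ, P.constraint κ γ d * P.active K A B γ * P.constraint κ γ (Sum.inr x) =
        -(P.constraint κ (Sum.inr (Sum.inr x)) d * κ) := by
      simp [constraint_inr, Pi.single_apply, ha]
    rw [h2, hx, flip_inr, hneg]
    linear_combination ((if d = Sum.inr x then 1 else 0) -
      (if d = Sum.inl x.1.1.1 then 1 else 0)) * hκ

end Constraints

end RibbonGraph.Presentation

/-! ### Passage from internal corners to darts. -/

namespace RibbonGraph.Presentation

open TriangleForest

variable {X : Type u} [Fintype X] [DecidableEq X] {G : RibbonGraph X} {o : G.Orientation}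
  {C : Type v} [Fintype C] [DecidableEq C] (P : G.Presentation o C)

/-- The darts, sorted into internal corners, external corners and inner triangles. -/
def dartEquiv : P.InternalCorner ⊕ (P.ExternalCorner ⊕ P.forest.InnerTriangle) ≃ P.forest.Dart :=
  (Equiv.sumAssoc _ _ _).symm.trans ((Equiv.sumCompl P.IsInternal).sumCongr (Equiv.refl _))

variable (K : Type w) [Field K]

/-- The indicator matrix of the internal corner under an inner triangle. -/
def foot : Matrix (P.ExternalCorner ⊕ P.forest.InnerTriangle) P.InternalCorner K :=
  Matrix.fromRows 0 (Matrix.of fun x i => if x.1.1.1 = i.1 then 1 else 0)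

variable {K} in
/-- The coefficients of the eliminated darts in their constraints. -/
def pivot (κ : K) : Matrix (P.ExternalCorner ⊕ P.forest.InnerTriangle)
    (P.ExternalCorner ⊕ P.forest.InnerTriangle) K :=
  Matrix.diagonal (Sum.elim 1 fun _ => -κ)

variable [Algebra ℝ K]

theorem two_mul_algebraMap_sq :
    2 * (algebraMap ℝ K (1 / √2) * algebraMap ℝ K (1 / √2)) = 1 := by
  rw [← map_mul, one_div, ← mul_inv, Real.mul_self_sqrt (by norm_num), map_inv₀, map_ofNat]
  have : (2 : K) ≠ 0 := by
    rw [← map_ofNat (algebraMap ℝ K) 2]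
    exact (map_ne_zero _).2 (by norm_num)
  exact mul_inv_cancel₀ this

omit [Fintype C] in
theorem incidence_inl (e : P.Edge) (i : P.InternalCorner) :
    P.incidence K (Sum.inl e) i = algebraMap ℝ K (1 / √2) *
      ((if i.1 = P.corner (P.head e) then 1 else 0) -
        (if i.1 = P.corner (P.tail e) then 1 else 0)) := by
  have h : P.corner (P.head e) ≠ P.corner (P.tail e) := fun h =>
    headPos_ne_tailPos (e := e) (e' := e) (P.corner_injective h)
  simp only [incidence, Matrix.smul_apply, Matrix.fromRows_apply_inl, Matrix.map_apply, ε,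
    Matrix.of_apply, smul_eq_mul]
  congr 1
  by_cases h1 : P.corner (P.head e) = i.1
  · simp [← h1, h]
  · by_cases h2 : P.corner (P.tail e) = i.1
    · simp [← h2, h, h.symm]
    · simp [h1, h2, Ne.symm h1, Ne.symm h2]

omit [Fintype C] in
theorem incidence_inr (e : P.Edge) (i : P.InternalCorner) :
    P.incidence K (Sum.inr e) i = algebraMap ℝ K (1 / √2) *
      ((if i.1 = P.corner (P.head e) then 1 else 0) +
        (if i.1 = P.corner (P.tail e) then 1 else 0)) := by
  have h : P.corner (P.head e) ≠ P.corner (P.tail e) := fun h =>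
    headPos_ne_tailPos (e := e) (e' := e) (P.corner_injective h)
  simp only [incidence, Matrix.smul_apply, Matrix.fromRows_apply_inr, Matrix.map_apply, ε,
    Matrix.of_apply, smul_eq_mul]
  congr 1
  by_cases h1 : P.corner (P.head e) = i.1
  · simp [← h1, h]
  · by_cases h2 : P.corner (P.tail e) = i.1
    · simp [← h2, h, h.symm]
    · simp [h1, h2, Ne.symm h1, Ne.symm h2]

omit [Fintype C] [DecidableEq C] in
theorem inl_eq_dart {c : C} {y : o.Pos} : Sum.inl c = P.dart y ↔ c = P.corner y :=
  ⟨fun h => Sum.inl.inj h, fun h => congrArg Sum.inl h⟩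

/-- The constraints at external and inner corners are solved for the external darts and the darts
`inr`. This is the shape required by `det_fromBlocks_eliminate`. -/
theorem constraint_submatrix_dartEquiv :
    (P.constraint (algebraMap ℝ K (1 / √2))).submatrix id P.dartEquiv =
      Matrix.fromBlocks (P.incidence K) 0
        (-(P.pivot (algebraMap ℝ K (1 / √2)) * P.foot K)) (P.pivot (algebraMap ℝ K (1 / √2))) := by
  ext γ d
  rw [Matrix.submatrix_apply, id]
  rcases γ with (e | e) | (c | x) <;> rcases d with i | (c' | x')
  · rw [Matrix.fromBlocks_apply₁₁, incidence_inl]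
    simp [constraint, dartEquiv, Pi.single_apply, inl_eq_dart, headPos, tailPos, mul_sub]
  · have h1 := (dart_ne_inl_external (P := P) (y := P.headPos e) (P.head_spec e).1 c').symm
    have h2 := (dart_ne_inl_external (P := P) (y := P.tailPos e) (P.not_isFlag_tail e) c').symm
    simp [constraint, dartEquiv, h1, h2]
  · have h1 := fun y => (dart_ne_inr (P := P) y x').symm
    simp [constraint, dartEquiv, h1]
  · rw [Matrix.fromBlocks_apply₁₁, incidence_inr]
    simp [constraint, dartEquiv, Pi.single_apply, inl_eq_dart, headPos, tailPos, mul_add]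
  · have h1 := (dart_ne_inl_external (P := P) (y := P.headPos e) (P.head_spec e).1 c').symm
    have h2 := (dart_ne_inl_external (P := P) (y := P.tailPos e) (P.not_isFlag_tail e) c').symm
    simp [constraint, dartEquiv, h1, h2]
  · have h1 := fun y => (dart_ne_inr (P := P) y x').symm
    simp [constraint, dartEquiv, h1]
  · have h1 : i.1 ≠ c.1 := fun h => c.2 (h ▸ i.2)
    rw [Matrix.fromBlocks_apply₂₁, Matrix.neg_apply, pivot, Matrix.diagonal_mul]
    simp [constraint, dartEquiv, foot, h1]
  · simp [constraint, dartEquiv, Pi.single_apply, pivot, Matrix.diagonal_apply, ← Subtype.ext_iff,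
      eq_comm]
  · simp [constraint, dartEquiv, pivot]
  · rw [Matrix.fromBlocks_apply₂₁, Matrix.neg_apply, pivot, Matrix.diagonal_mul]
    simp [constraint, dartEquiv, Pi.single_apply, foot, eq_comm]
    split_ifs <;> simp
  · have h3 := external_ne_fst (P := P) c' x
    simp [constraint, dartEquiv, pivot, h3]
  · simp [constraint, dartEquiv, Pi.single_apply, pivot, Matrix.diagonal_apply, eq_comm]
    split_ifs <;> simp

-- The substitution `fromRows 1 (foot K)` copies the variable of an internal corner to all its darts
-- and puts `0` at external corners.
omit [Algebra ℝ K] in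
theorem foot_transpose_mul_adjacency_mul :
    (Matrix.fromRows (1 : Matrix P.InternalCorner P.InternalCorner K) (P.foot K)).transpose *
        (P.forest.adjacency K).submatrix P.dartEquiv P.dartEquiv *
        Matrix.fromRows (1 : Matrix P.InternalCorner P.InternalCorner K) (P.foot K) =
      P.α.map fun n : ℤ => (n : K) := by
  set J := (Matrix.fromRows (1 : Matrix P.InternalCorner P.InternalCorner K) (P.foot K)).submatrix P.dartEquiv.symm id with hJ
  have hJ' : Matrix.fromRows (1 : Matrix P.InternalCorner P.InternalCorner K) (P.foot K) = J.submatrix P.dartEquiv id := by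
    rw [hJ, Matrix.submatrix_submatrix]
    simp
  rw [hJ', Matrix.transpose_submatrix, Matrix.submatrix_mul_equiv, Matrix.submatrix_mul_equiv,
    Matrix.submatrix_id_id]
  have key : ∀ d (i : P.InternalCorner), J d i = if Dart.corner d = i.1 then 1 else 0 := by
    intro d i
    obtain ⟨d, rfl⟩ := P.dartEquiv.surjective d
    rw [hJ, Matrix.submatrix_apply, Equiv.symm_apply_apply, id]
    rcases d with j | (c | x)
    · simp [dartEquiv, Dart.corner, Matrix.one_apply, Subtype.ext_iff]
    · have h1 : c.1 ≠ i.1 := fun h => c.2 (h ▸ i.2)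
      simp [dartEquiv, Dart.corner, foot, h1]
    · simp [dartEquiv, Dart.corner, foot]
  ext i j
  rw [transpose_mul_adjacency_mul (fun i : P.InternalCorner => i.1) J key, Matrix.map_apply, α,
    Matrix.of_apply]
  change (if ∃ v, (i.1, j.1) ∈ (P.tree v).sides then (1 : K)
      else if ∃ v, (j.1, i.1) ∈ (P.tree v).sides then -1 else 0) = _
  split_ifs <;> simp

-- The bordered determinant is compared with its version on darts. The factor `det (1 + W)` supplies
-- a `2` per triangle, and the elimination costs `κ ^ 2 = 1 / 2` per inner triangle, so one `2` per
-- vertex of `G` is left.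
set_option synthInstance.maxSize 1000 in
theorem two_pow_mul_det_fromBlocks (A B : Finset (Finset X)) :
    2 ^ G.numVertices * (Matrix.fromBlocks
      (Matrix.diagonal fun s => 1 - P.active K A B (Sum.inl s))
      (Matrix.diagonal (fun s => P.active K A B (Sum.inl s)) * P.incidence K)
      (-(P.incidence K).transpose) (P.α.map fun n : ℤ => (n : K))).det =
    ∏ v : (G.partialDual A).Vertex, if Odd ((G.partialDual A).degree B v) then 2 else 0 := by
  set κ := algebraMap ℝ K (1 / √2) with hκdef
  have hκ : 2 * (κ * κ) = 1 := two_mul_algebraMap_sq K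
  set p := P.active K A B with hp
  have hp2 : ∀ s, p s * p s = p s := by
    rintro ((e | e) | n)
    · simp only [hp, active, Sum.elim_inl]; split_ifs <;> simp
    · simp only [hp, active, Sum.elim_inl, Sum.elim_inr]; split_ifs <;> simp
    · simp [hp, active]
  have hbig := Matrix.det_mul_det_fromBlocks_constraints p hp2 (P.constraint κ)
    (constraint_mul_transpose hκ) _ _ _ (P.forest.one_add_rotate_mul_adjacency K)
  set k := P.pivot κ with hk
  -- Because `2 * κ ^ 2 = 1`, the inverse of `-κ` is `-(2 * κ)`.
  have hkk : Matrix.diagonal (Sum.elim 1 fun _ => -(2 * κ)) * k = 1 := by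
    rw [hk, pivot, Matrix.diagonal_mul_diagonal, ← Matrix.diagonal_one]
    congr 1
    funext n
    rcases n with n | n
    · simp
    · simp only [Sum.elim_inr]; linear_combination hκ
  have helim := Matrix.det_fromBlocks_eliminate
    (Matrix.diagonal fun s => 1 - p (Sum.inl s))
    (Matrix.diagonal (fun s => p (Sum.inl s)) * P.incidence K)
    (-(P.incidence K).transpose) (P.foot K) k _ hkk
    ((P.forest.adjacency K).submatrix P.dartEquiv P.dartEquiv)
  rw [foot_transpose_mul_adjacency_mul] at helim
  have hreindex : (Matrix.fromBlocks (Matrix.diagonal fun s => 1 - p s)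
      (Matrix.diagonal p * P.constraint κ) (-(P.constraint κ).transpose)
      (P.forest.adjacency K)).submatrix ((Equiv.refl _).sumCongr P.dartEquiv)
        ((Equiv.refl _).sumCongr P.dartEquiv) =
      Matrix.fromBlocks (Matrix.fromBlocks (Matrix.diagonal fun s => 1 - p (Sum.inl s)) 0 0 0)
        (Matrix.fromBlocks (Matrix.diagonal (fun s => p (Sum.inl s)) * P.incidence K) 0
          (-(k * P.foot K)) k)
        (Matrix.fromBlocks (-(P.incidence K).transpose) ((P.foot K).transpose * k) 0 (-k))
        ((P.forest.adjacency K).submatrix P.dartEquiv P.dartEquiv) := by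
    have hcon := P.constraint_submatrix_dartEquiv K
    rw [← hκdef, ← hk] at hcon
    have hentry : ∀ γ d, P.constraint κ γ (P.dartEquiv d) =
        Matrix.fromBlocks (P.incidence K) 0 (-(k * P.foot K)) k γ d := fun γ d => by
      rw [← hcon]; rfl
    have hkt : k.transpose = k := by rw [hk, pivot, Matrix.diagonal_transpose]
    have hpr : ∀ n, p (Sum.inr n) = 1 := fun _ => rfl
    ext a b
    rcases a with γ | d <;> rcases b with γ' | d'
    · rcases γ with s | n <;> rcases γ' with s' | n' <;>
        simp [Matrix.diagonal_apply, hpr]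
    · rcases γ with s | n <;> rcases d' with i | n' <;>
        simp [Matrix.diagonal_mul, hentry, hpr]
    · have : ∀ i n, ((P.foot K).transpose * k) i n = (k * P.foot K) n i := fun i n => by
        rw [← Matrix.transpose_apply (k * P.foot K), Matrix.transpose_mul, hkt]
      rcases γ' with s | n <;> rcases d with i | n' <;>
        simp [hentry, this]
      exact congrFun (congrFun hkt n') n
    · rfl
  rw [← hreindex, Matrix.det_submatrix_equiv_self] at helim
  have hdetk : k.det ^ 2 * 2 ^ Fintype.card P.forest.InnerTriangle = 1 := by
    rw [hk, pivot, Matrix.det_diagonal, Fintype.prod_sum_type]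
    simp only [Sum.elim_inl, Sum.elim_inr, Pi.one_apply, Finset.prod_const_one, one_mul,
      Finset.prod_const, Finset.card_univ]
    rw [← pow_mul, mul_comm _ 2, pow_mul, ← mul_pow]
    convert one_pow _
    linear_combination hκ
  have hcard := P.forest.card_triangle
  -- With `W` the rotation, the left side is `1 - W + W * (2 Fᵀ P F)`, and `2 Fᵀ P F` is one plus
  -- the signed exchange. The two multiples of `W` cancel, and rotation after exchange is the
  -- modified walk.
  have hdet : ((1 : Matrix P.forest.Dart P.forest.Dart K) - Matrix.weightedPerm P.forest.rotate 1 +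
      ((1 : Matrix P.forest.Dart P.forest.Dart K) + Matrix.weightedPerm P.forest.rotate 1 -
        (1 - Matrix.weightedPerm P.forest.rotate 1)) *
        (P.constraint κ).transpose * Matrix.diagonal p * P.constraint κ) =
      1 + Matrix.weightedPerm (P.forest.walk * (o.swapOn A).viaEmbedding P.dart)
        (P.mark K B) := by
    have h1 := P.two_mul_constraint_mul hκ A B
    set W : Matrix P.forest.Dart P.forest.Dart K := Matrix.weightedPerm P.forest.rotate (1 : P.forest.Dart → K)
    have h2 : (1 + W - (1 - W)) = (2 : K) • W := by
      rw [two_smul]; abel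
    have h3 : W * Matrix.weightedPerm (P.exchange A) (P.mark K B) =
        Matrix.weightedPerm (P.forest.walk * (o.swapOn A).viaEmbedding P.dart) (P.mark K B) := by
      rw [Matrix.weightedPerm_mul, exchange, walk, mul_assoc]
      simp
    rw [h2, Matrix.smul_mul, Matrix.smul_mul, Matrix.smul_mul, Matrix.mul_assoc, Matrix.mul_assoc,
      ← Matrix.mul_smul, ← Matrix.mul_assoc (P.constraint κ).transpose, h1, Matrix.mul_add,
      Matrix.mul_one, h3]
    abel
  rw [hdet, det_one_add_rotate, hcard, helim] at hbig
  rw [det_one_add_weightedPerm_walk P A B _ (fun d hd => mark_of_notMem B hd)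
    (fun y => mark_dart B y)] at hbig
  rw [← hbig, pow_add]
  change 2 ^ Fintype.card G.Vertex * _ = _
  linear_combination (-(2 : K) ^ Fintype.card G.Vertex * (Matrix.fromBlocks
      (Matrix.diagonal fun s => 1 - p (Sum.inl s))
      (Matrix.diagonal (fun s => p (Sum.inl s)) * P.incidence K)
      (-(P.incidence K).transpose) (P.α.map fun n : ℤ => (n : K))).det) * hdetk

end RibbonGraph.Presentation

/-! ### Summation over pairs `(A, B)` and the theorem. -/

namespace RibbonGraph

variable {X : Type u} [Fintype X] [DecidableEq X] {G : RibbonGraph X} {o : G.Orientation}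
  {C : Type v} [Fintype C] [DecidableEq C]

theorem prod_odd_eq_ite_admissible {K : Type*} [CommSemiring K] (A B : Finset (Finset X)) :
    ∏ v : (G.partialDual A).Vertex, (if Odd ((G.partialDual A).degree B v) then (2 : K) else 0) =
      if G.Admissible A B then 2 ^ (G.partialDual A).numVertices else 0 := by
  split_ifs with h
  · rw [Finset.prod_congr rfl fun v _ => if_pos (h v), Finset.prod_const, Finset.card_univ]
    rfl
  · unfold Admissible at h
    push Not at h
    obtain ⟨v, hv⟩ := h
    exact Finset.prod_eq_zero (Finset.mem_univ v) (if_neg hv)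

namespace Presentation

variable (P : G.Presentation o C) {K : Type w} [Field K]

/-- The Gaussian variables `u_e`, `v_e` selected by a pair of sets of edges. -/
def support (A B : Finset (Finset X)) : Finset (P.Edge ⊕ P.Edge) :=
  (Finset.univ.filter fun e : P.Edge => ¬ (e.1 ∈ A ↔ e.1 ∈ B)).disjSum
    (Finset.univ.filter fun e : P.Edge => e.1 ∈ B)

omit [Fintype C] [DecidableEq C] in
variable {P} in
theorem inl_mem_support {A B : Finset (Finset X)} {e : P.Edge} :
    Sum.inl e ∈ P.support A B ↔ ¬ (e.1 ∈ A ↔ e.1 ∈ B) := by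
  simp [support]

omit [Fintype C] [DecidableEq C] in
variable {P} in
theorem inr_mem_support {A B : Finset (Finset X)} {e : P.Edge} :
    Sum.inr e ∈ P.support A B ↔ e.1 ∈ B := by
  simp [support]

omit [Fintype C] [DecidableEq C] in
theorem active_inl (A B : Finset (Finset X)) (s : P.Edge ⊕ P.Edge) :
    P.active K A B (Sum.inl s) = if s ∈ P.support A B then 1 else 0 := by
  rcases s with e | e
  · exact if_congr inl_mem_support.symm rfl rfl
  · exact if_congr inr_mem_support.symm rfl rfl

-- The map sends `(A, B)` to the symmetric difference of `A` and `B` in the `u`-variables and to `B`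
-- in the `v`-variables. It is undone by taking a symmetric difference again.
omit [Fintype C] [DecidableEq C] in
theorem sum_support {M : Type*} [AddCommMonoid M] (f : Finset (P.Edge ⊕ P.Edge) → M) :
    ∑ S, f S = ∑ A ∈ G.edges.powerset, ∑ B ∈ G.edges.powerset, f (P.support A B) := by
  rw [← Finset.sum_product']
  symm
  apply Finset.sum_nbij fun p : Finset (Finset X) × Finset (Finset X) => P.support p.1 p.2
  · exact fun _ _ => Finset.mem_univ _
  · rintro ⟨A, B⟩ h ⟨A', B'⟩ h' hS
    simp only [Finset.coe_product, Set.mem_prod, Finset.mem_coe, Finset.mem_powerset] at h h' hS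
    have hB : ∀ e : P.Edge, e.1 ∈ B ↔ e.1 ∈ B' := fun e => by
      rw [← inr_mem_support (A := A), hS, inr_mem_support]
    have hA : ∀ e : P.Edge, e.1 ∈ A ↔ e.1 ∈ A' := fun e => by
      have := inl_mem_support (A := A) (B := B) (e := e)
      rw [hS, inl_mem_support, hB] at this
      tauto
    refine Prod.ext (Finset.ext fun e => ?_) (Finset.ext fun e => ?_)
    · exact ⟨fun he => (hA ⟨e, h.1 he⟩).1 he, fun he => (hA ⟨e, h'.1 he⟩).2 he⟩
    · exact ⟨fun he => (hB ⟨e, h.2 he⟩).1 he, fun he => (hB ⟨e, h'.2 he⟩).2 he⟩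
  · intro S _
    refine ⟨((Finset.univ.filter fun e : P.Edge => ¬ (Sum.inl e ∈ S ↔ Sum.inr e ∈ S)).image
      Subtype.val, (Finset.univ.filter fun e : P.Edge => Sum.inr e ∈ S).image Subtype.val), ?_, ?_⟩
    · simp only [Finset.coe_product, Set.mem_prod, Finset.mem_coe, Finset.mem_powerset,
        Finset.image_subset_iff]
      exact ⟨fun e _ => e.2, fun e _ => e.2⟩
    · ext (e | e)
      · simp only [inl_mem_support, Finset.mem_image, Finset.mem_filter, Finset.mem_univ, true_and,
          Subtype.val_inj, exists_eq_right]
        tauto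
      · simp only [inr_mem_support, Finset.mem_image, Finset.mem_filter, Finset.mem_univ, true_and,
          Subtype.val_inj, exists_eq_right]
  · exact fun _ _ => rfl

-- Edge by edge: `t` is multiplied by `Ω / t` if exactly one of `A`, `B` contains the edge, and by
-- `Ω * t` if `B` does. Division by `t` is the only use of `t ≠ 0`.
omit [Fintype C] [DecidableEq C] in
theorem prod_mul_prod_support (Ω t : Finset X → K) (ht : ∀ e ∈ G.edges, t e ≠ 0)
    {A : Finset (Finset X)} (hA : A ⊆ G.edges) (B : Finset (Finset X)) :
    (∏ e ∈ G.edges, t e) * ∏ s ∈ P.support A B,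
        (Sum.elim (fun e => Ω e.1 / t e.1) (fun e => Ω e.1 * t e.1) : P.Edge ⊕ P.Edge → K) s =
      (∏ e ∈ (G.edges \ A) ∩ (G.edges \ B), t e) * (∏ e ∈ A ∩ (G.edges \ B), Ω e) *
        (∏ e ∈ A ∩ B, Ω e * t e ^ 2) * (∏ e ∈ (G.edges \ A) ∩ B, t e * Ω e ^ 2) := by
  have h1 : (G.edges \ A) ∩ (G.edges \ B) = G.edges.filter fun e => e ∉ A ∧ e ∉ B := by
    ext e; simp only [Finset.mem_inter, Finset.mem_sdiff, Finset.mem_filter]; tauto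
  have h2 : A ∩ (G.edges \ B) = G.edges.filter fun e => e ∈ A ∧ e ∉ B := by
    ext e; simp only [Finset.mem_inter, Finset.mem_sdiff, Finset.mem_filter]; tauto
  have h3 : A ∩ B = G.edges.filter fun e => e ∈ A ∧ e ∈ B := by
    ext e
    have := @hA e
    simp only [Finset.mem_inter, Finset.mem_filter]; tauto
  have h4 : (G.edges \ A) ∩ B = G.edges.filter fun e => e ∉ A ∧ e ∈ B := by
    ext e
    simp only [Finset.mem_inter, Finset.mem_sdiff, Finset.mem_filter]; tauto
  rw [h1, h2, h3, h4, support, Finset.prod_disjSum]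
  simp only [Finset.prod_filter, Sum.elim_inl, Sum.elim_inr]
  rw [Finset.prod_coe_sort G.edges fun e => if ¬ (e ∈ A ↔ e ∈ B) then Ω e / t e else 1,
    Finset.prod_coe_sort G.edges fun e => if e ∈ B then Ω e * t e else 1]
  simp only [← Finset.prod_mul_distrib]
  refine Finset.prod_congr rfl fun e he => ?_
  have hte := ht e he
  by_cases h : e ∈ A <;> by_cases h' : e ∈ B <;>
    simp only [h, h', iff_true, iff_false, not_true_eq_false, not_false_eq_true, and_true, and_false,
      if_true, if_false, one_mul, mul_one] <;>
    field_simp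

theorem HU_eq_sum [Algebra ℝ K] (Ω t : Finset X → K) (ht : ∀ e ∈ G.edges, t e ≠ 0) :
    P.HU Ω t = ∑ A ∈ G.edges.powerset, ∑ B ∈ G.edges.powerset,
      (∏ e ∈ (G.edges \ A) ∩ (G.edges \ B), t e) * (∏ e ∈ A ∩ (G.edges \ B), Ω e) *
        (∏ e ∈ A ∩ B, Ω e * t e ^ 2) * (∏ e ∈ (G.edges \ A) ∩ B, t e * Ω e ^ 2) *
        ∏ v : (G.partialDual A).Vertex,
          if Odd ((G.partialDual A).degree B v) then (2 : K) else 0 := by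
  set d : P.Edge ⊕ P.Edge → K :=
    Sum.elim (fun e => Ω e.1 / t e.1) (fun e => Ω e.1 * t e.1) with hd
  have hDR : P.D Ω t + P.R K =
      Matrix.fromBlocks (Matrix.fromBlocks (Matrix.diagonal d) 1 (-1) 0)
        (Matrix.fromRows 0 (P.incidence K)) (Matrix.fromCols 0 (-(P.incidence K).transpose))
        (P.α.map fun n : ℤ => (n : K)) := by
    have hD : P.D Ω t = Matrix.fromBlocks (Matrix.fromBlocks (Matrix.diagonal d) 0 0 0) 0 0 0 := by
      ext i j
      rcases i with (i | i) | i <;> rcases j with (j | j) | j <;>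
        simp [D, Matrix.diagonal_apply, hd]
    rw [hD, R, Matrix.fromBlocks_add, Matrix.fromBlocks_add]
    simp
  have hdet := (congrArg Matrix.det hDR).trans ((Matrix.det_hyperbolic_eq d (P.incidence K)
    (P.α.map fun n : ℤ => (n : K))).trans
      (Matrix.det_fromBlocks_diagonal_mul_expand d (P.incidence K) (-(P.incidence K).transpose) _))
  unfold HU
  rw [hdet, P.sum_support, Finset.mul_sum]
  refine Finset.sum_congr rfl fun A hA => ?_
  rw [Finset.mul_sum]
  refine Finset.sum_congr rfl fun B _ => ?_
  rw [← P.prod_mul_prod_support Ω t ht (Finset.mem_powerset.1 hA) B,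
    ← P.two_pow_mul_det_fromBlocks K A B]
  have h1 : (fun s => 1 - P.active K A B (Sum.inl s)) =
      fun s => if s ∈ P.support A B then 0 else 1 := by
    funext s
    rw [active_inl]
    split_ifs <;> simp
  have h2 : (fun s => P.active K A B (Sum.inl s)) =
      fun s => if s ∈ P.support A B then 1 else 0 := funext (P.active_inl A B)
  rw [h1, h2]
  ring

end Presentation

end RibbonGraph

theorem theorem5p3 {X : Type*} [Fintype X] [DecidableEq X] (G : RibbonGraph X) (o : G.Orientation)
    {C : Type*} [Fintype C] [DecidableEq C] (P : G.Presentation o C)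
    {K : Type*} [Field K] [Algebra ℝ K] (Ω t : Finset X → K) (ht : ∀ e ∈ G.edges, t e ≠ 0) :
    P.HU Ω t = G.Q t Ω (fun e => Ω e * t e ^ 2) (fun e => t e * Ω e ^ 2)
        (fun n => if Odd n then 2 else 0) ∧
    P.HU Ω t = ∑ A ∈ G.edges.powerset, ∑ B ∈ G.edges.powerset with G.Admissible A B,
      2 ^ (G.partialDual A).numVertices *
        (∏ e ∈ (G.edges \ A) ∩ (G.edges \ B), t e) *
        (∏ e ∈ (G.edges \ A) ∩ B, t e * Ω e ^ 2) *
        (∏ e ∈ A ∩ (G.edges \ B), Ω e) *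
        (∏ e ∈ A ∩ B, Ω e * t e ^ 2) := by
  rw [P.HU_eq_sum Ω t ht]
  constructor
  · unfold RibbonGraph.Q
    -- In `Q` the inner sum runs over subsets of the edges of the partial dual, which are the edges
    -- of `G`.
    simp only [RibbonGraph.edges_partialDual]
  · refine Finset.sum_congr rfl fun A _ => ?_
    rw [Finset.sum_filter]
    refine Finset.sum_congr rfl fun B _ => ?_
    rw [RibbonGraph.prod_odd_eq_ite_admissible]
    split_ifs
    · ring
    · rw [mul_zero]
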